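/- Let $W$ be a finite group generated by reflections of a Euclidean space $V_{\mathbb R}$ of dimension $\ell\ge 1$ on which $W$ acts irreducibly, let $V=\mathbb C\otimes V_{\mathbb R}$, and let $\mathcal S\subset W$ be the set of reflections, with roots $\alpha_s\in V$ ($s\in\mathcal S$). For a conjugation-invariant function $c:\mathcal S\to\mathbb C$ and $y\in V^*$ let $\nabla^{(c)}_y$ be the Dunkl operator on $S(V)$, $$\nabla^{(c)}_y(q)=\frac{\partial q}{\partial y}-\sum_{s\in\mathcal S}c(s)\,\langle y,\alpha_s\rangle\,\frac{q-s(q)}{\alpha_s}.$$ These operators commute, so $y\mapsto\nabla_y^{(c)}$ extends multiplicatively to $p\mapsto\nabla^{(c)}_p$, $p\in S(V^*)$. Call $c$ regular if no element of $S(V)$ of positive degree is annihilated by all $\nabla^{(c)}_y$, $y\in V^*$. For $d\ge 0$ let $\mathcal{QH}^{(c,d)}$ be the graded space of all $x\in S(V)$ such that $\nabla^{(c)}_p(x)=0$ for every homogeneous $W$-invariant $p\in S(V^*)$ with $0<\deg p<d$, and let $\mathcal{QH}^{(c,d)}_n=\mathcal{QH}^{(c,d)}\cap S^n(V)$. Let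 $c_1,\dots,c_k$ be variables indexed by the conjugacy classes $C_1,\dots,C_k$ of reflections, $\mathbb C[c]=\mathbb C[c_1,\dots,c_k]$, and let $\mathcal{QH}^{(\cdot,d)}_n\subset\mathbb C[c]\otimes S^n(V)$ be the space defined in the same way through the universal Dunkl operators over $\mathbb C[c]$, in which $c(s)$ is the variable $c_i$ for $s\in C_i$. The algebra $S(V^*)^W$ is generated by $\ell$ algebraically independent homogeneous elements; let $d_1\le\dots\le d_\ell$ be their degrees. **Proposition.** For each $i=1,\dots,\ell$ and each regular $c$, $$\dim\bigl(\mathcal{QH}^{(c,d_i)}_{d_i}\bigr)^W=\begin{cases}1,&\text{if } d_j\ne d_i \text{ for all } j\ne i,\\ 2,&\text{if } d_j=d_i\text{ for some } j\neq i;\end{cases}$$ for $i=\ell$ the dimension is always $1$. Therefore, if all $d_i$ are distinct, then for every $i=1,\dots,\ell$ there is a nonzero $W$-invariant $e^{(c)}_{d_i}\in\mathcal{QH}^{(\cdot,d_i)}_{d_i}$, unique up to proportionality: it can be chosen so that every $W$-invariant in $\mathcal{QH}^{(\cdot,d_i)}_{d_i}$ is a multiple of it by an element of $\mathbb C[c]$.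 Likewise, for every regular $c:\mathcal S\to\mathbb C$, there is a nonzero $W$-invariant in $\mathcal{QH}^{(c,d_i)}_{d_i}$, unique up to a scalar factor. -/

import Mathlib

namespace CoxeterQH

open MvPolynomial

/-- The Euclidean space `V_ℝ` of dimension `l`, with its orthonormal standard basis. -/
abbrev Euc (l : ℕ) := EuclideanSpace ℝ (Fin l)

/-- `w` is the orthogonal reflection in the hyperplane `αᗮ` for some nonzero vector `α`. -/
def IsReflection {l : ℕ} (w : Euc l ≃ₗᵢ[ℝ] Euc l) : Prop :=
  ∃ α : Euc l, α ≠ 0 ∧ w = (ℝ ∙ α)ᗮ.reflection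

/-- `W` is a finite group generated by reflections, and the `W`-module `V_ℝ` is irreducible. -/
structure IsIrreducibleReflectionGroup {l : ℕ} (W : Subgroup (Euc l ≃ₗᵢ[ℝ] Euc l)) : Prop where
  finite : Finite W
  generated : Subgroup.closure {w | w ∈ W ∧ IsReflection w} = W
  rank_pos : 0 < l
  irreducible : ∀ U : Submodule ℝ (Euc l),
    (∀ w ∈ W, ∀ u ∈ U, w u ∈ U) → U = ⊥ ∨ U = ⊤

/-- The set of reflections of `W`. -/
abbrev Refl {l : ℕ} (W : Subgroup (Euc l ≃ₗᵢ[ℝ] Euc l)) : Type :=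
  {s : Euc l ≃ₗᵢ[ℝ] Euc l // s ∈ W ∧ IsReflection s}

/-- Conjugacy of reflections under `W`. -/
def reflSetoid {l : ℕ} (W : Subgroup (Euc l ≃ₗᵢ[ℝ] Euc l)) : Setoid (Refl W) where
  r s t := ∃ τ ∈ W, t.1 = τ * s.1 * τ⁻¹
  iseqv :=
    { refl := fun s => ⟨1, W.one_mem, by simp⟩
      symm := by
        rintro s t ⟨τ, hτ, h⟩
        exact ⟨τ⁻¹, W.inv_mem hτ, by rw [h]; group⟩
      trans := by
        rintro s t u ⟨τ, hτ, h⟩ ⟨σ, hσ, h'⟩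
        exact ⟨σ * τ, W.mul_mem hσ hτ, by rw [h', h]; group⟩ }

/-- The set of conjugacy classes `C_1, …, C_k` of reflections of `W`. -/
abbrev ReflClass {l : ℕ} (W : Subgroup (Euc l ≃ₗᵢ[ℝ] Euc l)) : Type :=
  Quotient (reflSetoid W)

/-- A function on the reflections of `W` is conjugation-invariant. -/
def IsConjInvariant {l : ℕ} (W : Subgroup (Euc l ≃ₗᵢ[ℝ] Euc l)) {R : Type*}
    (c : Refl W → R) : Prop :=
  ∀ s t : Refl W, (∃ τ ∈ W, t.1 = τ * s.1 * τ⁻¹) → c t = c s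

/-- A root `α_s` of the reflection `s` (a nonzero vector with `s` the reflection in its orthogonal
hyperplane; nothing below depends on which one is taken). -/
noncomputable def root {l : ℕ} {W : Subgroup (Euc l ≃ₗᵢ[ℝ] Euc l)} (s : Refl W) : Euc l :=
  s.2.2.choose

section Polynomials

variable {l : ℕ} (R : Type*) [CommRing R] [Algebra ℂ R]

/-- A real vector `v ∈ V_ℝ` as an element of degree one of `R ⊗ S(V)`. Here `R ⊗ S(V)` is the
polynomial ring `MvPolynomial (Fin l) R`, the variable `X j` being the `j`-th standard basis
vector. -/
noncomputable def linForm (v : Euc l) : MvPolynomial (Fin l) R :=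
  ∑ k, C (algebraMap ℂ R ((v k : ℝ) : ℂ)) * X k

/-- The action of `w` on `R ⊗ S(V)` by algebra automorphisms that extends the action on `V`.
In `S(V*)`, also written as `MvPolynomial (Fin l) ℂ`, the variable `X j` is the `j`-th element of
the dual basis; since `w` is orthogonal, the dual action is given by the same formula. -/
noncomputable def act (w : Euc l ≃ₗᵢ[ℝ] Euc l) :
    MvPolynomial (Fin l) R →ₐ[R] MvPolynomial (Fin l) R :=
  aeval fun j => linForm R (w (EuclideanSpace.single j 1))

/-- The `W`-invariants of `R ⊗ S(V)`. -/
noncomputable def invariants (W : Subgroup (Euc l ≃ₗᵢ[ℝ] Euc l)) :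
    Submodule R (MvPolynomial (Fin l) R) where
  carrier := {x | ∀ w ∈ W, act R w x = x}
  add_mem' := by
    intro a b ha hb w hw
    rw [map_add, ha w hw, hb w hw]
  zero_mem' := fun w _ => map_zero _
  smul_mem' := by
    intro a x hx w hw
    rw [map_smul, hx w hw]

theorem root_spec {W : Subgroup (Euc l ≃ₗᵢ[ℝ] Euc l)} (s : Refl W) :
    root s ≠ 0 ∧ s.1 = (ℝ ∙ root s)ᗮ.reflection :=
  s.2.2.choose_spec

theorem linForm_sub_smul (a : ℝ) (v u : Euc l) :
    linForm R (v - a • u) =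
      linForm R v - linForm R u * C (algebraMap ℂ R (a : ℂ)) := by
  simp only [linForm, Finset.sum_mul, ← Finset.sum_sub_distrib]
  refine Finset.sum_congr rfl fun k _ => ?_
  simp only [PiLp.sub_apply, PiLp.smul_apply, smul_eq_mul, Complex.ofReal_sub,
    Complex.ofReal_mul, map_sub, map_mul]
  ring

theorem linForm_single (j : Fin l) :
    linForm R (EuclideanSpace.single j (1 : ℝ)) = X j := by
  rw [linForm, Finset.sum_eq_single j]
  · simp
  · intro k _ hk
    simp [hk]
  · simp

/-- `q - s(q)` is divisible by `α_s`. -/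
theorem exists_divDiff {W : Subgroup (Euc l ≃ₗᵢ[ℝ] Euc l)} (s : Refl W)
    (q : MvPolynomial (Fin l) R) :
    ∃ r, linForm R (root s) * r = q - act R s.1 q := by
  induction q using MvPolynomial.induction_on with
  | C a => exact ⟨0, by simp [act]⟩
  | add p q hp hq =>
    obtain ⟨r, hr⟩ := hp
    obtain ⟨t, ht⟩ := hq
    exact ⟨r + t, by rw [mul_add, hr, ht, map_add]; ring⟩
  | mul_X p j hp =>
    obtain ⟨r, hr⟩ := hp
    obtain ⟨a, ha⟩ : ∃ a : ℝ, s.1 (EuclideanSpace.single j 1) =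
        EuclideanSpace.single j (1 : ℝ) - a • root s := by
      refine ⟨2 * (inner ℝ (root s) (EuclideanSpace.single j (1 : ℝ)) / ‖root s‖ ^ 2), ?_⟩
      conv_lhs => rw [(root_spec s).2]
      rw [Submodule.reflection_orthogonal_apply, Submodule.reflection_singleton_apply, mul_smul,
        two_smul, two_smul]
      simp
    have hX : act R s.1 (X j) =
        X j - linForm R (root s) * C (algebraMap ℂ R (a : ℂ)) := by
      rw [act, aeval_X, ha, linForm_sub_smul, linForm_single]
    refine ⟨r * X j + act R s.1 p * C (algebraMap ℂ R (a : ℂ)), ?_⟩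
    rw [map_mul, hX]
    linear_combination X j * hr

theorem linForm_ne_zero [Nontrivial R] {v : Euc l} (hv : v ≠ 0) : linForm R v ≠ 0 := by
  intro h
  apply hv
  ext k
  have h1 : (linForm R v).coeff (Finsupp.single k 1) = algebraMap ℂ R ((v k : ℝ) : ℂ) := by
    rw [linForm, coeff_sum, Finset.sum_eq_single k]
    · simp [coeff_C_mul, coeff_X]
    · intro m _ hm
      rw [coeff_C_mul, coeff_X, if_neg, mul_zero]
      intro h2
      exact hm (Finsupp.single_left_injective one_ne_zero h2)
    · simp
  rw [h, coeff_zero] at h1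
  have h2 := (FaithfulSMul.algebraMap_injective ℂ R) (h1.symm.trans (map_zero _).symm)
  simpa using h2

variable {R} [IsDomain R]

theorem divDiff_unique {W : Subgroup (Euc l ≃ₗᵢ[ℝ] Euc l)} (s : Refl W)
    {a b : MvPolynomial (Fin l) R} (h : linForm R (root s) * a = linForm R (root s) * b) :
    a = b :=
  mul_left_cancel₀ (linForm_ne_zero R (root_spec s).1) h

/-- The operator `q ↦ (q - s(q)) / α_s`. -/
noncomputable def divDiff {W : Subgroup (Euc l ≃ₗᵢ[ℝ] Euc l)} (s : Refl W) :
    Module.End R (MvPolynomial (Fin l) R) where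
  toFun q := (exists_divDiff R s q).choose
  map_add' p q := by
    apply divDiff_unique s
    rw [mul_add, (exists_divDiff R s (p + q)).choose_spec, (exists_divDiff R s p).choose_spec,
      (exists_divDiff R s q).choose_spec, map_add]
    ring
  map_smul' a q := by
    apply divDiff_unique s
    rw [RingHom.id_apply, mul_smul_comm, (exists_divDiff R s (a • q)).choose_spec,
      (exists_divDiff R s q).choose_spec, map_smul, smul_sub]

/-- The Dunkl operator `∇_y q = ∂q/∂y - ∑_s c(s) ⟨y, α_s⟩ (q - s(q)) / α_s` on `R ⊗ S(V)`, where
`y ∈ R ⊗ V*` is given by its coordinates in the dual basis. -/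
noncomputable def dunkl {W : Subgroup (Euc l ≃ₗᵢ[ℝ] Euc l)} (c : Refl W → R) (y : Fin l → R) :
    Module.End R (MvPolynomial (Fin l) R) :=
  (∑ j, y j • (pderiv j : Derivation R (MvPolynomial (Fin l) R) _).toLinearMap) -
    ∑ᶠ s : Refl W, (c s * ∑ j, y j * algebraMap ℂ R ((root s j : ℝ) : ℂ)) • divDiff s

/-- The operator `∇_p` for `p ∈ S(V*)`: substitute the operators `∇_{y_1}, …, ∇_{y_l}` of the dual
basis for the variables of `p`. (These operators commute; in each monomial they are composed in
the order of the indices.) -/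
noncomputable def dunklPoly {W : Subgroup (Euc l ≃ₗᵢ[ℝ] Euc l)} (c : Refl W → R)
    (p : MvPolynomial (Fin l) ℂ) : Module.End R (MvPolynomial (Fin l) R) :=
  ∑ m ∈ p.support, algebraMap ℂ R (p.coeff m) •
    (List.ofFn fun i : Fin l => dunkl c (Pi.single i 1) ^ m i).prod

/-- The space `QH^(c,d)` of all `x ∈ R ⊗ S(V)` that are killed by `∇_p` for every homogeneous
`W`-invariant `p ∈ S(V*)` of positive degree less than `d`. -/
noncomputable def truncQH {W : Subgroup (Euc l ≃ₗᵢ[ℝ] Euc l)} (c : Refl W → R) (d : ℕ) :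
    Submodule R (MvPolynomial (Fin l) R) where
  carrier := {x | ∀ k, 0 < k → k < d → ∀ p ∈ invariants ℂ W, p.IsHomogeneous k →
    dunklPoly c p x = 0}
  add_mem' := by
    intro a b ha hb k hk hkd p hp hpk
    rw [map_add, ha k hk hkd p hp hpk, hb k hk hkd p hp hpk, add_zero]
  zero_mem' := fun _ _ _ _ _ _ => map_zero _
  smul_mem' := by
    intro a x hx k hk hkd p hp hpk
    rw [map_smul, hx k hk hkd p hp hpk, smul_zero]

/-- The space `(QH^(c,d)_n)^W` of `W`-invariants of degree `n` in `QH^(c,d)`. -/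
noncomputable def truncQHInv {W : Subgroup (Euc l ≃ₗᵢ[ℝ] Euc l)} (c : Refl W → R) (d n : ℕ) :
    Submodule R (MvPolynomial (Fin l) R) :=
  truncQH c d ⊓ homogeneousSubmodule (Fin l) R n ⊓ invariants R W

end Polynomials

/-- `c` is regular: a conjugation-invariant function for which no element of `S(V)` of positive
degree is annihilated by all Dunkl operators. -/
def IsRegularParam {l : ℕ} {W : Subgroup (Euc l ≃ₗᵢ[ℝ] Euc l)} (c : Refl W → ℂ) : Prop :=
  IsConjInvariant W c ∧
    ∀ x : MvPolynomial (Fin l) ℂ, (∀ y : Fin l → ℂ, dunkl c y x = 0) → x.totalDegree = 0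

/-- The universal parameter: `s ∈ C_i` goes to the variable `c_i` of `ℂ[c] = ℂ[c_1, …, c_k]`. -/
noncomputable def univParam {l : ℕ} (W : Subgroup (Euc l ≃ₗᵢ[ℝ] Euc l)) :
    Refl W → MvPolynomial (ReflClass W) ℂ :=
  fun s => X (Quotient.mk (reflSetoid W) s)

/-- `d_1 ≤ … ≤ d_l` are the degrees of a system of elementary invariants of `W`, that is, of
algebraically independent homogeneous generators of the algebra `S(V*)^W`. -/
def IsDegrees {l : ℕ} (W : Subgroup (Euc l ≃ₗᵢ[ℝ] Euc l)) (d : Fin l → ℕ) : Prop :=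
  Monotone d ∧ ∃ f : Fin l → MvPolynomial (Fin l) ℂ,
    (∀ i, (f i).IsHomogeneous (d i)) ∧ AlgebraicIndependent ℂ f ∧
      (Algebra.adjoin ℂ (Set.range f) : Set (MvPolynomial (Fin l) ℂ)) = invariants ℂ W

end CoxeterQH

open CoxeterQH

/-! Let `pair p x` be the constant term of `∇_p x`. In each degree `n` it is a `W`-invariant pairing
of `S^n(V*)` with `S^n(V)`. For regular `c` it is nondegenerate
(`IsRegularParam.pairMatrix_ne_zero`): if `x` of positive degree is orthogonal to everything, then
by induction on the degree every `∇_y x` vanishes. An invariant `x` of degree `n` lies in `QH^(c,n)`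
exactly when it is orthogonal to all products, of total degree `n`, of two invariants of positive
degree. So the space in question is dual to the degree `n` part of `I/I²`, where `I` is the ideal of
invariants without constant term in `S(V*)^W`, and its dimension is the number of `j` with `d_j = n`
(`finrank_truncQHInv`).

It remains to show that no degree occurs three times and that the largest occurs once
(`degree_multiplicity`). This is done without the classification, for `l ≥ 2`, by means of a
bipartite Coxeter element `w`. It has an eigenvector `v` off all reflecting hyperplanes, with
eigenvalue `lam` of finite order `h`. The gradients of the basic invariants at `v` form a basis of
eigenvectors of `w` with eigenvalues `lam ^ (d_i - 1)`. The eigenspaces of `w` have dimension at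
most two, since the Coxeter graph is a tree with at most three leaves; hence no triple degree.
Orthogonality of `w` produces a permutation `σ` with `d_i + d_(σ i) ≥ h + 2`; together with `∑ (d_i
- 1) = N`, the number of reflections, and `2 N ≤ h l`, this forces equality throughout. So the
indices of largest degree are matched with indices of degree 2, and irreducibility allows only one
invariant quadratic form.

Two classical facts are proved on the way. Chevalley's theorem gives the existence of the degrees
(`exists_isDegrees`). The Jacobian of the basic invariants is a multiple of the product of the roots
(`jacobian_eq`), which gives both the sum of the degrees and the independence of the gradients at
`v`.

Over `ℂ[c]` the determinants of the pairing are nonzero because they are nonzero at `c = 0`. When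
`d_i` is unrepeated, the invariants in question form a torsion-free module of rank one, and removing
the constant factors from any nonzero element gives a generator, `ℂ[c]` being factorial
(`exists_generator_univParam`). -/

namespace CoxeterQH

set_option linter.unusedSectionVars false

open MvPolynomial

/-! ### The action of `W` on polynomials, reflections and divided differences. -/

section Action

section Basics

variable {l : ℕ} (R : Type*) [CommRing R] [Algebra ℂ R]

/-- The matrix of `w` in the standard basis, with entries in `R`. -/
noncomputable def cmat (w : Euc l ≃ₗᵢ[ℝ] Euc l) : Matrix (Fin l) (Fin l) R :=
  fun k j => algebraMap ℂ R ((w (EuclideanSpace.single j 1) k : ℝ) : ℂ)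

theorem linForm_add (v u : Euc l) : linForm R (v + u) = linForm R v + linForm R u := by
  simp [linForm, add_mul, Finset.sum_add_distrib]

theorem linForm_smul (a : ℝ) (v : Euc l) :
    linForm R (a • v) = C (algebraMap ℂ R (a : ℂ)) * linForm R v := by
  simp [linForm, Finset.mul_sum, mul_assoc]

/-- `linForm` as an additive map. -/
noncomputable def linFormHom : Euc l →+ MvPolynomial (Fin l) R :=
  AddMonoidHom.mk' (linForm R) (linForm_add R)

theorem linForm_sum {ι : Type*} (s : Finset ι) (v : ι → Euc l) :
    linForm R (∑ i ∈ s, v i) = ∑ i ∈ s, linForm R (v i) :=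
  map_sum (linFormHom R) v s

theorem isometry_mul_apply (w u : Euc l ≃ₗᵢ[ℝ] Euc l) (x : Euc l) : (w * u) x = w (u x) := rfl

theorem euc_eq_sum (v : Euc l) : v = ∑ j, v j • EuclideanSpace.single j (1 : ℝ) := by
  ext k
  simp [Finset.sum_apply, Pi.single_apply]

theorem isometry_apply_coord (w : Euc l ≃ₗᵢ[ℝ] Euc l) (v : Euc l) (k : Fin l) :
    w v k = ∑ j, w (EuclideanSpace.single j 1) k * v j := by
  conv_lhs => rw [euc_eq_sum v]
  simp [Finset.sum_apply, mul_comm]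

theorem cmat_mulVec (w : Euc l ≃ₗᵢ[ℝ] Euc l) (v : Euc l) :
    (cmat R w).mulVec (fun j => algebraMap ℂ R ((v j : ℝ) : ℂ)) =
      fun k => algebraMap ℂ R ((w v k : ℝ) : ℂ) := by
  ext k
  rw [isometry_apply_coord w v k]
  simp [Matrix.mulVec, dotProduct, cmat]

theorem cmat_one : cmat R (1 : Euc l ≃ₗᵢ[ℝ] Euc l) = 1 := by
  ext k j
  simp only [cmat, LinearIsometryEquiv.coe_one, id, Matrix.one_apply]
  by_cases h : k = j <;> simp [h]

theorem cmat_mul (w u : Euc l ≃ₗᵢ[ℝ] Euc l) : cmat R (w * u) = cmat R w * cmat R u := by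
  ext k j
  have := congrFun (cmat_mulVec R w (u (EuclideanSpace.single j 1))) k
  exact this.symm

theorem single_inner (v : Euc l) (j : Fin l) :
    inner ℝ (EuclideanSpace.single j (1 : ℝ)) v = v j := by
  simp [EuclideanSpace.inner_single_left]

/-- Orthogonality of `w`; it is what lets one matrix serve for both `V` and `V*`. -/
theorem cmat_transpose (w : Euc l ≃ₗᵢ[ℝ] Euc l) : (cmat R w).transpose = cmat R w⁻¹ := by
  ext k j
  simp only [Matrix.transpose_apply, cmat]
  congr 2
  rw [← single_inner (w _) j, ← single_inner (w⁻¹ _) k, real_inner_comm,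
    LinearIsometryEquiv.inner_map_eq_flip]
  rfl

theorem cmat_mul_transpose (w : Euc l ≃ₗᵢ[ℝ] Euc l) :
    cmat R w * (cmat R w).transpose = 1 := by
  rw [cmat_transpose, ← cmat_mul, mul_inv_cancel, cmat_one]

theorem transpose_mul_cmat (w : Euc l ≃ₗᵢ[ℝ] Euc l) :
    (cmat R w).transpose * cmat R w = 1 := by
  rw [cmat_transpose, ← cmat_mul, inv_mul_cancel, cmat_one]

theorem act_X (w : Euc l ≃ₗᵢ[ℝ] Euc l) (j : Fin l) :
    act R w (X j) = linForm R (w (EuclideanSpace.single j 1)) := by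
  simp [act]

theorem act_X_eq_sum (w : Euc l ≃ₗᵢ[ℝ] Euc l) (j : Fin l) :
    act R w (X j) = ∑ k, C (cmat R w k j) * X k := by
  rw [act_X]; rfl

@[simp] theorem act_C (w : Euc l ≃ₗᵢ[ℝ] Euc l) (a : R) : act R w (C a) = C a := by
  simp [act]

theorem act_linForm (w : Euc l ≃ₗᵢ[ℝ] Euc l) (v : Euc l) :
    act R w (linForm R v) = linForm R (w v) := by
  conv_rhs => rw [euc_eq_sum v]
  rw [map_sum, linForm_sum]
  simp only [linForm, map_sum, map_mul, act_C]
  refine Finset.sum_congr rfl fun k _ => ?_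
  rw [map_smul, ← linForm, linForm_smul, act_X]

theorem act_mul (w u : Euc l ≃ₗᵢ[ℝ] Euc l) (p : MvPolynomial (Fin l) R) :
    act R (w * u) p = act R w (act R u p) := by
  have : act R (w * u) = (act R w).comp (act R u) := by
    apply MvPolynomial.algHom_ext
    intro j
    rw [AlgHom.comp_apply, act_X, act_X, act_linForm]
    rfl
  rw [this]; rfl

@[simp] theorem act_one (p : MvPolynomial (Fin l) R) : act R 1 p = p := by
  have : act R (1 : Euc l ≃ₗᵢ[ℝ] Euc l) = AlgHom.id R _ := by
    apply MvPolynomial.algHom_ext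
    intro j
    rw [act_X]
    exact linForm_single R j
  rw [this]; rfl

theorem linForm_isHomogeneous (v : Euc l) : (linForm R v).IsHomogeneous 1 :=
  IsHomogeneous.sum _ _ _ fun k _ => isHomogeneous_C_mul_X _ k

theorem act_isHomogeneous (w : Euc l ≃ₗᵢ[ℝ] Euc l) {p : MvPolynomial (Fin l) R} {n : ℕ}
    (hp : p.IsHomogeneous n) : (act R w p).IsHomogeneous n := by
  have := hp.aeval (fun j => linForm R (w (EuclideanSpace.single j 1)))
    (fun j => linForm_isHomogeneous R _)
  rwa [one_mul] at this

theorem act_homogeneousComponent (w : Euc l ≃ₗᵢ[ℝ] Euc l) (p : MvPolynomial (Fin l) R) (n : ℕ) :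
    homogeneousComponent n (act R w p) = act R w (homogeneousComponent n p) := by
  conv_lhs => rw [← sum_homogeneousComponent p]
  rw [map_sum, map_sum]
  have h : ∀ i, homogeneousComponent n (act R w (homogeneousComponent i p)) =
      if n = i then act R w (homogeneousComponent i p) else 0 := fun i =>
    homogeneousComponent_of_mem (act_isHomogeneous R w (homogeneousComponent_isHomogeneous i p))
  simp only [h, Finset.sum_ite_eq, Finset.mem_range]
  split_ifs with hn
  · rfl
  · rw [homogeneousComponent_eq_zero n p (by omega), map_zero]

theorem linForm_map {R' : Type*} [CommRing R'] [Algebra ℂ R'] (φ : R →ₐ[ℂ] R') (v : Euc l) :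
    map φ.toRingHom (linForm R v) = linForm R' v := by
  simp [linForm]

theorem act_map {R' : Type*} [CommRing R'] [Algebra ℂ R'] (φ : R →ₐ[ℂ] R')
    (w : Euc l ≃ₗᵢ[ℝ] Euc l) (p : MvPolynomial (Fin l) R) :
    map φ.toRingHom (act R w p) = act R' w (map φ.toRingHom p) := by
  induction p using MvPolynomial.induction_on with
  | C a => simp
  | add p q hp hq => simp only [map_add, hp, hq]
  | mul_X p j hp => rw [map_mul, map_mul, map_mul, map_mul, hp, act_X, linForm_map, map_X, act_X]

theorem pderiv_linForm (k : Fin l) (v : Euc l) :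
    pderiv k (linForm R v) = C (algebraMap ℂ R ((v k : ℝ) : ℂ)) := by
  simp only [linForm, map_sum, pderiv_C_mul, pderiv_X, Pi.single_apply]
  simp

/-- Chain rule for a linear substitution. Gradients of invariants therefore transform by the matrix
of `w`. -/
theorem pderiv_act (w : Euc l ≃ₗᵢ[ℝ] Euc l) (k : Fin l) (p : MvPolynomial (Fin l) R) :
    pderiv k (act R w p) = ∑ j, C (cmat R w k j) * act R w (pderiv j p) := by
  induction p using MvPolynomial.induction_on with
  | C a => simp
  | add p q hp hq => simp only [map_add, hp, hq, mul_add, Finset.sum_add_distrib]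
  | mul_X p i hp =>
    rw [map_mul, pderiv_mul, hp, act_X, pderiv_linForm]
    simp only [pderiv_mul, map_add, map_mul, mul_add, Finset.sum_add_distrib, pderiv_X, act_X]
    rw [Finset.sum_mul]
    congr 1
    · exact Finset.sum_congr rfl fun j _ => by ring
    · rw [Finset.sum_eq_single i]
      · simp [cmat, mul_comm]
      · intro j _ hj
        simp [Ne.symm hj]
      · simp

theorem eval_act (w : Euc l ≃ₗᵢ[ℝ] Euc l) (x : Fin l → R) (p : MvPolynomial (Fin l) R) :
    eval x (act R w p) = eval ((cmat R w).transpose.mulVec x) p := by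
  induction p using MvPolynomial.induction_on with
  | C a => simp
  | add p q hp hq => simp only [map_add, hp, hq]
  | mul_X p j hp =>
    rw [map_mul, map_mul, map_mul, hp, act_X_eq_sum]
    simp [Matrix.mulVec, dotProduct]

theorem homogeneousComponent_mul_of_left {σ S : Type*} [CommRing S] {a b : MvPolynomial σ S}
    {m : ℕ} (ha : a.IsHomogeneous m) (n : ℕ) :
    homogeneousComponent (m + n) (a * b) = a * homogeneousComponent n b := by
  conv_lhs => rw [← sum_homogeneousComponent b, Finset.mul_sum, map_sum]
  have h : ∀ i, homogeneousComponent (m + n) (a * homogeneousComponent i b) =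
      if n = i then a * homogeneousComponent i b else 0 := fun i => by
    rw [homogeneousComponent_of_mem (ha.mul (homogeneousComponent_isHomogeneous i b))]
    simp only [add_right_inj]
  simp only [h, Finset.sum_ite_eq, Finset.mem_range]
  split_ifs with hn
  · rfl
  · rw [homogeneousComponent_eq_zero n b (by omega), mul_zero]

theorem homogeneousComponent_mul_of_right {σ S : Type*} [CommRing S] {a b : MvPolynomial σ S}
    {m : ℕ} (hb : b.IsHomogeneous m) (n : ℕ) :
    homogeneousComponent (n + m) (a * b) = homogeneousComponent n a * b := by
  rw [mul_comm, add_comm, homogeneousComponent_mul_of_left hb, mul_comm]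

theorem homogeneousComponent_mul_eq_zero {σ S : Type*} [CommRing S] {a b : MvPolynomial σ S}
    {m : ℕ} (hb : b.IsHomogeneous m) {n : ℕ} (h : n < m) :
    homogeneousComponent n (a * b) = 0 := by
  rw [← sum_homogeneousComponent a, Finset.sum_mul, map_sum]
  refine Finset.sum_eq_zero fun i _ => ?_
  rw [homogeneousComponent_of_mem ((homogeneousComponent_isHomogeneous i a).mul hb),
    if_neg (by omega)]

theorem isHomogeneous_of_components {σ S : Type*} [CommRing S] {b : MvPolynomial σ S} {n : ℕ}
    (h : ∀ k, k ≠ n → homogeneousComponent k b = 0) : b.IsHomogeneous n := by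
  rw [← sum_homogeneousComponent b]
  refine IsHomogeneous.sum _ _ _ fun k _ => ?_
  by_cases hk : k = n
  · exact hk ▸ homogeneousComponent_isHomogeneous _ _
  · rw [h k hk]; exact isHomogeneous_zero _ _ _

theorem isHomogeneous_of_mul_left {σ S : Type*} [CommRing S] [IsDomain S] {a b : MvPolynomial σ S}
    {m n : ℕ} (ha : a.IsHomogeneous m) (ha0 : a ≠ 0) (h : (a * b).IsHomogeneous (m + n)) :
    b.IsHomogeneous n := by
  refine isHomogeneous_of_components fun k hk => ?_
  have h1 := homogeneousComponent_mul_of_left (b := b) ha k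
  rw [homogeneousComponent_of_mem h, if_neg (by omega)] at h1
  exact (mul_eq_zero.1 h1.symm).resolve_left ha0

end Basics

section Reflections

variable {l : ℕ} {W : Subgroup (Euc l ≃ₗᵢ[ℝ] Euc l)}

theorem finite_refl (hW : Finite W) : Finite (Refl W) :=
  Finite.of_injective (fun s : Refl W => (⟨s.1, s.2.1⟩ : W)) fun s t h => by
    simpa [Subtype.ext_iff] using h

theorem reflection_apply_of (a : Euc l) (x : Euc l) :
    (ℝ ∙ a)ᗮ.reflection x = x - (2 * inner ℝ a x / ‖a‖ ^ 2) • a := by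
  rw [Submodule.reflection_orthogonal_apply, Submodule.reflection_singleton_apply]
  rw [two_smul, neg_sub, ← add_smul]
  congr 2
  simp only [RCLike.ofReal_real_eq_id, id]
  ring

/-- The coroot coefficient functional of a reflection. -/
noncomputable def corootFn (s : Refl W) (x : Euc l) : ℝ :=
  2 * inner ℝ (root s) x / ‖root s‖ ^ 2

theorem refl_apply (s : Refl W) (x : Euc l) : s.1 x = x - corootFn s x • root s := by
  conv_lhs => rw [(root_spec s).2]
  exact reflection_apply_of _ _

theorem norm_root_ne_zero (s : Refl W) : ‖root s‖ ≠ 0 := norm_ne_zero_iff.2 (root_spec s).1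

theorem corootFn_root (s : Refl W) : corootFn s (root s) = 2 := by
  have := norm_root_ne_zero s
  rw [corootFn, real_inner_self_eq_norm_sq]
  field_simp

theorem refl_root (s : Refl W) : s.1 (root s) = -root s := by
  rw [refl_apply, corootFn_root, two_smul]; abel

theorem refl_refl (s : Refl W) (x : Euc l) : s.1 (s.1 x) = x := by
  have h := refl_apply s x
  have h2 := congrArg s.1 h
  rw [map_sub, map_smul, refl_root, h] at h2
  rw [h, h2]
  module

theorem refl_mul_self (s : Refl W) : s.1 * s.1 = 1 :=
  LinearIsometryEquiv.ext fun x => refl_refl s x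

theorem exists_smul_root (s : Refl W) {x : Euc l} (hx : s.1 x = -x) : ∃ a : ℝ, x = a • root s := by
  refine ⟨corootFn s x / 2, ?_⟩
  rw [refl_apply] at hx
  have : (2 : ℝ) • x = corootFn s x • root s := by
    rw [two_smul]
    rw [sub_eq_iff_eq_add] at hx
    nth_rewrite 1 [hx]; abel
  rw [div_eq_inv_mul, mul_smul, ← this, smul_smul]; norm_num

/-- Conjugation of reflections by an element of `W`. -/
noncomputable def conjRefl (w : Euc l ≃ₗᵢ[ℝ] Euc l) (hw : w ∈ W) (s : Refl W) : Refl W :=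
  ⟨w * s.1 * w⁻¹, W.mul_mem (W.mul_mem hw s.2.1) (W.inv_mem hw), w (root s), by
    simpa using (root_spec s).1, by
    ext1 x
    rw [reflection_apply_of, isometry_mul_apply, isometry_mul_apply,
      refl_apply, map_sub, map_smul, LinearIsometryEquiv.norm_map,
      LinearIsometryEquiv.inner_map_eq_flip]
    simp only [corootFn]
    congr 1
    exact LinearIsometryEquiv.apply_symm_apply w x⟩

/-- Conjugation as a permutation of the reflections. -/
noncomputable def conjReflEquiv (w : Euc l ≃ₗᵢ[ℝ] Euc l) (hw : w ∈ W) : Refl W ≃ Refl W where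
  toFun := conjRefl w hw
  invFun := conjRefl w⁻¹ (W.inv_mem hw)
  left_inv s := Subtype.ext (by simp only [conjRefl]; group)
  right_inv s := Subtype.ext (by simp only [conjRefl]; group)

theorem conjRefl_mul (w : Euc l ≃ₗᵢ[ℝ] Euc l) (hw : w ∈ W) (s : Refl W) :
    (conjRefl w hw s).1 * w = w * s.1 := by
  simp only [conjRefl]; group

/-- Roots are chosen separately for each reflection, so `w` respects them only up to a scalar; the
scalar exists because the `-1`-eigenspace of a reflection is a line. -/
theorem exists_root_conj (w : Euc l ≃ₗᵢ[ℝ] Euc l) (hw : w ∈ W) (s : Refl W) :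
    ∃ a : ℝ, a ≠ 0 ∧ w (root s) = a • root (conjRefl w hw s) := by
  have h : (conjRefl w hw s).1 (w (root s)) = -(w (root s)) := by
    rw [← isometry_mul_apply, conjRefl_mul, isometry_mul_apply, refl_root,
      map_neg]
  obtain ⟨a, ha⟩ := exists_smul_root _ h
  refine ⟨a, ?_, ha⟩
  rintro rfl
  rw [zero_smul] at ha
  exact (root_spec s).1 (by simpa using ha)

end Reflections

section DivDiff

variable {l : ℕ} {W : Subgroup (Euc l ≃ₗᵢ[ℝ] Euc l)} {R : Type*} [CommRing R] [Algebra ℂ R]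
  [IsDomain R]

theorem divDiff_spec (s : Refl W) (q : MvPolynomial (Fin l) R) :
    linForm R (root s) * divDiff s q = q - act R s.1 q :=
  (exists_divDiff R s q).choose_spec

theorem divDiff_eq_of_mul_eq {s : Refl W} {q r : MvPolynomial (Fin l) R}
    (h : linForm R (root s) * r = q - act R s.1 q) : divDiff s q = r :=
  divDiff_unique s ((divDiff_spec s q).trans h.symm)

/-- The twisted Leibniz rule. In particular divided differences are linear over the invariants,
which drives Chevalley's lemma below. -/
theorem divDiff_mul (s : Refl W) (p q : MvPolynomial (Fin l) R) :
    divDiff s (p * q) = divDiff s p * q + act R s.1 p * divDiff s q := by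
  apply divDiff_eq_of_mul_eq
  rw [map_mul]
  linear_combination q * divDiff_spec s p + act R s.1 p * divDiff_spec s q

theorem divDiff_eq_zero {s : Refl W} {q : MvPolynomial (Fin l) R} (h : act R s.1 q = q) :
    divDiff s q = 0 :=
  divDiff_eq_of_mul_eq (by rw [h]; ring)

theorem divDiff_X (s : Refl W) (k : Fin l) :
    divDiff s (X k : MvPolynomial (Fin l) R) =
      C (algebraMap ℂ R ((corootFn s (EuclideanSpace.single k 1) : ℝ) : ℂ)) := by
  apply divDiff_eq_of_mul_eq
  rw [act_X, refl_apply, linForm_sub_smul, linForm_single]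
  ring

theorem divDiff_isHomogeneous (s : Refl W) {q : MvPolynomial (Fin l) R} {n : ℕ}
    (hq : q.IsHomogeneous n) : (divDiff s q).IsHomogeneous (n - 1) := by
  -- In degree 0 the subtraction `n - 1` truncates, and the divided difference of a constant is
  -- zero.
  rcases Nat.eq_zero_or_pos n with rfl | hn
  · rw [← totalDegree_zero_iff_isHomogeneous, totalDegree_eq_zero_iff_eq_C] at hq
    rw [hq, divDiff_eq_zero (act_C _ _ _)]
    exact isHomogeneous_zero _ _ _
  · refine isHomogeneous_of_mul_left (linForm_isHomogeneous R (root s))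
      (linForm_ne_zero R (root_spec s).1) ?_
    rw [divDiff_spec, Nat.add_sub_cancel' hn]
    exact hq.sub (act_isHomogeneous R _ hq)

theorem divDiff_map {R' : Type*} [CommRing R'] [Algebra ℂ R'] [IsDomain R'] (φ : R →ₐ[ℂ] R')
    (s : Refl W) (q : MvPolynomial (Fin l) R) :
    map φ.toRingHom (divDiff s q) = divDiff s (map φ.toRingHom q) := by
  symm
  apply divDiff_eq_of_mul_eq
  rw [← linForm_map R φ, ← map_mul, divDiff_spec, map_sub, act_map]

theorem act_divDiff (w : Euc l ≃ₗᵢ[ℝ] Euc l) (hw : w ∈ W) (s : Refl W) {a : ℝ}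
    (ha : w (root s) = a • root (conjRefl w hw s)) (q : MvPolynomial (Fin l) R) :
    divDiff (conjRefl w hw s) (act R w q) =
      C (algebraMap ℂ R (a : ℂ)) * act R w (divDiff s q) := by
  apply divDiff_eq_of_mul_eq
  rw [← act_mul, conjRefl_mul, act_mul, ← map_sub, ← divDiff_spec s q, map_mul, act_linForm, ha,
    linForm_smul]
  ring

end DivDiff

end Action

/-! ### Dunkl operators: equivariance, commutativity, grading and base change. -/

section DunklOperators

section Dunkl

variable {l : ℕ} {W : Subgroup (Euc l ≃ₗᵢ[ℝ] Euc l)} {R : Type*} [CommRing R] [Algebra ℂ R]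
  [IsDomain R]

/-- The pairing of `y ∈ R ⊗ V*` with a real vector. -/
noncomputable def evalVec (y : Fin l → R) (v : Euc l) : R :=
  ∑ j, y j * algebraMap ℂ R ((v j : ℝ) : ℂ)

theorem evalVec_smul (y : Fin l → R) (a : ℝ) (v : Euc l) :
    evalVec y (a • v) = algebraMap ℂ R (a : ℂ) * evalVec y v := by
  simp only [evalVec, Finset.mul_sum, PiLp.smul_apply, smul_eq_mul, Complex.ofReal_mul, map_mul]
  exact Finset.sum_congr rfl fun j _ => by ring

theorem evalVec_cmat (w : Euc l ≃ₗᵢ[ℝ] Euc l) (y : Fin l → R) (v : Euc l) :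
    evalVec ((cmat R w).mulVec y) (w v) = evalVec y v := by
  have h1 : ∀ (z : Fin l → R) (u : Euc l),
      evalVec z u = dotProduct z (fun j => algebraMap ℂ R ((u j : ℝ) : ℂ)) := fun _ _ => rfl
  rw [h1, ← cmat_mulVec, h1, Matrix.dotProduct_mulVec, ← Matrix.mulVec_transpose,
    Matrix.mulVec_mulVec, transpose_mul_cmat, Matrix.one_mulVec]

/-- The derivative `∂/∂y`. -/
noncomputable def dirDeriv (y : Fin l → R) (q : MvPolynomial (Fin l) R) :
    MvPolynomial (Fin l) R :=
  ∑ j, C (y j) * pderiv j q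

theorem dunkl_apply [Fintype (Refl W)] (c : Refl W → R) (y : Fin l → R)
    (q : MvPolynomial (Fin l) R) :
    dunkl c y q = dirDeriv y q - ∑ s, C (c s * evalVec y (root s)) * divDiff s q := by
  rw [dunkl, finsum_eq_sum_of_fintype]
  simp only [LinearMap.sub_apply, LinearMap.sum_apply, LinearMap.smul_apply, dirDeriv, evalVec,
    smul_eq_C_mul]
  rfl

theorem dunkl_add [Finite (Refl W)] (c : Refl W → R) (y z : Fin l → R) :
    dunkl c (y + z) = dunkl c y + dunkl c z := by
  have := Fintype.ofFinite (Refl W)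
  refine LinearMap.ext fun q => ?_
  simp only [LinearMap.add_apply, dunkl_apply, dirDeriv, evalVec, Pi.add_apply, add_mul, mul_add,
    map_add, Finset.sum_add_distrib]
  ring

theorem dunkl_smul [Finite (Refl W)] (c : Refl W → R) (a : R) (y : Fin l → R) :
    dunkl c (a • y) = a • dunkl c y := by
  have := Fintype.ofFinite (Refl W)
  refine LinearMap.ext fun q => ?_
  have h : ∀ v, evalVec (a • y) v = a * evalVec y v := fun v => by
    simp only [evalVec, Finset.mul_sum, Pi.smul_apply, smul_eq_mul, mul_assoc]
  simp only [LinearMap.smul_apply, dunkl_apply, dirDeriv, h, Pi.smul_apply, smul_eq_mul,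
    smul_eq_C_mul, mul_sub, Finset.mul_sum, map_mul]
  congr 1 <;> exact Finset.sum_congr rfl fun j _ => by ring

/-- The Dunkl operators as a linear function of the direction. -/
noncomputable def dunklLin [Finite (Refl W)] (c : Refl W → R) :
    (Fin l → R) →ₗ[R] Module.End R (MvPolynomial (Fin l) R) where
  toFun := dunkl c
  map_add' := dunkl_add c
  map_smul' := dunkl_smul c

theorem dunkl_eq_sum [Finite (Refl W)] (c : Refl W → R) (y : Fin l → R) :
    dunkl c y = ∑ j, y j • dunkl c (Pi.single j 1) := by
  have h := LinearMap.pi_apply_eq_sum_univ (dunklLin c) y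
  simp only [dunklLin, LinearMap.coe_mk, AddHom.coe_mk] at h
  rw [h]
  refine Finset.sum_congr rfl fun j _ => ?_
  congr 2
  ext i
  simp [Pi.single_apply, eq_comm]

theorem dunkl_C [Finite (Refl W)] (c : Refl W → R) (y : Fin l → R) (a : R) :
    dunkl c y (C a) = 0 := by
  have := Fintype.ofFinite (Refl W)
  simp [dunkl_apply, dirDeriv, divDiff_eq_zero (act_C R _ a)]

theorem dunkl_isHomogeneous [Finite (Refl W)] (c : Refl W → R) (y : Fin l → R)
    {q : MvPolynomial (Fin l) R} {n : ℕ} (hq : q.IsHomogeneous n) :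
    (dunkl c y q).IsHomogeneous (n - 1) := by
  have := Fintype.ofFinite (Refl W)
  rw [dunkl_apply]
  exact (IsHomogeneous.sum _ _ _ fun j _ => (hq.pderiv).C_mul _).sub
    (IsHomogeneous.sum _ _ _ fun s _ => (divDiff_isHomogeneous s hq).C_mul _)

theorem dirDeriv_X_mul (y : Fin l → R) (k : Fin l) (q : MvPolynomial (Fin l) R) :
    dirDeriv y (X k * q) = X k * dirDeriv y q + C (y k) * q := by
  simp only [dirDeriv, pderiv_mul, mul_add, Finset.sum_add_distrib, pderiv_X, Finset.mul_sum]
  rw [add_comm]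
  congr 1
  · exact Finset.sum_congr rfl fun j _ => by ring
  · rw [Finset.sum_eq_single k]
    · simp
    · intro j _ hj
      simp [hj]
    · simp

/-- The commutator of `∇_y` with a coordinate, a defining relation of the rational Cherednik
algebra; commutativity is deduced from it by induction on the degree. -/
theorem dunkl_X_mul [Fintype (Refl W)] (c : Refl W → R) (y : Fin l → R) (k : Fin l)
    (q : MvPolynomial (Fin l) R) :
    dunkl c y (X k * q) = X k * dunkl c y q + C (y k) * q -
      ∑ s, C (c s * evalVec y (root s) *
        algebraMap ℂ R ((corootFn s (EuclideanSpace.single k 1) : ℝ) : ℂ)) * act R s.1 q := by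
  rw [dunkl_apply, dunkl_apply, dirDeriv_X_mul]
  have h : ∀ s : Refl W, divDiff s (X k * q) = X k * divDiff s q +
      C (algebraMap ℂ R ((corootFn s (EuclideanSpace.single k 1) : ℝ) : ℂ)) * act R s.1 q := by
    intro s
    rw [mul_comm, divDiff_mul, divDiff_X]; ring
  simp only [h, mul_add, Finset.sum_add_distrib, mul_sub, Finset.mul_sum, C_mul]
  have h2 : ∀ s : Refl W, C (c s) * C (evalVec y (root s)) * (X k * divDiff s q) =
    X k * (C (c s) * C (evalVec y (root s)) * divDiff s q) := fun s => by ring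
  simp only [h2, mul_assoc]
  ring

theorem act_dirDeriv (w : Euc l ≃ₗᵢ[ℝ] Euc l) (y : Fin l → R) (q : MvPolynomial (Fin l) R) :
    dirDeriv ((cmat R w).mulVec y) (act R w q) = act R w (dirDeriv y q) := by
  simp only [dirDeriv, pderiv_act, map_sum, map_mul, act_C, Finset.mul_sum, ← mul_assoc]
  rw [Finset.sum_comm]
  refine Finset.sum_congr rfl fun j _ => ?_
  rw [← Finset.sum_mul]
  congr 1
  simp only [← C_mul, ← map_sum]
  congr 1
  have h : (cmat R w).transpose.mulVec ((cmat R w).mulVec y) j = y j := by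
    rw [Matrix.mulVec_mulVec, transpose_mul_cmat, Matrix.one_mulVec]
  rw [← h]
  exact Finset.sum_congr rfl fun i _ => mul_comm _ _

/-- Conjugation by `w` permutes the reflections and `c` is constant on the orbits. The rescaling of
a root by `w` cancels between the factor `⟨y, α_s⟩` and the denominator `α_s`. -/
theorem act_dunkl [Finite (Refl W)] {c : Refl W → R} (hc : IsConjInvariant W c)
    (w : Euc l ≃ₗᵢ[ℝ] Euc l) (hw : w ∈ W) (y : Fin l → R) (q : MvPolynomial (Fin l) R) :
    dunkl c ((cmat R w).mulVec y) (act R w q) = act R w (dunkl c y q) := by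
  have := Fintype.ofFinite (Refl W)
  rw [dunkl_apply, dunkl_apply, act_dirDeriv, map_sub, map_sum]
  congr 1
  rw [← (conjReflEquiv w hw).sum_comp]
  refine Finset.sum_congr rfl fun s _ => ?_
  obtain ⟨a, ha0, ha⟩ := exists_root_conj w hw s
  have h1 : c (conjReflEquiv w hw s) = c s := hc _ _ ⟨w, hw, rfl⟩
  rw [h1]
  change C (c s * evalVec _ (root (conjRefl w hw s))) * divDiff (conjRefl w hw s) _ = _
  rw [act_divDiff w hw s ha, ← mul_assoc, ← C_mul, mul_assoc, mul_comm (evalVec _ _),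
    ← evalVec_smul, ← ha, evalVec_cmat]
  simp only [map_mul, act_C]

theorem mulVec_refl (s : Refl W) (y : Fin l → R) :
    (cmat R s.1).mulVec y = y - evalVec y (root s) • fun k =>
      algebraMap ℂ R ((corootFn s (EuclideanSpace.single k 1) : ℝ) : ℂ) := by
  have hs : (cmat R s.1) = (cmat R s.1).transpose := by
    rw [cmat_transpose, ← eq_inv_of_mul_eq_one_left (refl_mul_self s)]
  ext k
  rw [hs]
  simp only [Matrix.mulVec, dotProduct, Matrix.transpose_apply, cmat, refl_apply, Pi.sub_apply,
    Pi.smul_apply, smul_eq_mul, PiLp.sub_apply, PiLp.smul_apply, evalVec, Finset.sum_mul]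
  have h : ∀ x, algebraMap ℂ R (((EuclideanSpace.single k (1 : ℝ) : Euc l) x -
      corootFn s (EuclideanSpace.single k 1) * root s x : ℝ) : ℂ) * y x =
      (if x = k then y x else 0) - y x * algebraMap ℂ R ((root s x : ℝ) : ℂ) *
        algebraMap ℂ R ((corootFn s (EuclideanSpace.single k 1) : ℝ) : ℂ) := by
    intro x
    by_cases hx : x = k
    · simp [hx]; ring
    · simp [hx]; ring
  rw [Finset.sum_congr rfl fun x _ => h x, Finset.sum_sub_distrib]
  simp

theorem corootFn_single (s : Refl W) (k : Fin l) :
    corootFn s (EuclideanSpace.single k 1) = 2 / ‖root s‖ ^ 2 * root s k := by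
  rw [corootFn, real_inner_comm, single_inner]; ring

theorem dunkl_C_mul (c : Refl W → R) (y : Fin l → R) (a : R) (p : MvPolynomial (Fin l) R) :
    dunkl c y (C a * p) = C a * dunkl c y p := by
  rw [← smul_eq_C_mul, map_smul, smul_eq_C_mul]

theorem dunkl_X_mul' [Fintype (Refl W)] (c : Refl W → R) (y : Fin l → R) (k : Fin l)
    (q : MvPolynomial (Fin l) R) :
    dunkl c y (X k * q) = X k * dunkl c y q + C (y k) * q -
      ∑ s, C (c s * algebraMap ℂ R ((corootFn s (EuclideanSpace.single k 1) : ℝ) : ℂ)) *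
        (C (evalVec y (root s)) * act R s.1 q) := by
  rw [dunkl_X_mul]
  congr 1
  refine Finset.sum_congr rfl fun s _ => ?_
  rw [← mul_assoc, ← C_mul, mul_right_comm]

theorem dunkl_dunkl_X_mul [Fintype (Refl W)] (c : Refl W → R) (u v : Fin l → R) (k : Fin l)
    (q : MvPolynomial (Fin l) R) :
    dunkl c u (dunkl c v (X k * q)) =
      X k * dunkl c u (dunkl c v q) + C (u k) * dunkl c v q + C (v k) * dunkl c u q -
      ∑ s, C (c s * algebraMap ℂ R ((corootFn s (EuclideanSpace.single k 1) : ℝ) : ℂ)) *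
        (C (evalVec u (root s)) * act R s.1 (dunkl c v q) +
          C (evalVec v (root s)) * dunkl c u (act R s.1 q)) := by
  rw [dunkl_X_mul' c v, map_sub, map_add, dunkl_X_mul' c u, map_sum, dunkl_C_mul]
  simp only [dunkl_C_mul, mul_add, Finset.sum_add_distrib]
  abel

/-- Equivariance gives `s ∇_z = ∇_(s z) s`, and `s z` differs from `z` by `⟨z, α_s⟩` times the
coroot; the correction thus carries the factor `⟨z, α_s⟩`. -/
theorem act_dunkl_comm [Finite (Refl W)] {c : Refl W → R} (hc : IsConjInvariant W c) (s : Refl W)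
    (z : Fin l → R) (q : MvPolynomial (Fin l) R) :
    act R s.1 (dunkl c z q) = dunkl c z (act R s.1 q) - C (evalVec z (root s)) *
      dunkl c (fun k => algebraMap ℂ R ((corootFn s (EuclideanSpace.single k 1) : ℝ) : ℂ))
        (act R s.1 q) := by
  rw [← act_dunkl hc s.1 s.2.1, mulVec_refl, sub_eq_add_neg, dunkl_add, ← neg_smul, dunkl_smul,
    LinearMap.add_apply, LinearMap.smul_apply, smul_eq_C_mul, map_neg, neg_mul, ← sub_eq_add_neg]

/-- Dunkl operators commute. -/
theorem dunkl_comm [Finite (Refl W)] {c : Refl W → R} (hc : IsConjInvariant W c)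
    (y z : Fin l → R) (q : MvPolynomial (Fin l) R) :
    dunkl c y (dunkl c z q) = dunkl c z (dunkl c y q) := by
  have := Fintype.ofFinite (Refl W)
  induction q using MvPolynomial.induction_on with
  | C a => simp [dunkl_C]
  | add p q hp hq => simp only [map_add, hp, hq]
  | mul_X q k hq =>
    rw [mul_comm q, dunkl_dunkl_X_mul, dunkl_dunkl_X_mul, hq]
    -- The contribution of each reflection is symmetric in `y` and `z`: moving `s` past `∇_z`
    -- produces a correction which, multiplied by `⟨y, α_s⟩`, contains the symmetric product `⟨y,
    -- α_s⟩ ⟨z, α_s⟩`.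
    have h : ∀ s : Refl W,
        C (evalVec y (root s)) * act R s.1 (dunkl c z q) +
              C (evalVec z (root s)) * dunkl c y (act R s.1 q) =
        C (evalVec z (root s)) * act R s.1 (dunkl c y q) +
              C (evalVec y (root s)) * dunkl c z (act R s.1 q) := by
      intro s
      rw [act_dunkl_comm hc, act_dunkl_comm hc]
      generalize dunkl c _ (act R s.1 q) = a1
      generalize dunkl c y (act R s.1 q) = a2
      generalize dunkl c z (act R s.1 q) = a3
      generalize (C (evalVec y (root s)) : MvPolynomial (Fin l) R) = a4
      ring
    rw [Finset.sum_congr rfl fun s _ => by rw [h s], add_right_comm]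

theorem dunkl_commute [Finite (Refl W)] {c : Refl W → R} (hc : IsConjInvariant W c)
    (y z : Fin l → R) : Commute (dunkl c y) (dunkl c z) :=
  LinearMap.ext fun q => dunkl_comm hc y z q

/-- The commutative algebra generated by the Dunkl operators. -/
noncomputable abbrev dunklAlgebra (c : Refl W → R) :
    Subalgebra ℂ (Module.End R (MvPolynomial (Fin l) R)) :=
  Algebra.adjoin ℂ (Set.range fun j => dunkl c (Pi.single j 1))

open scoped IsMulCommutative in
/-- The homomorphism `p ↦ ∇_p`. -/
noncomputable def dunklHom [Finite (Refl W)] {c : Refl W → R} (hc : IsConjInvariant W c) :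
    MvPolynomial (Fin l) ℂ →ₐ[ℂ] Module.End R (MvPolynomial (Fin l) R) :=
  -- Substitution into a polynomial needs a commutative target, so it takes place in the algebra
  -- generated by the Dunkl operators, which is then included in the endomorphisms.
  haveI : IsMulCommutative (dunklAlgebra c) := Algebra.isMulCommutative_adjoin ℂ (by
    rintro _ ⟨i, rfl⟩ _ ⟨j, rfl⟩
    exact dunkl_commute hc _ _)
  (dunklAlgebra c).val.comp (aeval fun j : Fin l =>
    (⟨dunkl c (Pi.single j 1), Algebra.subset_adjoin ⟨j, rfl⟩⟩ : dunklAlgebra c))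

theorem dunklHom_X [Finite (Refl W)] {c : Refl W → R} (hc : IsConjInvariant W c) (j : Fin l) :
    dunklHom hc (X j) = dunkl c (Pi.single j 1) := by
  simp [dunklHom]

theorem dunklHom_monomial [Finite (Refl W)] {c : Refl W → R} (hc : IsConjInvariant W c)
    (m : Fin l →₀ ℕ) (a : ℂ) : dunklHom hc (monomial m a) = algebraMap ℂ R a •
      (List.ofFn fun i : Fin l => dunkl c (Pi.single i 1) ^ m i).prod := by
  have h : (monomial m a : MvPolynomial (Fin l) ℂ) =
      a • (List.ofFn fun i : Fin l => (X i : MvPolynomial (Fin l) ℂ) ^ m i).prod := by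
    rw [monomial_eq, smul_eq_C_mul, List.prod_ofFn, Finsupp.prod_fintype]
    simp
  rw [h, map_smul, map_list_prod, List.map_ofFn, algebraMap_smul]
  congr 3
  ext1 i
  simp [dunklHom_X]

theorem dunklPoly_eq [Finite (Refl W)] {c : Refl W → R} (hc : IsConjInvariant W c)
    (p : MvPolynomial (Fin l) ℂ) : dunklPoly c p = dunklHom hc p := by
  conv_rhs => rw [p.as_sum, map_sum]
  exact Finset.sum_congr rfl fun m _ => (dunklHom_monomial hc m _).symm

theorem dunklHom_act [Finite (Refl W)] {c : Refl W → R} (hc : IsConjInvariant W c)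
    (w : Euc l ≃ₗᵢ[ℝ] Euc l) (hw : w ∈ W) (p : MvPolynomial (Fin l) ℂ)
    (q : MvPolynomial (Fin l) R) :
    dunklHom hc (act ℂ w p) (act R w q) = act R w (dunklHom hc p q) := by
  induction p using MvPolynomial.induction_on generalizing q with
  | C a =>
    rw [act_C, ← MvPolynomial.algebraMap_eq, AlgHom.commutes]
    simp only [Module.algebraMap_end_apply, ← algebraMap_smul R a, map_smul]
  | add p r hp hr => simp only [map_add, LinearMap.add_apply, hp, hr]
  | mul_X p j hp =>
    rw [map_mul, map_mul, map_mul, Module.End.mul_apply, Module.End.mul_apply, ← hp, dunklHom_X,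
      ← act_dunkl hc w hw, act_X_eq_sum, map_sum]
    congr 1
    rw [dunkl_eq_sum c ((cmat R w).mulVec _), LinearMap.sum_apply, LinearMap.sum_apply]
    refine Finset.sum_congr rfl fun k _ => ?_
    rw [map_mul, dunklHom_X, ← MvPolynomial.algebraMap_eq, AlgHom.commutes,
      Module.End.mul_apply, Module.algebraMap_end_apply, LinearMap.smul_apply]
    rw [Matrix.mulVec_single_one, ← algebraMap_smul R (cmat ℂ w k j)]
    rfl

/-- For `k > n` the subtraction truncates, and the claim is only that the result is constant. -/
theorem dunklHom_isHomogeneous [Finite (Refl W)] {c : Refl W → R} (hc : IsConjInvariant W c)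
    {p : MvPolynomial (Fin l) ℂ} {k : ℕ} (hp : p.IsHomogeneous k)
    {q : MvPolynomial (Fin l) R} {n : ℕ} (hq : q.IsHomogeneous n) :
    (dunklHom hc p q).IsHomogeneous (n - k) := by
  have hpow : ∀ (j : Fin l) (k : ℕ) {q : MvPolynomial (Fin l) R} {n : ℕ}, q.IsHomogeneous n →
      ((dunkl c (Pi.single j 1) ^ k) q).IsHomogeneous (n - k) := by
    intro j k
    induction k with
    | zero => intro q n hq; simpa using hq
    | succ k ih =>
      intro q n hq
      rw [pow_succ', Module.End.mul_apply]
      simpa [Nat.sub_sub] using dunkl_isHomogeneous c (Pi.single j 1) (ih hq)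
  have hmon : ∀ (L : List (Fin l)) (m : Fin l → ℕ) {q : MvPolynomial (Fin l) R} {n : ℕ},
      q.IsHomogeneous n → ((L.map fun i => dunkl c (Pi.single i 1) ^ m i).prod q).IsHomogeneous
        (n - (L.map m).sum) := by
    intro L m
    induction L with
    | nil => intro q n hq; simpa using hq
    | cons i L ih =>
      intro q n hq
      rw [List.map_cons, List.prod_cons, Module.End.mul_apply, List.map_cons, List.sum_cons,
        add_comm, ← Nat.sub_sub]
      exact hpow i _ (ih hq)
  rw [p.as_sum, map_sum, LinearMap.sum_apply]
  refine IsHomogeneous.sum _ _ _ fun m hm => ?_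
  rw [dunklHom_monomial, LinearMap.smul_apply, smul_eq_C_mul]
  refine IsHomogeneous.C_mul ?_ _
  rw [List.ofFn_eq_map]
  have h := hmon (List.finRange l) m hq
  have hk : ((List.finRange l).map m).sum = k := by
    rw [← List.ofFn_eq_map, List.sum_ofFn, ← hp (mem_support_iff.1 hm), Finsupp.weight_apply,
      Finsupp.sum_fintype]
    · simp
    · simp
  rwa [hk] at h

theorem dunkl_map [Finite (Refl W)] {R' : Type*} [CommRing R'] [Algebra ℂ R'] [IsDomain R']
    (φ : R →ₐ[ℂ] R') (c : Refl W → R) (y : Fin l → R) (q : MvPolynomial (Fin l) R) :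
    map φ.toRingHom (dunkl c y q) =
      dunkl (fun s => φ (c s)) (fun j => φ (y j)) (map φ.toRingHom q) := by
  have := Fintype.ofFinite (Refl W)
  rw [dunkl_apply, dunkl_apply, map_sub, map_sum, dirDeriv, dirDeriv, map_sum]
  simp only [map_mul, map_C, divDiff_map, ← pderiv_map, evalVec, map_sum]
  simp

/-- Used to specialize the universal parameter to numerical values. -/
theorem dunklHom_map [Finite (Refl W)] {R' : Type*} [CommRing R'] [Algebra ℂ R'] [IsDomain R']
    (φ : R →ₐ[ℂ] R') {c : Refl W → R} (hc : IsConjInvariant W c)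
    (hc' : IsConjInvariant W (fun s => φ (c s))) (p : MvPolynomial (Fin l) ℂ)
    (q : MvPolynomial (Fin l) R) :
    map φ.toRingHom (dunklHom hc p q) = dunklHom hc' p (map φ.toRingHom q) := by
  induction p using MvPolynomial.induction_on generalizing q with
  | C a =>
    rw [← MvPolynomial.algebraMap_eq, AlgHom.commutes, AlgHom.commutes]
    simp only [Module.algebraMap_end_apply, ← algebraMap_smul R a, ← algebraMap_smul R' a,
      smul_eq_C_mul, map_mul, map_C]
    simp
  | add p r hp hr => simp only [map_add, LinearMap.add_apply, hp, hr]
  | mul_X p j hp =>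
    rw [map_mul, map_mul, Module.End.mul_apply, Module.End.mul_apply, hp, dunklHom_X, dunklHom_X,
      dunkl_map]
    congr 3
    ext i
    by_cases h : i = j <;> simp [h]

end Dunkl

end DunklOperators

/-! ### Averaging, Chevalley's lemma on relations and generators of the invariants. -/

section InvariantTheory

section Reynolds

variable {l : ℕ} (W : Subgroup (Euc l ≃ₗᵢ[ℝ] Euc l)) [Finite W] (R : Type*) [CommRing R]
  [Algebra ℂ R]

/-- The averaging operator over `W`. -/
noncomputable def reynolds : MvPolynomial (Fin l) R →ₗ[R] MvPolynomial (Fin l) R :=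
  letI := Fintype.ofFinite W
  algebraMap ℂ R (Fintype.card W : ℂ)⁻¹ • ∑ w : W, (act R w.1).toLinearMap

theorem reynolds_apply [Fintype W] (p : MvPolynomial (Fin l) R) :
    reynolds W R p = C (algebraMap ℂ R (Fintype.card W : ℂ)⁻¹) * ∑ w : W, act R w.1 p := by
  rw [← smul_eq_C_mul]
  simp only [reynolds, LinearMap.smul_apply, LinearMap.sum_apply, AlgHom.toLinearMap_apply]
  congr!

theorem reynolds_mem (p : MvPolynomial (Fin l) R) : reynolds W R p ∈ invariants R W := by
  have := Fintype.ofFinite W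
  intro w hw
  rw [reynolds_apply, map_mul, act_C, map_sum]
  refine congrArg _ (Fintype.sum_equiv (Equiv.mulLeft (⟨w, hw⟩ : W)) _ _ fun u => ?_)
  exact (act_mul R w u.1 p).symm

theorem C_card_inv_mul [Fintype W] (p : MvPolynomial (Fin l) R) :
    C (algebraMap ℂ R (Fintype.card W : ℂ)⁻¹) * (Fintype.card W • p) = p := by
  rw [nsmul_eq_mul, ← mul_assoc, ← map_natCast (C : R →+* MvPolynomial (Fin l) R), ← C_mul,
    ← map_natCast (algebraMap ℂ R), ← map_mul, inv_mul_cancel₀, map_one, C_1, one_mul]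
  exact Nat.cast_ne_zero.2 Fintype.card_ne_zero

theorem reynolds_of_mem {p : MvPolynomial (Fin l) R} (hp : p ∈ invariants R W) :
    reynolds W R p = p := by
  have := Fintype.ofFinite W
  rw [reynolds_apply, Finset.sum_congr rfl fun w _ => hp w.1 w.2, Finset.sum_const,
    Finset.card_univ, C_card_inv_mul]

theorem reynolds_isHomogeneous {p : MvPolynomial (Fin l) R} {n : ℕ} (hp : p.IsHomogeneous n) :
    (reynolds W R p).IsHomogeneous n := by
  have := Fintype.ofFinite W
  rw [reynolds_apply]
  exact (IsHomogeneous.sum _ _ _ fun w _ => act_isHomogeneous R _ hp).C_mul _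

theorem reynolds_mul_of_mem {g : MvPolynomial (Fin l) R} (hg : g ∈ invariants R W)
    (p : MvPolynomial (Fin l) R) : reynolds W R (g * p) = g * reynolds W R p := by
  have := Fintype.ofFinite W
  have h : ∀ w : W, act R w.1 (g * p) = g * act R w.1 p := fun w => by
    rw [map_mul, hg w.1 w.2]
  rw [reynolds_apply, reynolds_apply, Finset.sum_congr rfl fun w _ => h w, ← Finset.mul_sum,
    mul_left_comm]

end Reynolds

section InvariantIdeal

variable {l : ℕ} (W : Subgroup (Euc l ≃ₗᵢ[ℝ] Euc l))

theorem C_mem_invariants (R : Type*) [CommRing R] [Algebra ℂ R] (a : R) :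
    (C a : MvPolynomial (Fin l) R) ∈ invariants R W := fun w _ => act_C R w a

theorem mul_mem_invariants {R : Type*} [CommRing R] [Algebra ℂ R] {p q : MvPolynomial (Fin l) R}
    (hp : p ∈ invariants R W) (hq : q ∈ invariants R W) : p * q ∈ invariants R W :=
  fun w hw => by rw [map_mul, hp w hw, hq w hw]

theorem homogeneousComponent_mem_invariants {R : Type*} [CommRing R] [Algebra ℂ R]
    {p : MvPolynomial (Fin l) R} (hp : p ∈ invariants R W) (n : ℕ) :
    homogeneousComponent n p ∈ invariants R W :=
  fun w hw => by rw [← act_homogeneousComponent, hp w hw]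

/-- The invariants as a subalgebra. -/
noncomputable def invSubalgebra : Subalgebra ℂ (MvPolynomial (Fin l) ℂ) where
  carrier := invariants ℂ W
  mul_mem' := mul_mem_invariants W
  add_mem' := (invariants ℂ W).add_mem
  algebraMap_mem' a := C_mem_invariants W ℂ a

/-- The ideal generated by the homogeneous invariants of positive degree. -/
noncomputable def invIdeal : Ideal (MvPolynomial (Fin l) ℂ) :=
  Ideal.span {p | p ∈ invariants ℂ W ∧ ∃ n, 0 < n ∧ p.IsHomogeneous n}

attribute [local instance] MvPolynomial.gradedAlgebra in
theorem homogeneousComponent_mem_span {σ K : Type*} [CommRing K] {G : Set (MvPolynomial σ K)}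
    (hG : ∀ g ∈ G, ∃ n, g.IsHomogeneous n) {p : MvPolynomial σ K} (hp : p ∈ Ideal.span G) (n : ℕ) :
    homogeneousComponent n p ∈ Ideal.span G :=
  homogeneousComponent_mem_of_mem (Ideal.homogeneous_span _ _ hG) hp n

theorem mem_invIdeal_of_coeff_zero {p : MvPolynomial (Fin l) ℂ} (hp : p ∈ invariants ℂ W)
    (h0 : coeff 0 p = 0) : p ∈ invIdeal W := by
  rw [← sum_homogeneousComponent p]
  refine Ideal.sum_mem _ fun n _ => ?_
  rcases Nat.eq_zero_or_pos n with rfl | hn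
  · rw [homogeneousComponent_zero, h0, C_0]; exact zero_mem _
  · exact Ideal.subset_span ⟨homogeneousComponent_mem_invariants W hp n, n, hn,
      homogeneousComponent_isHomogeneous n p⟩

theorem coeff_zero_of_mem_invIdeal {p : MvPolynomial (Fin l) ℂ} (hp : p ∈ invIdeal W) :
    coeff 0 p = 0 := by
  have h : invIdeal W ≤ RingHom.ker (constantCoeff : MvPolynomial (Fin l) ℂ →+* ℂ) := by
    refine Ideal.span_le.2 ?_
    rintro q ⟨_, n, hn, hq⟩
    exact hq.coeff_eq_zero (by simpa using hn.ne)
  exact h hp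

theorem act_mem_invIdeal {w : Euc l ≃ₗᵢ[ℝ] Euc l} (hw : w ∈ W) {p : MvPolynomial (Fin l) ℂ}
    (hp : p ∈ invIdeal W) : act ℂ w p ∈ invIdeal W := by
  have h : invIdeal W ≤ (invIdeal W).comap (act ℂ w) := by
    refine Ideal.span_le.2 fun q hq => ?_
    change act ℂ w q ∈ invIdeal W
    rw [hq.1 w hw]
    exact Ideal.subset_span hq
  exact h hp

variable {W}

/-- The ideal is `W`-stable, so being fixed modulo it can be tested on generators of the group. -/
theorem act_sub_mem_of_refl (hgen : Subgroup.closure {w | w ∈ W ∧ IsReflection w} = W)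
    {p : MvPolynomial (Fin l) ℂ} (hp : ∀ s : Refl W, p - act ℂ s.1 p ∈ invIdeal W)
    {w : Euc l ≃ₗᵢ[ℝ] Euc l} (hw : w ∈ W) : p - act ℂ w p ∈ invIdeal W := by
  have hw' := hw
  rw [← hgen] at hw
  induction hw using Subgroup.closure_induction'' with
  | mem x hx => exact hp ⟨x, hx⟩
  | inv_mem x hx =>
    have h := act_mem_invIdeal W (W.inv_mem hx.1) (hp ⟨x, hx⟩)
    rw [map_sub, ← act_mul, inv_mul_cancel, act_one] at h
    rw [← neg_sub]
    exact neg_mem h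
  | one => simp
  | mul x y hx hy h1 h2 =>
    rw [hgen] at hx hy
    rw [act_mul]
    have h3 := add_mem (h1 hx) (act_mem_invIdeal W hx (h2 hy))
    rwa [map_sub, sub_add_sub_cancel] at h3

theorem totalDegree_divDiff_lt (s : Refl W) {q : MvPolynomial (Fin l) ℂ} (hq : q.totalDegree ≠ 0) :
    (divDiff s q).totalDegree < q.totalDegree := by
  refine lt_of_le_of_lt ?_ (Nat.sub_lt (Nat.pos_of_ne_zero hq) one_pos)
  conv_lhs => rw [← sum_homogeneousComponent q, map_sum]
  refine (totalDegree_finsetSum _ _).trans (Finset.sup_le fun n hn => ?_)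
  refine (divDiff_isHomogeneous s (homogeneousComponent_isHomogeneous n q)).totalDegree_le.trans ?_
  rw [Finset.mem_range] at hn
  omega

/-- Chevalley's lemma on relations between invariants. -/
theorem mem_invIdeal_of_relation [Finite W]
    (hgen : Subgroup.closure {w | w ∈ W ∧ IsReflection w} = W)
    {ι : Type*} [Fintype ι] {g : ι → MvPolynomial (Fin l) ℂ} (hg : ∀ i, g i ∈ invariants ℂ W)
    {e : ι → ℕ} (he : ∀ i, (g i).IsHomogeneous (e i)) {i₀ : ι}
    (h₀ : g i₀ ∉ Ideal.span (g '' {i | i ≠ i₀})) (p : ι → MvPolynomial (Fin l) ℂ)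
    (hp : ∑ i, g i * p i = 0) : p i₀ ∈ invIdeal W := by
  classical
  have := Fintype.ofFinite W
  -- Induction on the degree of the coefficient `p i₀`, over all relations at once: a divided
  -- difference turns a relation into one with a coefficient of lower degree.
  induction hn : (p i₀).totalDegree using Nat.strong_induction_on generalizing p with
  | _ n ih =>
  have h1 : ∀ s : Refl W, p i₀ - act ℂ s.1 (p i₀) ∈ invIdeal W := by
    intro s
    rw [← divDiff_spec s]
    refine Ideal.mul_mem_left _ _ ?_
    by_cases hq : (p i₀).totalDegree = 0
    · rw [totalDegree_eq_zero_iff_eq_C.1 hq, divDiff_eq_zero (act_C _ _ _)]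
      exact zero_mem _
    · refine ih _ (hn ▸ totalDegree_divDiff_lt s hq) (fun i => divDiff s (p i)) ?_ rfl
      have h2 := congrArg (divDiff s) hp
      rw [map_sum, map_zero] at h2
      rw [← h2]
      refine Finset.sum_congr rfl fun i _ => ?_
      rw [divDiff_mul, divDiff_eq_zero (hg i s.1 s.2.1), hg i s.1 s.2.1, zero_mul, zero_add]
  -- Modulo the ideal `p i₀` is fixed by all reflections, hence by `W`, hence equals its average; an
  -- invariant is congruent to its constant term `a`.
  have h2 : p i₀ - reynolds W ℂ (p i₀) ∈ invIdeal W := by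
    have h3 : p i₀ - reynolds W ℂ (p i₀) = C (algebraMap ℂ ℂ (Fintype.card W : ℂ)⁻¹) *
        ∑ w : W, (p i₀ - act ℂ w.1 (p i₀)) := by
      rw [Finset.sum_sub_distrib, mul_sub, Finset.sum_const, Finset.card_univ, C_card_inv_mul,
        reynolds_apply]
    rw [h3]
    exact Ideal.mul_mem_left _ _ (Ideal.sum_mem _ fun w _ => act_sub_mem_of_refl hgen h1 w.2)
  set a := coeff 0 (reynolds W ℂ (p i₀)) with ha
  have h4 : reynolds W ℂ (p i₀) - C a ∈ invIdeal W :=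
    mem_invIdeal_of_coeff_zero W
      ((invariants ℂ W).sub_mem (reynolds_mem W ℂ _) (C_mem_invariants W ℂ a)) (by simp [ha])
  have h5 : p i₀ - C a ∈ invIdeal W := by
    have := add_mem h2 h4
    rwa [sub_add_sub_cancel] at this
  suffices a = 0 by rwa [this, C_0, sub_zero] at h5
  by_contra ha0
  refine h₀ ?_
  -- If `a ≠ 0`, the component of the relation in degree `e i₀` is `a * g i₀` plus elements of the
  -- ideal of the other `g i`, because `p i₀ - a` has no constant term. This contradicts the
  -- assumption on `g i₀`.
  have h6 : ∑ i ∈ Finset.univ.erase i₀, g i * p i ∈ Ideal.span (g '' {i | i ≠ i₀}) :=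
    Ideal.sum_mem _ fun i hi => Ideal.mul_mem_right _ _
      (Ideal.subset_span ⟨i, (Finset.mem_erase.1 hi).1, rfl⟩)
  have h7 := homogeneousComponent_mem_span (by rintro _ ⟨i, _, rfl⟩; exact ⟨_, he i⟩) h6 (e i₀)
  have h8 : ∑ i ∈ Finset.univ.erase i₀, g i * p i = -(g i₀ * (p i₀ - C a)) - g i₀ * C a := by
    rw [← Finset.add_sum_erase _ _ (Finset.mem_univ i₀)] at hp
    linear_combination hp
  rw [h8, map_sub, map_neg, ← add_zero (e i₀), homogeneousComponent_mul_of_left (he i₀),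
    homogeneousComponent_mul_of_left (he i₀), homogeneousComponent_zero, homogeneousComponent_zero,
    coeff_zero_of_mem_invIdeal W h5, C_0, mul_zero, neg_zero, zero_sub, coeff_C, if_pos rfl] at h7
  have h9 := Ideal.mul_mem_right (C (-a⁻¹)) _ h7
  rwa [neg_mul, mul_assoc, ← C_mul, ← mul_neg, ← C_neg, mul_neg, neg_neg, mul_inv_cancel₀ ha0, C_1,
    mul_one] at h9

/-- A minimal homogeneous system of invariant generators of the ideal `invIdeal W`. -/
structure MinimalInvariants (W : Subgroup (Euc l ≃ₗᵢ[ℝ] Euc l)) (ι : Type*) where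
  f : ι → MvPolynomial (Fin l) ℂ
  deg : ι → ℕ
  mem : ∀ i, f i ∈ invariants ℂ W
  pos : ∀ i, 0 < deg i
  hom : ∀ i, (f i).IsHomogeneous (deg i)
  span : Ideal.span (Set.range f) = invIdeal W
  minimal : ∀ i, f i ∉ Ideal.span (f '' {j | j ≠ i})

/-- A finite generating subset of `G` of least cardinality. -/
theorem exists_minimal_span {A : Type*} [CommRing A] [IsNoetherianRing A] (G : Set A) :
    ∃ t : Finset A, (t : Set A) ⊆ G ∧ Ideal.span (t : Set A) = Ideal.span G ∧
      ∀ x ∈ t, x ∉ Ideal.span ((t : Set A) \ {x}) := by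
  classical
  have h : ∃ n, ∃ t : Finset A, ((t : Set A) ⊆ G ∧ Ideal.span (t : Set A) = Ideal.span G) ∧
      t.card = n := by
    obtain ⟨t, h1, h2⟩ := (Submodule.fg_span_iff_fg_span_finset_subset G).1
      (IsNoetherian.noetherian (Ideal.span G))
    exact ⟨_, t, ⟨h1, h2.symm⟩, rfl⟩
  obtain ⟨t, ⟨h1, h2⟩, h3⟩ := Nat.find_spec h
  refine ⟨t, h1, h2, fun x hx hx' => ?_⟩
  refine Nat.find_min h (m := (t.erase x).card) (h3 ▸ Finset.card_erase_lt_of_mem hx)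
    ⟨t.erase x, ⟨(Finset.coe_subset.2 (Finset.erase_subset _ _)).trans h1, ?_⟩, rfl⟩
  rw [← h2, Finset.coe_erase]
  refine le_antisymm (Ideal.span_mono Set.sdiff_subset) (Ideal.span_le.2 fun y hy => ?_)
  by_cases hyx : y = x
  · rw [hyx]; exact hx'
  · exact Ideal.subset_span ⟨hy, hyx⟩

theorem exists_minimalInvariants (W : Subgroup (Euc l ≃ₗᵢ[ℝ] Euc l)) :
    ∃ t : Finset (MvPolynomial (Fin l) ℂ), Nonempty (MinimalInvariants W t) := by
  obtain ⟨t, h1, h2, h3⟩ := exists_minimal_span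
    {p | p ∈ invariants ℂ W ∧ ∃ n, 0 < n ∧ p.IsHomogeneous n}
  choose d hd hd' using fun i : t => (h1 i.2).2
  refine ⟨t, ⟨⟨fun i => i.1, d, fun i => (h1 i.2).1, hd, hd', ?_, fun i hi => h3 i.1 i.2 ?_⟩⟩⟩
  · rw [Subtype.range_coe_subtype]
    exact h2
  · suffices h : (t : Set (MvPolynomial (Fin l) ℂ)) \ {i.1} = (fun i : t => i.1) '' {j | j ≠ i} by
      rwa [h]
    ext x
    constructor
    · rintro ⟨hx, hxi⟩
      exact ⟨⟨x, hx⟩, fun h => hxi (by rw [← h]; rfl), rfl⟩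
    · rintro ⟨j, hj, rfl⟩
      exact ⟨j.2, fun h => hj (Subtype.ext h)⟩

theorem exists_sum_of_mem_span_range {A ι : Type*} [CommRing A] [Fintype ι] {f : ι → A} {x : A}
    (hx : x ∈ Ideal.span (Set.range f)) : ∃ a : ι → A, x = ∑ i, a i * f i := by
  obtain ⟨a, ha⟩ := Submodule.mem_span_range_iff_exists_fun A |>.1 hx
  exact ⟨a, by simpa using ha.symm⟩

namespace MinimalInvariants

variable {ι : Type*} [Fintype ι] (D : MinimalInvariants W ι)

include D in
theorem ideal_coeffs {p : MvPolynomial (Fin l) ℂ} (hp : p ∈ invIdeal W) :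
    ∃ a : ι → MvPolynomial (Fin l) ℂ, p = ∑ i, a i * D.f i :=
  exists_sum_of_mem_span_range (D.span ▸ hp)

/-- Hilbert's argument. Write a homogeneous invariant as a combination of the generators of the
ideal and average: the coefficients become invariants of smaller degree, to which induction applies.
-/
theorem adjoin_eq [Finite W] : Algebra.adjoin ℂ (Set.range D.f) = invSubalgebra W := by
  refine le_antisymm (Algebra.adjoin_le ?_) ?_
  · rintro _ ⟨i, rfl⟩
    exact D.mem i
  have key : ∀ n, ∀ p ∈ invariants ℂ W, p.IsHomogeneous n →
      p ∈ Algebra.adjoin ℂ (Set.range D.f) := by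
    intro n
    induction n using Nat.strong_induction_on with
    | _ n ih =>
    intro p hp hpn
    rcases Nat.eq_zero_or_pos n with rfl | hn
    · rw [totalDegree_eq_zero_iff_eq_C.1 ((totalDegree_zero_iff_isHomogeneous _).2 hpn)]
      exact Subalgebra.algebraMap_mem _ _
    · obtain ⟨a, ha⟩ := D.ideal_coeffs (Ideal.subset_span ⟨hp, n, hn, hpn⟩)
      have h1 : p = ∑ i, homogeneousComponent n (a i * D.f i) := by
        rw [← map_sum, ← ha, homogeneousComponent_eq_self hpn]
      have h2 : p = ∑ i, reynolds W ℂ (homogeneousComponent n (a i * D.f i)) := by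
        rw [← map_sum, ← h1, reynolds_of_mem W ℂ hp]
      rw [h2]
      refine Subalgebra.sum_mem _ fun i _ => ?_
      by_cases hi : D.deg i ≤ n
      · obtain ⟨k, rfl⟩ := Nat.exists_eq_add_of_le' hi
        rw [homogeneousComponent_mul_of_right (D.hom i), mul_comm, reynolds_mul_of_mem W ℂ (D.mem i)]
        refine Subalgebra.mul_mem _ (Algebra.subset_adjoin ⟨i, rfl⟩) ?_
        exact ih k (by have := D.pos i; omega) _ (reynolds_mem W ℂ _)
          (reynolds_isHomogeneous W ℂ (homogeneousComponent_isHomogeneous _ _))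
      · rw [homogeneousComponent_mul_eq_zero (D.hom i) (not_le.1 hi), map_zero]
        exact zero_mem _
  intro p hp
  rw [← sum_homogeneousComponent p]
  exact Subalgebra.sum_mem _ fun n _ => key n _ (homogeneousComponent_mem_invariants W hp n)
    (homogeneousComponent_isHomogeneous n p)

end MinimalInvariants

end InvariantIdeal

end InvariantTheory

/-! ### Chevalley's theorem: the invariants form a polynomial algebra in `l` generators. -/

section ElementaryInvariants

section WeightedSubstitution

variable {σ ι K : Type*} [CommRing K] {f : ι → MvPolynomial σ K} {d : ι → ℕ}

theorem aeval_monomial_isHomogeneous (hf : ∀ i, (f i).IsHomogeneous (d i)) (m : ι →₀ ℕ) (a : K) :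
    (aeval f (monomial m a)).IsHomogeneous (Finsupp.weight d m) := by
  rw [aeval_monomial, MvPolynomial.algebraMap_eq, Finsupp.weight_apply]
  refine IsHomogeneous.C_mul (IsHomogeneous.prod _ _ _ fun i _ => ?_) _
  change (f i ^ m i).IsHomogeneous (m i * d i)
  rw [mul_comm]
  exact (hf i).pow _

theorem aeval_isHomogeneous_of_weighted (hf : ∀ i, (f i).IsHomogeneous (d i))
    {H : MvPolynomial ι K} {n : ℕ} (hH : H.IsWeightedHomogeneous d n) :
    (aeval f H).IsHomogeneous n := by
  rw [H.as_sum, map_sum]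
  refine IsHomogeneous.sum _ _ _ fun m hm => ?_
  rw [← hH (mem_support_iff.1 hm)]
  exact aeval_monomial_isHomogeneous hf m _

theorem homogeneousComponent_aeval (hf : ∀ i, (f i).IsHomogeneous (d i)) (H : MvPolynomial ι K)
    (n : ℕ) :
    homogeneousComponent n (aeval f H) = aeval f (weightedHomogeneousComponent d n H) := by
  conv_lhs => rw [H.as_sum]
  conv_rhs => rw [H.as_sum]
  simp only [map_sum]
  refine Finset.sum_congr rfl fun m _ => ?_
  rw [homogeneousComponent_of_mem (aeval_monomial_isHomogeneous hf m _),
    weightedHomogeneousComponent_of_mem (isWeightedHomogeneous_monomial d m _ rfl)]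
  split_ifs
  · rfl
  · rw [map_zero]

theorem pderiv_aeval (f : ι → MvPolynomial σ K) [Fintype ι] (k : σ) (H : MvPolynomial ι K) :
    pderiv k (aeval f H) = ∑ i, aeval f (pderiv i H) * pderiv k (f i) := by
  classical
  induction H using MvPolynomial.induction_on with
  | C a => simp [MvPolynomial.algebraMap_eq]
  | add p q hp hq => simp only [map_add, hp, hq, add_mul, Finset.sum_add_distrib]
  | mul_X p j hp =>
    simp only [map_mul, pderiv_mul, hp, aeval_X, map_add, add_mul, Finset.sum_add_distrib]
    congr 1
    · rw [Finset.sum_mul]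
      exact Finset.sum_congr rfl fun i _ => by ring
    · rw [Finset.sum_eq_single j]
      · simp
      · intro i _ hi
        simp [hi.symm]
      · simp

theorem pderiv_eq_zero_of_weight_lt {H : MvPolynomial ι K} {n : ℕ}
    (hH : H.IsWeightedHomogeneous d n) {i : ι} (hi : n < d i) : pderiv i H = 0 := by
  classical
  ext m
  rw [coeff_pderiv, hH.coeff_eq_zero, zero_mul, coeff_zero]
  rw [map_add, Finsupp.weight_single, one_smul]
  omega

theorem eq_C_of_pderiv_eq_zero {K : Type*} [Field K] [CharZero K] {H : MvPolynomial ι K}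
    (hH : ∀ i, pderiv i H = 0) : H = C (coeff 0 H) := by
  classical
  ext m
  rw [coeff_C]
  split_ifs with h
  · rw [h]
  · obtain ⟨i, hi⟩ : ∃ i, m i ≠ 0 := by
      by_contra! h'
      exact h (Finsupp.ext fun i => (h' i).symm)
    have h1 := congrArg (coeff (m - Finsupp.single i 1)) (hH i)
    have h2 : m - Finsupp.single i 1 + Finsupp.single i 1 = m :=
      tsub_add_cancel_of_le (by simpa using Nat.one_le_iff_ne_zero.2 hi)
    rw [coeff_pderiv, h2, coeff_zero] at h1
    refine (mul_eq_zero.1 h1).resolve_right ?_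
    exact Nat.cast_add_one_ne_zero _

end WeightedSubstitution

variable {l : ℕ} {W : Subgroup (Euc l ≃ₗᵢ[ℝ] Euc l)}

namespace MinimalInvariants

variable {ι : Type*} [Fintype ι] (D : MinimalInvariants W ι)

-- The contradiction that ends the proof of Chevalley's theorem. On the right the coefficient of `f
-- i₀` has no constant term because of the factors `X k`; so in degree `deg i₀` only the left side
-- contributes a multiple of `f i₀`, which then lies in the ideal of the others, against minimality.
include D in
theorem not_mem_of_euler (i₀ : ι) (a : ι → MvPolynomial (Fin l) ℂ) (ha : a i₀ = 1)
    (q : Fin l → MvPolynomial (Fin l) ℂ) (hq : ∀ k, q k ∈ invIdeal W) :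
    ∑ i, a i * (D.deg i • D.f i) ≠ ∑ k, X k * q k := by
  classical
  intro h
  choose b hb using fun k => D.ideal_coeffs (hq k)
  have h1 : ∑ k, X k * q k = ∑ i, (∑ k, X k * b k i) * D.f i := by
    simp only [Finset.sum_mul]
    rw [Finset.sum_comm]
    refine Finset.sum_congr rfl fun k _ => ?_
    rw [hb k, Finset.mul_sum]
    exact Finset.sum_congr rfl fun i _ => by ring
  rw [h1, ← Finset.add_sum_erase _ _ (Finset.mem_univ i₀),
    ← Finset.add_sum_erase _ _ (Finset.mem_univ i₀), ha, one_mul] at h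
  have h2 : D.deg i₀ • D.f i₀ - (∑ k, X k * b k i₀) * D.f i₀ ∈
      Ideal.span (D.f '' {j | j ≠ i₀}) := by
    have h3 : D.deg i₀ • D.f i₀ - (∑ k, X k * b k i₀) * D.f i₀ =
        ∑ i ∈ Finset.univ.erase i₀, ((∑ k, X k * b k i) - C (D.deg i : ℂ) * a i) * D.f i := by
      simp only [sub_mul, Finset.sum_sub_distrib]
      rw [sub_eq_sub_iff_add_eq_add, add_comm]
      rw [← sub_eq_zero] at h ⊢
      rw [← h]
      have h4 : ∀ i, a i * (D.deg i • D.f i) = C (D.deg i : ℂ) * a i * D.f i := fun i => by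
        rw [nsmul_eq_mul, map_natCast]; ring
      rw [Finset.sum_congr rfl fun i _ => h4 i]
      ring
    rw [h3]
    exact Ideal.sum_mem _ fun i hi => Ideal.mul_mem_left _ _
      (Ideal.subset_span ⟨i, (Finset.mem_erase.1 hi).1, rfl⟩)
  have h5 := homogeneousComponent_mem_span (by rintro _ ⟨i, _, rfl⟩; exact ⟨_, D.hom i⟩) h2
    (D.deg i₀)
  have h6 : homogeneousComponent (0 + D.deg i₀) ((∑ k, X k * b k i₀) * D.f i₀) = 0 := by
    rw [homogeneousComponent_mul_of_right (D.hom i₀), homogeneousComponent_zero]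
    have : coeff 0 (∑ k, X k * b k i₀) = 0 := by
      rw [← constantCoeff_eq, map_sum]
      simp
    rw [this, C_0, zero_mul]
  rw [zero_add] at h6
  rw [map_sub, h6, sub_zero, map_nsmul, homogeneousComponent_eq_self (D.hom i₀)] at h5
  refine D.minimal i₀ ?_
  have h7 := Ideal.mul_mem_left _ (C (D.deg i₀ : ℂ)⁻¹) h5
  rwa [nsmul_eq_mul, ← map_natCast (C : ℂ →+* MvPolynomial (Fin l) ℂ), ← mul_assoc, ← C_mul,
    inv_mul_cancel₀ (Nat.cast_ne_zero.2 (D.pos i₀).ne'), C_1, one_mul] at h7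

/-- Differentiating the relation `H(f) = 0` gives `∑ i, h i * ∂_k (f i) = 0` with `h i = (∂_i H)(f)`
invariant. If all `h i` vanish, the `∂_i H` are relations of smaller weight and induction makes `H`
constant. If not, Chevalley's lemma, applied to a minimal set of generators of the ideal of the `h
i`, contradicts the minimality of the `f i` through Euler's identity. -/
theorem eq_zero_of_aeval_eq_zero [Finite W]
    (hgen : Subgroup.closure {w | w ∈ W ∧ IsReflection w} = W) (n : ℕ) (H : MvPolynomial ι ℂ)
    (hH : H.IsWeightedHomogeneous D.deg n) (h0 : aeval D.f H = 0) : H = 0 := by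
  classical
  induction n using Nat.strong_induction_on generalizing H with
  | _ n ih =>
  set h : ι → MvPolynomial (Fin l) ℂ := fun i => aeval D.f (pderiv i H) with hh
  have hhom : ∀ i, (h i).IsHomogeneous (n - D.deg i) := by
    intro i
    by_cases hi : D.deg i ≤ n
    · exact aeval_isHomogeneous_of_weighted D.hom (hH.pderiv (Nat.sub_add_cancel hi))
    · simp only [hh, pderiv_eq_zero_of_weight_lt hH (not_le.1 hi), map_zero]
      exact isHomogeneous_zero _ _ _
  have hinv : ∀ i, h i ∈ invariants ℂ W := by
    intro i
    have : h i ∈ Algebra.adjoin ℂ (Set.range D.f) := by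
      rw [Algebra.adjoin_range_eq_range_aeval]
      exact ⟨_, rfl⟩
    rw [D.adjoin_eq] at this
    exact this
  by_cases hz : ∀ i, h i = 0
  · have h1 : ∀ i, pderiv i H = 0 := by
      intro i
      by_cases hi : D.deg i ≤ n
      · exact ih _ (Nat.sub_lt ((D.pos i).trans_le hi) (D.pos i)) _
          (hH.pderiv (Nat.sub_add_cancel hi)) (hz i)
      · exact pderiv_eq_zero_of_weight_lt hH (not_le.1 hi)
    have h2 := eq_C_of_pderiv_eq_zero h1
    rw [h2, aeval_C, MvPolynomial.algebraMap_eq, C_eq_zero] at h0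
    rw [h2, h0, C_0]
  · exfalso
    obtain ⟨t, ht1, ht2, ht3⟩ := exists_minimal_span (Set.range h)
    choose s hs using fun x : t => ht1 x.2
    have hmem : ∀ i, ∃ a : t → MvPolynomial (Fin l) ℂ, h i = ∑ x, a x * x.1 := fun i =>
      exists_sum_of_mem_span_range (f := fun x : t => x.1) (by
        rw [Subtype.range_coe_subtype]
        change h i ∈ Ideal.span (t : Set (MvPolynomial (Fin l) ℂ))
        rw [ht2]
        exact Ideal.subset_span ⟨i, rfl⟩)
    obtain ⟨x₀⟩ : Nonempty t := by
      by_contra hne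
      rw [not_nonempty_iff] at hne
      refine hz fun i => ?_
      obtain ⟨a, ha⟩ := hmem i
      rw [ha, Finset.univ_eq_empty, Finset.sum_empty]
    -- The expansion of the generator `x₀`, that is of `h (s x₀)`, is taken to be the trivial one,
    -- so that one coefficient is exactly 1.
    have hmem' : ∀ i, ∃ a : t → MvPolynomial (Fin l) ℂ, h i = ∑ x, a x * x.1 ∧
        (i = s x₀ → a x₀ = 1) := by
      intro i
      by_cases hi : i = s x₀
      · refine ⟨Pi.single x₀ 1, ?_, fun _ => by simp⟩
        rw [hi, hs, Finset.sum_eq_single x₀] <;> simp +contextual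
      · obtain ⟨a, ha⟩ := hmem i
        exact ⟨a, ha, fun h => absurd h hi⟩
    choose a ha ha' using hmem'
    -- The differentiated relation, regrouped by the generators in `t`, is a relation between
    -- invariants to which Chevalley's lemma applies at `x₀`.
    have hrel : ∀ k, ∑ i, a i x₀ * pderiv k (D.f i) ∈ invIdeal W := by
      intro k
      refine mem_invIdeal_of_relation hgen (g := fun x : t => x.1)
        (e := fun x => n - D.deg (s x)) (fun x => hs x ▸ hinv _) (fun x => hs x ▸ hhom _)
        (i₀ := x₀) ?_ (fun x => ∑ i, a i x * pderiv k (D.f i)) ?_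
      · intro hx
        refine ht3 x₀.1 x₀.2 (Ideal.span_mono ?_ hx)
        rintro _ ⟨y, hy, rfl⟩
        exact ⟨y.2, fun h => hy (Subtype.ext h)⟩
      · have h1 := congrArg (pderiv k) h0
        rw [pderiv_aeval, map_zero] at h1
        rw [← h1]
        simp only [Finset.mul_sum]
        rw [Finset.sum_comm]
        refine Finset.sum_congr rfl fun i _ => ?_
        change _ = h i * _
        rw [ha i, Finset.sum_mul]
        exact Finset.sum_congr rfl fun x _ => by ring
    -- Multiplying by `X k` and summing over `k`, Euler's identity replaces the derivatives of `f i`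
    -- by `deg i • f i`.
    refine D.not_mem_of_euler (s x₀) (fun i => a i x₀) (ha' _ rfl) _ hrel ?_
    simp only [Finset.mul_sum]
    rw [Finset.sum_comm]
    refine Finset.sum_congr rfl fun i _ => ?_
    rw [← (D.hom i).sum_X_mul_pderiv, Finset.mul_sum]
    exact Finset.sum_congr rfl fun k _ => by ring

/-- The `f i` are homogeneous, so every component of a relation for the weights `deg i` is itself a
relation. -/
theorem algebraicIndependent [Finite W]
    (hgen : Subgroup.closure {w | w ∈ W ∧ IsReflection w} = W) :
    AlgebraicIndependent ℂ D.f := by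
  rw [algebraicIndependent_iff]
  intro H hH
  ext m
  have h1 := D.eq_zero_of_aeval_eq_zero hgen (Finsupp.weight D.deg m)
    (weightedHomogeneousComponent D.deg _ H)
    (weightedHomogeneousComponent_isWeightedHomogeneous _ _)
    (by rw [← homogeneousComponent_aeval D.hom, hH, map_zero])
  have h2 := congrArg (coeff m) h1
  rwa [coeff_weightedHomogeneousComponent, if_pos rfl] at h2

end MinimalInvariants

/-- The action of `W` on `S(V)` by ring automorphisms. -/
noncomputable abbrev polyAction (W : Subgroup (Euc l ≃ₗᵢ[ℝ] Euc l)) :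
    MulSemiringAction W (MvPolynomial (Fin l) ℂ) where
  smul w p := act ℂ w.1 p
  one_smul p := act_one ℂ p
  mul_smul w u p := act_mul ℂ w.1 u.1 p
  smul_zero _ := map_zero _
  smul_add _ := map_add _
  smul_one _ := map_one _
  smul_mul _ := map_mul _

theorem isIntegral_invSubalgebra [Finite W] :
    Algebra.IsIntegral (invSubalgebra W) (MvPolynomial (Fin l) ℂ) := by
  let := polyAction W
  have : Algebra.IsInvariant (invSubalgebra W) (MvPolynomial (Fin l) ℂ) W :=
    ⟨fun p hp => ⟨⟨p, fun w hw => hp ⟨w, hw⟩⟩, rfl⟩⟩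
  exact Algebra.IsInvariant.isIntegral (invSubalgebra W) (MvPolynomial (Fin l) ℂ) W

/-- The polynomial ring is integral over the invariants, since `W` is finite; so the `f i` form a
transcendence basis, as the `l` variables do. -/
theorem MinimalInvariants.card_eq [Finite W] {ι : Type*} [Fintype ι] (D : MinimalInvariants W ι)
    (hgen : Subgroup.closure {w | w ∈ W ∧ IsReflection w} = W) : Fintype.card ι = l := by
  have h1 := D.algebraicIndependent hgen
  have h2 : IsTranscendenceBasis ℂ D.f := by
    rw [h1.isTranscendenceBasis_iff_isAlgebraic, D.adjoin_eq]
    have := isIntegral_invSubalgebra (W := W)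
    infer_instance
  have h3 := h2.lift_cardinalMk_eq (IsTranscendenceBasis.mvPolynomial (Fin l) ℂ)
  simpa using h3

theorem exists_isDegrees [Finite W] (hgen : Subgroup.closure {w | w ∈ W ∧ IsReflection w} = W) :
    ∃ d : Fin l → ℕ, IsDegrees W d := by
  obtain ⟨t, ⟨D⟩⟩ := exists_minimalInvariants W
  let e : Fin l ≃ t := (Fintype.equivFinOfCardEq (D.card_eq hgen)).symm
  let σ := Tuple.sort (D.deg ∘ e)
  refine ⟨(D.deg ∘ e) ∘ σ, Tuple.monotone_sort _, D.f ∘ (σ.trans e), fun i => D.hom _,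
    (D.algebraicIndependent hgen).comp _ (σ.trans e).injective, ?_⟩
  rw [(σ.trans e).surjective.range_comp, D.adjoin_eq]
  rfl

end ElementaryInvariants

/-! ### The Jacobian does not lie in the ideal generated by invariants of positive degree. -/

section JacobianIdeal

section Wiebe

variable {σ K : Type*} [Fintype σ] [DecidableEq σ] [Field K]

theorem image_X_pow (s : Set σ) (n : ℕ) : (fun j => (X j ^ n : MvPolynomial σ K)) '' s =
    (fun m => monomial m (1 : K)) '' ((fun j => Finsupp.single j n) '' s) := by
  rw [Set.image_image]
  exact Set.image_congr fun j _ => X_pow_eq_monomial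

/-- A variable is not a zero divisor modulo powers of the other variables; for a monomial ideal this
is seen on exponents. -/
theorem mem_span_of_X_mul_mem {n : ℕ} {k : σ} {p : MvPolynomial σ K}
    (h : p * X k ∈ Ideal.span ((fun j => (X j ^ n : MvPolynomial σ K)) '' {j | j ≠ k})) :
    p ∈ Ideal.span ((fun j => (X j ^ n : MvPolynomial σ K)) '' {j | j ≠ k}) := by
  rw [image_X_pow, mem_ideal_span_monomial_image] at h ⊢
  intro m hm
  obtain ⟨_, ⟨j, hj, rfl⟩, h2⟩ := h (m + Finsupp.single k 1) (by
    rw [mem_support_iff, coeff_mul_X]; exact mem_support_iff.1 hm)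
  refine ⟨_, ⟨j, hj, rfl⟩, ?_⟩
  rw [Finsupp.single_le_iff] at h2 ⊢
  simpa [Finsupp.single_apply, Ne.symm hj] using h2

theorem prod_X_pow_not_mem (n : ℕ) :
    ∏ k, X k ^ n ∉ Ideal.span (Set.range fun j => (X j ^ (n + 1) : MvPolynomial σ K)) := by
  rw [← Set.image_univ, image_X_pow, mem_ideal_span_monomial_image]
  intro h
  have h1 : (∏ k, X k ^ n : MvPolynomial σ K) =
      monomial (Finsupp.equivFunOnFinite.symm fun _ => n) 1 := by
    rw [monomial_eq, C_1, one_mul, Finsupp.prod_fintype]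
    · simp
    · simp
  obtain ⟨_, ⟨j, -, rfl⟩, h2⟩ := h (Finsupp.equivFunOnFinite.symm fun _ => n) (by
    rw [h1, mem_support_iff, coeff_monomial, if_pos rfl]; exact one_ne_zero)
  rw [Finsupp.single_le_iff] at h2
  simp at h2

/-- By Cramer's rule `det E * X k` is a combination of the entries of `E x`, hence of powers of the
variables other than `X k`; then `X k` is cancelled. -/
theorem det_mem_of_mulVec {n : ℕ} {k : σ} (E : Matrix σ σ (MvPolynomial σ K))
    (hk : E.mulVec X k = 0) (hE : ∀ j, j ≠ k → E.mulVec X j = X j ^ n) :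
    E.det ∈ Ideal.span (Set.range fun j => (X j ^ n : MvPolynomial σ K)) := by
  refine Ideal.span_mono (Set.image_subset_range _ {j | j ≠ k}) (mem_span_of_X_mul_mem ?_)
  have h1 : E.adjugate.mulVec (E.mulVec X) k = E.det * X k := by
    rw [Matrix.mulVec_mulVec, Matrix.adjugate_mul, Matrix.smul_mulVec, Matrix.one_mulVec]
    rfl
  rw [← h1]
  refine Ideal.sum_mem _ fun j _ => Ideal.mul_mem_left _ _ ?_
  by_cases hj : j = k
  · rw [hj, hk]; exact zero_mem _
  · rw [hE j hj]; exact Ideal.subset_span ⟨j, hj, rfl⟩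

/-- A matrix taking `(x_k)` to `(x_k ^ (n + 1))` has determinant `∏ x_k ^ n` modulo the ideal
generated by the `x_k ^ (n + 1)`. -/
theorem det_sub_prod_mem {n : ℕ} (A : Matrix σ σ (MvPolynomial σ K))
    (hA : ∀ k, A.mulVec X k = X k ^ (n + 1)) :
    A.det - ∏ k, X k ^ n ∈
      Ideal.span (Set.range fun j => (X j ^ (n + 1) : MvPolynomial σ K)) := by
  -- The rows of `A` are replaced one at a time by those of the diagonal matrix with entries `X k ^
  -- n`. Each step changes the determinant by that of a matrix whose `k`-th row is a difference of
  -- two rows with the same value on `x`, so `det_mem_of_mulVec` applies.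
  set B : Finset σ → Matrix σ σ (MvPolynomial σ K) := fun T k =>
    if k ∈ T then Pi.single k (X k ^ n) else A k with hB
  have hBX : ∀ T k, (B T).mulVec X k = X k ^ (n + 1) := by
    intro T k
    simp only [hB, Matrix.mulVec]
    split_ifs
    · rw [single_dotProduct, pow_succ]
    · exact hA k
  have key : ∀ T : Finset σ, A.det - (B T).det ∈
      Ideal.span (Set.range fun j => (X j ^ (n + 1) : MvPolynomial σ K)) := by
    intro T
    induction T using Finset.induction_on with
    | empty => simp [hB]
    | insert k T hk ih =>
      have h1 : B (insert k T) = (B T).updateRow k (B (insert k T) k) := by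
        ext i j
        by_cases hi : i = k
        · subst hi; simp
        · rw [Matrix.updateRow_ne hi]
          simp [hB, hi]
      have h2 : (B T).det - (B (insert k T)).det =
          ((B T).updateRow k (B T k - B (insert k T) k)).det := by
        rw [sub_eq_add_neg, sub_eq_add_neg, Matrix.det_updateRow_add, Matrix.updateRow_eq_self,
          ← neg_one_smul (MvPolynomial σ K) (B (insert k T) k), Matrix.det_updateRow_smul, ← h1]
        ring
      rw [← sub_add_sub_cancel, h2]
      refine add_mem ih (det_mem_of_mulVec (k := k) _ ?_ fun j hj => ?_)
      · rw [Matrix.mulVec, Matrix.updateRow_self, sub_dotProduct]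
        exact sub_eq_zero.2 ((hBX T k).trans (hBX (insert k T) k).symm)
      · rw [Matrix.mulVec, Matrix.updateRow_ne hj]
        exact hBX T j
  have h3 := key Finset.univ
  have h4 : B Finset.univ = Matrix.diagonal fun k => X k ^ n := by
    ext i j
    simp [hB, Matrix.diagonal_apply, Pi.single_apply, eq_comm]
  rwa [h4, Matrix.det_diagonal] at h3

end Wiebe

variable {l : ℕ} {W : Subgroup (Euc l ≃ₗᵢ[ℝ] Euc l)}

/-- `x` is a root of the monic polynomial `∏ (T - g x)` with invariant coefficients. Its image under
`ε` is a power of `T`, so all its lower coefficients lie in `I`. -/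
theorem pow_card_mem_of_invariant_mem {A K G : Type*} [CommRing A] [Nontrivial A] [CommRing K]
    [Group G] [Fintype G] (φ : G → A →+* A) (hφ : ∀ g h a, φ (g * h) a = φ g (φ h a))
    (hφ1 : ∀ a, φ 1 a = a) (ε : A →+* K) {x : A} (hx : ∀ g, ε (φ g x) = 0) {I : Ideal A}
    (hI : ∀ a, (∀ g, φ g a = a) → ε a = 0 → a ∈ I) : x ^ Fintype.card G ∈ I := by
  obtain ⟨P, hP⟩ : ∃ P : Polynomial A, P = ∏ g : G, (Polynomial.X - Polynomial.C (φ g x)) :=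
    ⟨_, rfl⟩
  have hmonic : P.Monic := by
    rw [hP]
    exact Polynomial.monic_prod_of_monic _ _ fun g _ => Polynomial.monic_X_sub_C _
  have hdeg : P.natDegree = Fintype.card G := by
    rw [hP, Polynomial.natDegree_prod_of_monic _ _ fun g _ => Polynomial.monic_X_sub_C _]
    simp
  have hinv : ∀ i g, φ g (P.coeff i) = P.coeff i := by
    intro i g
    have h1 : P.map (φ g) = P := by
      rw [hP, Polynomial.map_prod]
      refine Fintype.prod_equiv (Equiv.mulLeft g) _ _ fun w => ?_
      rw [Polynomial.map_sub, Polynomial.map_X, Polynomial.map_C, Equiv.coe_mulLeft, hφ]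
    conv_rhs => rw [← h1, Polynomial.coeff_map]
  have hmap : P.map ε = Polynomial.X ^ Fintype.card G := by
    rw [hP, Polynomial.map_prod]
    simp [hx]
  have h0 : Polynomial.eval x P = 0 := by
    rw [hP, Polynomial.eval_prod]
    refine Finset.prod_eq_zero (Finset.mem_univ 1) ?_
    simp [hφ1]
  rw [Polynomial.eval_eq_sum_range, Finset.sum_range_succ, hmonic.coeff_natDegree, one_mul,
    hdeg] at h0
  rw [eq_neg_of_add_eq_zero_right h0]
  refine neg_mem (Ideal.sum_mem _ fun i hi => Ideal.mul_mem_right _ _ (hI _ (hinv i) ?_))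
  rw [← Polynomial.coeff_map, hmap, Polynomial.coeff_X_pow, if_neg (Finset.mem_range.1 hi).ne]

/-- Each variable is nilpotent modulo the invariants of positive degree. -/
theorem X_pow_card_mem_invIdeal [Finite W] (k : Fin l) : X k ^ Nat.card W ∈ invIdeal W := by
  have := Fintype.ofFinite W
  rw [Nat.card_eq_fintype_card]
  refine pow_card_mem_of_invariant_mem (fun w : W => (act ℂ w.1).toRingHom)
    (fun g h a => act_mul ℂ g.1 h.1 a) (fun a => act_one ℂ a) constantCoeff (fun w => ?_)
    fun a ha h0 => mem_invIdeal_of_coeff_zero W (fun w hw => ha ⟨w, hw⟩) h0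
  change constantCoeff (act ℂ w.1 (X k)) = 0
  rw [act_X]
  exact (linForm_isHomogeneous ℂ _).coeff_eq_zero (by simp)

/-- A system of elementary invariants with its degrees. -/
structure IsBasicInvariants (W : Subgroup (Euc l ≃ₗᵢ[ℝ] Euc l))
    (f : Fin l → MvPolynomial (Fin l) ℂ) (d : Fin l → ℕ) : Prop where
  hom : ∀ i, (f i).IsHomogeneous (d i)
  indep : AlgebraicIndependent ℂ f
  adjoin : Algebra.adjoin ℂ (Set.range f) = invSubalgebra W

theorem IsDegrees.exists_basic {d : Fin l → ℕ} (hd : IsDegrees W d) :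
    ∃ f, IsBasicInvariants W f d := by
  obtain ⟨-, f, h1, h2, h3⟩ := hd
  exact ⟨f, h1, h2, SetLike.coe_injective h3⟩

namespace IsBasicInvariants

variable {f : Fin l → MvPolynomial (Fin l) ℂ} {d : Fin l → ℕ} (hf : IsBasicInvariants W f d)
include hf

theorem mem (i : Fin l) : f i ∈ invariants ℂ W := by
  have h : f i ∈ invSubalgebra W := hf.adjoin ▸ Algebra.subset_adjoin ⟨i, rfl⟩
  exact h

theorem pos (i : Fin l) : 0 < d i := by
  rw [Nat.pos_iff_ne_zero]
  intro h0
  have h1 := hf.hom i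
  rw [h0, ← totalDegree_zero_iff_isHomogeneous, totalDegree_eq_zero_iff_eq_C] at h1
  have h2 := algebraicIndependent_iff.1 hf.indep (X i - C (coeff 0 (f i))) (by
    rw [map_sub, aeval_X, aeval_C, MvPolynomial.algebraMap_eq, ← h1, sub_self])
  have h3 := congrArg (coeff (Finsupp.single i 1)) h2
  rw [coeff_sub, coeff_X, if_pos rfl, coeff_C, if_neg] at h3
  · simp at h3
  · intro h4
    have := DFunLike.congr_fun h4 i
    simp at this

theorem exists_aeval {p : MvPolynomial (Fin l) ℂ} (hp : p ∈ invariants ℂ W) :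
    ∃ H : MvPolynomial (Fin l) ℂ, aeval f H = p := by
  have h : p ∈ Algebra.adjoin ℂ (Set.range f) := by
    rw [hf.adjoin]; exact hp
  rwa [Algebra.adjoin_range_eq_range_aeval] at h

theorem coeff_zero (i : Fin l) : coeff 0 (f i) = 0 :=
  (hf.hom i).coeff_eq_zero (by simpa using (hf.pos i).ne)

theorem span_eq : Ideal.span (Set.range f) = invIdeal W := by
  refine le_antisymm (Ideal.span_le.2 ?_) (Ideal.span_le.2 ?_)
  · rintro _ ⟨i, rfl⟩
    exact Ideal.subset_span ⟨hf.mem i, d i, hf.pos i, hf.hom i⟩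
  · rintro p ⟨hp, n, hn, hpn⟩
    obtain ⟨H, rfl⟩ := hf.exists_aeval hp
    have h1 : ∀ H : MvPolynomial (Fin l) ℂ,
        aeval f H - C (coeff 0 H) ∈ Ideal.span (Set.range f) := by
      intro H
      induction H using MvPolynomial.induction_on with
      | C a => simp [MvPolynomial.algebraMap_eq]
      | add p q hp hq =>
        rw [map_add, coeff_add, C_add, add_sub_add_comm]
        exact add_mem hp hq
      | mul_X p i _ =>
        rw [map_mul, aeval_X, ← constantCoeff_eq, map_mul, constantCoeff_X, mul_zero, C_0, sub_zero]
        exact Ideal.mul_mem_left _ _ (Ideal.subset_span ⟨i, rfl⟩)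
    have h2 : coeff 0 H = 0 := by
      have h3 : Ideal.span (Set.range f) ≤
          RingHom.ker (constantCoeff : MvPolynomial (Fin l) ℂ →+* ℂ) := by
        refine Ideal.span_le.2 ?_
        rintro _ ⟨i, rfl⟩
        exact hf.coeff_zero i
      have h4 := h3 (h1 H)
      rw [RingHom.mem_ker, map_sub, constantCoeff_C, constantCoeff_eq,
        hpn.coeff_eq_zero (by simpa using hn.ne), zero_sub, neg_eq_zero] at h4
      exact h4
    have h5 := h1 H
    rwa [h2, C_0, sub_zero] at h5

end IsBasicInvariants

/-- The Jacobian determinant. -/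
noncomputable def jacobian (f : Fin l → MvPolynomial (Fin l) ℂ) : MvPolynomial (Fin l) ℂ :=
  (Matrix.of fun i j => pderiv j (f i)).det

namespace IsBasicInvariants

variable {f : Fin l → MvPolynomial (Fin l) ℂ} {d : Fin l → ℕ} (hf : IsBasicInvariants W f d)
include hf

/-- The Jacobian generates the socle of the coinvariant algebra; in particular it is not in the
ideal generated by the invariants of positive degree. -/
theorem jacobian_not_mem [Finite W] : jacobian f ∉ invIdeal W := by
  intro hJ
  obtain ⟨n, hn⟩ : ∃ n, Nat.card W = n + 1 := ⟨_, (Nat.succ_pred_eq_of_pos Nat.card_pos).symm⟩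
  have hX : ∀ k : Fin l, ∃ a : Fin l → MvPolynomial (Fin l) ℂ, X k ^ (n + 1) = ∑ i, a i * f i :=
    fun k => exists_sum_of_mem_span_range (hf.span_eq ▸ hn ▸ X_pow_card_mem_invIdeal k)
  choose a ha using hX
  let A : Matrix (Fin l) (Fin l) (MvPolynomial (Fin l) ℂ) := Matrix.of a
  -- The Jacobian matrix with its rows divided by the degrees: by Euler's identity it takes the
  -- vector of variables to `f`. As `A` takes `f` to the powers `X k ^ (n + 1)`, the determinant of
  -- `A * B` is `∏ X k ^ n` modulo these powers.
  let B : Matrix (Fin l) (Fin l) (MvPolynomial (Fin l) ℂ) :=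
    Matrix.diagonal (fun i => C (d i : ℂ)⁻¹) * Matrix.of fun i j => pderiv j (f i)
  have hB : B.mulVec X = f := by
    ext1 i
    rw [← Matrix.mulVec_mulVec, Matrix.mulVec_diagonal]
    have h1 : (Matrix.of fun i j => pderiv j (f i)).mulVec X i = d i • f i := by
      rw [← (hf.hom i).sum_X_mul_pderiv]
      simp only [Matrix.mulVec, dotProduct, Matrix.of_apply]
      exact Finset.sum_congr rfl fun j _ => mul_comm (pderiv j (f i)) (X j)
    rw [h1, nsmul_eq_mul, ← map_natCast (C : ℂ →+* MvPolynomial (Fin l) ℂ), ← mul_assoc, ← C_mul,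
      inv_mul_cancel₀ (Nat.cast_ne_zero.2 (hf.pos i).ne'), C_1, one_mul]
  have hA : A.mulVec f = fun k => X k ^ (n + 1) := by
    ext1 k
    rw [ha k]; rfl
  have h1 := det_sub_prod_mem (n := n) (A * B) fun k => by
    rw [← Matrix.mulVec_mulVec, hB, hA]
  have hBdet : B.det ∈ invIdeal W := by
    rw [Matrix.det_mul]
    exact Ideal.mul_mem_left _ _ hJ
  -- If the Jacobian were in the ideal of the `f i`, so would be `det B`; but `det A * f i` lies in
  -- the ideal of the powers by Cramer's rule. Then so would `∏ X k ^ n`, which is impossible.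
  have h2 : (A * B).det ∈
      Ideal.span (Set.range fun j => (X j ^ (n + 1) : MvPolynomial (Fin l) ℂ)) := by
    rw [← hf.span_eq] at hBdet
    obtain ⟨b, hb⟩ := exists_sum_of_mem_span_range hBdet
    rw [Matrix.det_mul, hb, Finset.mul_sum]
    refine Ideal.sum_mem _ fun i _ => ?_
    rw [mul_left_comm]
    refine Ideal.mul_mem_left _ _ ?_
    have h3 : A.det * f i = A.adjugate.mulVec (A.mulVec f) i := by
      rw [Matrix.mulVec_mulVec, Matrix.adjugate_mul, Matrix.smul_mulVec, Matrix.one_mulVec]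
      rfl
    rw [h3, hA]
    simp only [Matrix.mulVec, dotProduct]
    refine Ideal.sum_mem _ fun k _ => Ideal.mul_mem_left _ _ ?_
    exact Ideal.subset_span (Set.mem_range_self k)
  refine prod_X_pow_not_mem (σ := Fin l) (K := ℂ) n ?_
  have h4 := sub_mem h2 h1
  rwa [sub_sub_cancel] at h4

end IsBasicInvariants

end JacobianIdeal

/-! ### The Jacobian as the product of the roots. -/

section JacobianFactorization

variable {l : ℕ} {W : Subgroup (Euc l ≃ₗᵢ[ℝ] Euc l)}

/-- The quotient is a complex constant by degree, and it is real because it is a ratio of real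
coordinates. -/
theorem exists_smul_of_linForm_dvd {u v : Euc l} (hu : u ≠ 0)
    (h : linForm ℂ u ∣ linForm ℂ v) : ∃ a : ℝ, v = a • u := by
  obtain ⟨r, hr⟩ := h
  have h1 : r.IsHomogeneous 0 := by
    refine isHomogeneous_of_mul_left (linForm_isHomogeneous ℂ u) (linForm_ne_zero ℂ hu) ?_
    rw [← hr]
    exact linForm_isHomogeneous ℂ v
  rw [← totalDegree_zero_iff_isHomogeneous, totalDegree_eq_zero_iff_eq_C] at h1
  have h2 : ∀ (k : Fin l), ((v k : ℝ) : ℂ) = (u k : ℝ) * coeff 0 r := by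
    intro k
    have h3 := congrArg (pderiv k) hr
    rw [h1, mul_comm, pderiv_C_mul, pderiv_linForm, pderiv_linForm, ← C_mul, C_inj] at h3
    rw [mul_comm]
    exact h3
  obtain ⟨k, hk⟩ : ∃ k, u k ≠ 0 := by
    by_contra! h'
    exact hu (by ext k; exact h' k)
  refine ⟨v k / u k, ?_⟩
  ext j
  have h4 : coeff 0 r = ((v k / u k : ℝ) : ℂ) := by
    rw [Complex.ofReal_div, h2 k, mul_div_cancel_left₀]
    exact_mod_cast hk
  have h5 := h2 j
  rw [h4, ← Complex.ofReal_mul, Complex.ofReal_inj] at h5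
  rw [h5, PiLp.smul_apply, smul_eq_mul, mul_comm]

theorem irreducible_linForm {v : Euc l} (hv : v ≠ 0) : Irreducible (linForm ℂ v) := by
  refine irreducible_of_totalDegree_eq_one
    ((linForm_isHomogeneous ℂ v).totalDegree (linForm_ne_zero ℂ hv)) fun x hx => ?_
  obtain ⟨m, hm⟩ := exists_coeff_ne_zero (linForm_ne_zero ℂ hv)
  exact isUnit_iff_ne_zero.2 (ne_zero_of_dvd_ne_zero hm (hx m))

theorem refl_eq_of_root_smul {s t : Refl W} {a : ℝ} (h : root t = a • root s) : s = t := by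
  have ha : a ≠ 0 := by
    rintro rfl
    rw [zero_smul] at h
    exact (root_spec t).1 h
  have hs := norm_root_ne_zero s
  refine Subtype.ext (LinearIsometryEquiv.ext fun x => ?_)
  rw [refl_apply, refl_apply, corootFn, corootFn, h, norm_smul, inner_smul_left, smul_smul, mul_pow,
    Real.norm_eq_abs, sq_abs]
  congr 2
  simp only [conj_trivial]
  field_simp

theorem not_linForm_root_dvd {s t : Refl W} (hst : s ≠ t) :
    ¬ linForm ℂ (root s) ∣ linForm ℂ (root t) := fun h => by
  obtain ⟨a, ha⟩ := exists_smul_of_linForm_dvd (root_spec s).1 h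
  exact hst (refl_eq_of_root_smul ha)

/-- The product of all roots. -/
noncomputable def discRoot (W : Subgroup (Euc l ≃ₗᵢ[ℝ] Euc l)) [Fintype (Refl W)] :
    MvPolynomial (Fin l) ℂ :=
  ∏ s : Refl W, linForm ℂ (root s)

theorem discRoot_isHomogeneous [Fintype (Refl W)] :
    (discRoot W).IsHomogeneous (Fintype.card (Refl W)) := by
  have h := IsHomogeneous.prod Finset.univ (fun s : Refl W => linForm ℂ (root s)) (fun _ => 1)
    fun s _ => linForm_isHomogeneous ℂ _
  simpa [discRoot] using h

theorem discRoot_ne_zero [Fintype (Refl W)] : discRoot W ≠ 0 :=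
  Finset.prod_ne_zero_iff.2 fun s _ => linForm_ne_zero ℂ (root_spec s).1

/-- `s` permutes the root lines, so the product is multiplied by some scalar `κ`. The product `δ` of
the other roots is then multiplied by `-κ`; if `κ ≠ -1`, its divided difference shows that `α_s`
divides `δ`, hence another root, which is absurd. -/
theorem act_discRoot_refl [Fintype (Refl W)] (s : Refl W) :
    act ℂ s.1 (discRoot W) = -discRoot W := by
  classical
  choose a _ ha using fun t => exists_root_conj s.1 s.2.1 t
  have h1 : act ℂ s.1 (discRoot W) = C (∏ t, ((a t : ℝ) : ℂ)) * discRoot W := by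
    simp only [discRoot, map_prod, act_linForm]
    rw [← (conjReflEquiv s.1 s.2.1).prod_comp fun t => linForm ℂ (root t),
      ← Finset.prod_mul_distrib]
    refine Finset.prod_congr rfl fun t _ => ?_
    rw [ha t, linForm_smul]
    rfl
  set κ : ℂ := ∏ t, ((a t : ℝ) : ℂ)
  set δ := ∏ t ∈ Finset.univ.erase s, linForm ℂ (root t) with hδ
  have h2 : discRoot W = linForm ℂ (root s) * δ :=
    (Finset.mul_prod_erase _ _ (Finset.mem_univ s)).symm
  have hs0 := linForm_ne_zero ℂ (root_spec s).1
  have h3 : act ℂ s.1 δ = -(C κ * δ) := by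
    rw [h2, map_mul, act_linForm, refl_root, ← neg_one_smul ℝ (root s), linForm_smul] at h1
    refine mul_left_cancel₀ hs0 ?_
    simp only [Complex.ofReal_neg, Complex.ofReal_one, map_neg, map_one] at h1
    linear_combination -h1
  suffices κ = -1 by rw [h1, this]; simp
  by_contra hκ
  have h4 : linForm ℂ (root s) ∣ δ := by
    have h5 : linForm ℂ (root s) ∣ C (1 + κ) * δ := by
      refine ⟨divDiff s δ, ?_⟩
      rw [divDiff_spec, h3, C_add, C_1]
      ring
    obtain ⟨r, hr⟩ := h5
    have h6 : 1 + κ ≠ 0 := fun h => hκ (eq_neg_of_add_eq_zero_right h)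
    refine ⟨C (1 + κ)⁻¹ * r, ?_⟩
    rw [mul_left_comm, ← hr, ← mul_assoc, ← C_mul, inv_mul_cancel₀ h6, C_1, one_mul]
  obtain ⟨t, ht, h7⟩ := (irreducible_linForm (root_spec s).1).prime.exists_mem_finset_dvd h4
  exact not_linForm_root_dvd (Finset.mem_erase.1 ht).1.symm h7

/-- A reflection is the identity minus a matrix of rank one whose trace, root against coroot, is 2.
-/
theorem det_cmat_refl (s : Refl W) : (cmat ℂ s.1).det = -1 := by
  have h : cmat ℂ s.1 = 1 - Matrix.vecMulVec (fun k => ((root s k : ℝ) : ℂ))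
      (fun k => ((corootFn s (EuclideanSpace.single k 1) : ℝ) : ℂ)) := by
    ext k j
    simp only [cmat, refl_apply, Matrix.sub_apply, Matrix.one_apply, Matrix.vecMulVec_apply,
      PiLp.sub_apply, PiLp.smul_apply, smul_eq_mul]
    by_cases hk : k = j <;> simp [hk, mul_comm]
  have h2 : dotProduct (fun k => ((corootFn s (EuclideanSpace.single k 1) : ℝ) : ℂ))
      (fun k => ((root s k : ℝ) : ℂ)) = 2 := by
    have h3 : ∑ k, corootFn s (EuclideanSpace.single k 1) * root s k = 2 := by
      have := norm_root_ne_zero s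
      simp only [corootFn_single]
      have h4 : ∑ k, root s k * root s k = ‖root s‖ ^ 2 := by
        rw [EuclideanSpace.norm_sq_eq]
        exact Finset.sum_congr rfl fun k _ => by rw [Real.norm_eq_abs, sq_abs, sq]
      simp only [mul_assoc, ← Finset.mul_sum]
      rw [h4]
      field_simp
    rw [dotProduct]
    exact_mod_cast h3
  rw [h, sub_eq_add_neg, ← Matrix.neg_vecMulVec, Matrix.vecMulVec_eq Unit,
    Matrix.det_one_add_replicateCol_mul_replicateRow]
  rw [dotProduct_neg, h2]
  norm_num

theorem act_jacobian {f : Fin l → MvPolynomial (Fin l) ℂ} {w : Euc l ≃ₗᵢ[ℝ] Euc l}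
    (hf : ∀ i, act ℂ w (f i) = f i) :
    jacobian f = act ℂ w (jacobian f) * C (cmat ℂ w).det := by
  have h : (Matrix.of fun i j => pderiv j (f i)) =
      (act ℂ w : MvPolynomial (Fin l) ℂ →+* MvPolynomial (Fin l) ℂ).mapMatrix
        (Matrix.of fun i j => pderiv j (f i)) *
      ((C : ℂ →+* MvPolynomial (Fin l) ℂ).mapMatrix (cmat ℂ w)).transpose := by
    ext1 i j
    rw [Matrix.mul_apply]
    simp only [RingHom.mapMatrix_apply, Matrix.map_apply, Matrix.of_apply, Matrix.transpose_apply]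
    conv_lhs => rw [← hf i, pderiv_act]
    exact Finset.sum_congr rfl fun k _ => mul_comm _ _
  conv_lhs => rw [jacobian, h]
  rw [Matrix.det_mul, Matrix.det_transpose, ← RingHom.map_det, ← RingHom.map_det]
  rfl

theorem act_eq_of_refl (hgen : Subgroup.closure {w | w ∈ W ∧ IsReflection w} = W)
    {p : MvPolynomial (Fin l) ℂ} (hp : ∀ s : Refl W, act ℂ s.1 p = p) : p ∈ invariants ℂ W := by
  intro w hw
  rw [← hgen] at hw
  induction hw using Subgroup.closure_induction with
  | mem x hx => exact hp ⟨x, hx⟩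
  | one => simp
  | mul x y _ _ h1 h2 => rw [act_mul, h2, h1]
  | inv x _ h => conv_lhs => rw [← h, ← act_mul, inv_mul_cancel, act_one]

namespace IsBasicInvariants

variable {f : Fin l → MvPolynomial (Fin l) ℂ} {d : Fin l → ℕ} (hf : IsBasicInvariants W f d)
include hf

theorem jacobian_isHomogeneous : (jacobian f).IsHomogeneous (∑ i, (d i - 1)) := by
  rw [jacobian, Matrix.det_apply]
  refine IsHomogeneous.sum _ _ _ fun σ _ => ?_
  have h : (∏ i, (Matrix.of fun i j => pderiv j (f i)) (σ i) i).IsHomogeneous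
      (∑ i, (d i - 1)) := by
    rw [← Equiv.sum_comp σ]
    exact IsHomogeneous.prod _ _ _ fun i _ => (hf.hom (σ i)).pderiv
  rcases Int.units_eq_one_or (Equiv.Perm.sign σ) with h1 | h1 <;> rw [h1]
  · simpa using h
  · simpa using h.neg

/-- The Jacobian changes sign under `s`, so its difference with its image is twice itself, and
differences `q - s(q)` are divisible by `α_s`. -/
theorem linForm_root_dvd_jacobian (s : Refl W) : linForm ℂ (root s) ∣ jacobian f := by
  have h := act_jacobian fun i => hf.mem i s.1 s.2.1
  rw [det_cmat_refl] at h
  refine ⟨C 2⁻¹ * divDiff s (jacobian f), ?_⟩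
  rw [mul_left_comm, divDiff_spec]
  have h1 : act ℂ s.1 (jacobian f) = - jacobian f := by
    conv_rhs => rw [h]
    simp
  have h2 : (C 2⁻¹ : MvPolynomial (Fin l) ℂ) * 2 = 1 := by
    rw [← map_ofNat (C : ℂ →+* MvPolynomial (Fin l) ℂ) 2, ← C_mul, inv_mul_cancel₀ two_ne_zero, C_1]
  rw [h1]
  linear_combination -(jacobian f) * h2

/-- The Jacobian of the elementary invariants is a nonzero multiple of the product of the roots. -/
theorem jacobian_eq [Finite W] [Fintype (Refl W)]
    (hgen : Subgroup.closure {w | w ∈ W ∧ IsReflection w} = W) :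
    (∃ a : ℂ, a ≠ 0 ∧ jacobian f = C a * discRoot W) ∧
      ∑ i, (d i - 1) = Fintype.card (Refl W) := by
  have hJ := hf.jacobian_not_mem
  have hJ0 : jacobian f ≠ 0 := fun h => hJ (h ▸ zero_mem _)
  obtain ⟨g, hg⟩ : discRoot W ∣ jacobian f := by
    refine Finset.prod_dvd_of_isRelPrime (fun s _ t _ hst => ?_)
      fun s _ => hf.linForm_root_dvd_jacobian s
    exact (irreducible_linForm (root_spec s).1).isRelPrime_iff_not_dvd.2 (not_linForm_root_dvd hst)
  have hg0 : g ≠ 0 := fun h => hJ0 (by rw [hg, h, mul_zero])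
  have hle : Fintype.card (Refl W) ≤ ∑ i, (d i - 1) := by
    rw [← hf.jacobian_isHomogeneous.totalDegree hJ0, hg,
      totalDegree_mul_of_isDomain (discRoot_ne_zero (W := W)) hg0,
      (discRoot_isHomogeneous (W := W)).totalDegree (discRoot_ne_zero (W := W))]
    exact Nat.le_add_right _ _
  obtain ⟨k, hk⟩ := Nat.exists_eq_add_of_le hle
  have hghom : g.IsHomogeneous k := by
    refine isHomogeneous_of_mul_left (discRoot_isHomogeneous (W := W)) discRoot_ne_zero ?_
    rw [← hg, ← hk]
    exact hf.jacobian_isHomogeneous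
  have hginv : g ∈ invariants ℂ W := by
    refine act_eq_of_refl hgen fun s => ?_
    have h := act_jacobian fun i => hf.mem i s.1 s.2.1
    rw [det_cmat_refl, hg, map_mul, act_discRoot_refl] at h
    refine mul_left_cancel₀ (discRoot_ne_zero (W := W)) ?_
    rw [h]
    simp
  -- The quotient `g` of the Jacobian by the product of the roots is invariant; of positive degree
  -- it would put the Jacobian into the ideal. This gives the sum of the degrees without Molien
  -- series.
  have hk0 : k = 0 := by
    by_contra hk0
    refine hJ ?_
    rw [hg]
    exact Ideal.mul_mem_left _ _
      (Ideal.subset_span ⟨hginv, k, Nat.pos_of_ne_zero hk0, hghom⟩)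
  refine ⟨⟨coeff 0 g, ?_, ?_⟩, by rw [hk, hk0, add_zero]⟩
  all_goals
    rw [hk0, ← totalDegree_zero_iff_isHomogeneous, totalDegree_eq_zero_iff_eq_C] at hghom
  · intro h0
    rw [h0, C_0] at hghom
    exact hg0 hghom
  · rw [← hghom, hg, mul_comm]

/-- The differentials of the elementary invariants are independent off the hyperplanes. -/
theorem gradient_linearIndependent [Finite W]
    (hgen : Subgroup.closure {w | w ∈ W ∧ IsReflection w} = W) {v : Fin l → ℂ}
    (hv : ∀ s : Refl W, eval v (linForm ℂ (root s)) ≠ 0) :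
    LinearIndependent ℂ fun i : Fin l => fun j => eval v (pderiv j (f i)) := by
  have := finite_refl (W := W) ‹_›
  have := Fintype.ofFinite (Refl W)
  obtain ⟨⟨a, ha, h⟩, -⟩ := hf.jacobian_eq hgen
  have h1 : (Matrix.of fun i j => eval v (pderiv j (f i))).det ≠ 0 := by
    have h2 : (Matrix.of fun i j => eval v (pderiv j (f i))) =
        (eval v).mapMatrix (Matrix.of fun i j => pderiv j (f i)) := rfl
    rw [h2, ← RingHom.map_det, ← jacobian, h, map_mul, eval_C, discRoot, map_prod]
    exact mul_ne_zero ha (Finset.prod_ne_zero_iff.2 fun s _ => hv s)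
  exact Matrix.linearIndependent_rows_of_det_ne_zero h1

end IsBasicInvariants

end JacobianFactorization

/-! ### Unit roots and the existence of simple systems. -/

section Roots

variable {l : ℕ}

local notation "⟪" x ", " y "⟫" => inner ℝ x y

/-- The unit vectors orthogonal to the reflecting hyperplanes. -/
def rootSet (W : Subgroup (Euc l ≃ₗᵢ[ℝ] Euc l)) : Set (Euc l) :=
  {β | ‖β‖ = 1 ∧ (ℝ ∙ β)ᗮ.reflection ∈ W}

theorem reflection_unit {β : Euc l} (hβ : ‖β‖ = 1) (x : Euc l) :
    (ℝ ∙ β)ᗮ.reflection x = x - (2 * ⟪β, x⟫) • β := by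
  rw [reflection_apply_of, hβ]; simp

section RootSet

variable {W : Subgroup (Euc l ≃ₗᵢ[ℝ] Euc l)}

theorem ne_zero_of_mem_rootSet {β : Euc l} (hβ : β ∈ rootSet W) : β ≠ 0 := by
  rintro rfl
  simpa using hβ.1

theorem map_mem_rootSet {w : Euc l ≃ₗᵢ[ℝ] Euc l} (hw : w ∈ W) {β : Euc l} (hβ : β ∈ rootSet W) :
    w β ∈ rootSet W := by
  refine ⟨by rw [LinearIsometryEquiv.norm_map, hβ.1], ?_⟩
  have h : (ℝ ∙ w β)ᗮ.reflection = w * (ℝ ∙ β)ᗮ.reflection * w⁻¹ := by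
    ext1 x
    rw [reflection_unit (by rw [LinearIsometryEquiv.norm_map, hβ.1]), isometry_mul_apply,
      isometry_mul_apply, reflection_unit hβ.1, map_sub, map_smul,
      LinearIsometryEquiv.inner_map_eq_flip]
    congr 1
    exact (LinearIsometryEquiv.apply_symm_apply w x).symm
  rw [h]
  exact W.mul_mem (W.mul_mem hw hβ.2) (W.inv_mem hw)

theorem reflection_mem_rootSet {α β : Euc l} (hα : α ∈ rootSet W) (hβ : β ∈ rootSet W) :
    β - (2 * ⟪α, β⟫) • α ∈ rootSet W := by
  rw [← reflection_unit hα.1]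
  exact map_mem_rootSet hα.2 hβ

theorem neg_mem_rootSet {β : Euc l} (hβ : β ∈ rootSet W) : -β ∈ rootSet W := by
  have h := reflection_mem_rootSet hβ hβ
  rw [real_inner_self_eq_norm_sq, hβ.1] at h
  convert h using 1
  module

/-- The normalized root of a reflection. -/
noncomputable def unitRoot (s : Refl W) : Euc l := ‖root s‖⁻¹ • root s

theorem norm_unitRoot (s : Refl W) : ‖unitRoot s‖ = 1 := by
  rw [unitRoot, norm_smul, norm_inv, norm_norm, inv_mul_cancel₀ (norm_root_ne_zero s)]

theorem reflection_unitRoot (s : Refl W) : (ℝ ∙ unitRoot s)ᗮ.reflection = s.1 := by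
  have := norm_root_ne_zero s
  ext1 x
  rw [reflection_unit (norm_unitRoot s), refl_apply, corootFn, unitRoot, inner_smul_left, smul_smul]
  congr 2
  simp only [conj_trivial]
  field_simp

theorem unitRoot_mem (s : Refl W) : unitRoot s ∈ rootSet W :=
  ⟨norm_unitRoot s, by rw [reflection_unitRoot]; exact s.2.1⟩

theorem exists_unitRoot {β : Euc l} (hβ : β ∈ rootSet W) :
    ∃ s : Refl W, β = unitRoot s ∨ β = -unitRoot s := by
  refine ⟨⟨_, hβ.2, β, ne_zero_of_mem_rootSet hβ, rfl⟩, ?_⟩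
  set s : Refl W := ⟨_, hβ.2, β, ne_zero_of_mem_rootSet hβ, rfl⟩
  have h1 : s.1 β = -β := by
    change (ℝ ∙ β)ᗮ.reflection β = -β
    rw [reflection_unit hβ.1, real_inner_self_eq_norm_sq, hβ.1]
    module
  obtain ⟨a, ha⟩ := exists_smul_root s h1
  have h2 : β = (a * ‖root s‖) • unitRoot s := by
    rw [unitRoot, smul_smul, mul_assoc, mul_inv_cancel₀ (norm_root_ne_zero s), mul_one, ← ha]
  have h3 : |a * ‖root s‖| = 1 := by
    have := hβ.1
    rw [h2, norm_smul, norm_unitRoot, mul_one] at this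
    exact this
  rcases (abs_eq zero_le_one).1 h3 with h | h <;> rw [h] at h2
  · left; rw [h2, one_smul]
  · right; rw [h2, neg_one_smul]

theorem rootSet_finite [Finite W] : (rootSet W).Finite := by
  have := finite_refl (W := W) ‹_›
  refine ((Set.finite_range (unitRoot (W := W))).union
    (Set.finite_range fun s => -unitRoot (W := W) s)).subset fun β hβ => ?_
  obtain ⟨s, h | h⟩ := exists_unitRoot hβ
  · exact Or.inl ⟨s, h.symm⟩
  · exact Or.inr ⟨s, h.symm⟩

theorem two_mul_card_refl_le [Finite W] [Fintype (Refl W)] :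
    2 * Fintype.card (Refl W) ≤ (rootSet W).ncard := by
  have hinj : Function.Injective fun p : Refl W × Bool =>
      (if p.2 then unitRoot p.1 else -unitRoot p.1 : Euc l) := by
    rintro ⟨s, a⟩ ⟨t, b⟩ h
    have hst : s = t := by
      have h1 : unitRoot s = unitRoot t ∨ unitRoot s = -unitRoot t := by
        cases a <;> cases b <;> simp only [if_true, if_false, Bool.false_eq_true] at h
        · exact Or.inl (neg_injective h)
        · exact Or.inr (neg_eq_iff_eq_neg.1 h)
        · exact Or.inr h
        · exact Or.inl h
      apply Subtype.ext
      rw [← reflection_unitRoot s, ← reflection_unitRoot t]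
      ext1 x
      rw [reflection_unit (norm_unitRoot s), reflection_unit (norm_unitRoot t)]
      rcases h1 with h1 | h1 <;> rw [h1]
      rw [inner_neg_left]
      module
    subst hst
    have h2 : unitRoot s ≠ -unitRoot s := fun h2 => by
      have : unitRoot s = 0 := by
        have h4 : (2 : ℝ) • unitRoot s = 0 := by
          rw [two_smul]; nth_rewrite 1 [h2]; simp
        exact (smul_eq_zero.1 h4).resolve_left two_ne_zero
      have h3 := norm_unitRoot s
      rw [this, norm_zero] at h3
      exact zero_ne_one h3
    cases a <;> cases b <;> simp only [if_true, if_false, Bool.false_eq_true] at h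
    · rfl
    · exact absurd h.symm h2
    · exact absurd h h2
    · rfl
  have h := Set.ncard_le_ncard (s := Set.range fun p : Refl W × Bool =>
      (if p.2 then unitRoot p.1 else -unitRoot p.1 : Euc l)) (t := rootSet W) (by
    rintro _ ⟨⟨s, a⟩, rfl⟩
    cases a
    · exact neg_mem_rootSet (unitRoot_mem s)
    · exact unitRoot_mem s) rootSet_finite
  rw [← Set.image_univ, Set.ncard_image_of_injective _ hinj, Set.ncard_univ,
    Nat.card_eq_fintype_card, Fintype.card_prod, Fintype.card_bool] at h
  omega

end RootSet

/-- Vectors in an open half space with pairwise nonacute angles are linearly independent. -/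
theorem linearIndependent_of_inner_nonpos {E ι : Type*} [NormedAddCommGroup E]
    [InnerProductSpace ℝ E] [Fintype ι] {v : ι → E} {x : E} (hx : ∀ i, 0 < ⟪x, v i⟫)
    (hv : ∀ i j, i ≠ j → ⟪v i, v j⟫ ≤ 0) : LinearIndependent ℝ v := by
  rw [Fintype.linearIndependent_iff]
  intro g hg
  -- For a relation split into its positive and negative parts `a`, `b`, of disjoint supports, the
  -- squared norm of the common value is a sum of terms `b i * a j * ⟪v i, v j⟫ ≤ 0`. So the value
  -- is zero, and pairing with `x` kills the coefficients.
  have key : ∀ a b : ι → ℝ, (∀ i, 0 ≤ a i) → (∀ i, 0 ≤ b i) → (∀ i, a i * b i = 0) →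
      ∑ i, a i • v i = ∑ i, b i • v i → ∀ i, a i = 0 := by
    intro a b ha hb hab h
    have h1 : ⟪∑ i, a i • v i, ∑ i, a i • v i⟫ ≤ 0 := by
      conv_lhs => rw [h]; rw (occs := .pos [2]) [← h]
      rw [sum_inner]
      refine Finset.sum_nonpos fun i _ => ?_
      rw [inner_sum]
      refine Finset.sum_nonpos fun j _ => ?_
      rw [real_inner_smul_left, real_inner_smul_right, ← mul_assoc]
      by_cases hij : i = j
      · rw [hij, mul_comm (b j), hab, zero_mul]
      · exact mul_nonpos_of_nonneg_of_nonpos (mul_nonneg (hb i) (ha j)) (hv i j hij)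
    have h2 : ∑ i, a i • v i = 0 := real_inner_self_nonpos.1 h1
    have h3 : ∑ i, a i * ⟪x, v i⟫ = 0 := by
      have := congrArg (fun u => ⟪x, u⟫) h2
      simpa [inner_sum, real_inner_smul_right] using this
    intro i
    have h4 := (Finset.sum_eq_zero_iff_of_nonneg
      (fun i _ => mul_nonneg (ha i) (hx i).le)).1 h3 i (Finset.mem_univ i)
    exact (mul_eq_zero.1 h4).resolve_right (hx i).ne'
  have h0 : ∀ i, (g i)⁺ * (g i)⁻ = 0 := fun i => by
    rcases le_total 0 (g i) with h | h
    · rw [negPart_eq_zero.2 h, mul_zero]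
    · rw [posPart_eq_zero.2 h, zero_mul]
  have h1 : ∑ i, (g i)⁺ • v i = ∑ i, (g i)⁻ • v i := by
    rw [← sub_eq_zero, ← Finset.sum_sub_distrib, ← hg]
    exact Finset.sum_congr rfl fun i _ => by rw [← sub_smul, posPart_sub_negPart]
  intro i
  have h2 := key _ _ (fun i => posPart_nonneg _) (fun i => negPart_nonneg _) h0 h1 i
  have h3 := key _ _ (fun i => negPart_nonneg _) (fun i => posPart_nonneg _)
    (fun i => by rw [mul_comm]; exact h0 i) h1.symm i
  rw [← posPart_sub_negPart (g i), h2, h3, sub_zero]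

/-- `v` is a nonnegative combination of the elements of `t`. -/
def InCone (t : Finset (Euc l)) (v : Euc l) : Prop :=
  ∃ a : Euc l → ℝ, (∀ γ, 0 ≤ a γ) ∧ v = ∑ γ ∈ t, a γ • γ

theorem exists_minimal_cone (P : Finset (Euc l)) :
    ∃ t ⊆ P, (∀ β ∈ P, InCone t β) ∧ ∀ α ∈ t, ¬ InCone (t.erase α) α := by
  classical
  have h : ∃ n, ∃ t ⊆ P, (∀ β ∈ P, InCone t β) ∧ t.card = n := by
    refine ⟨_, P, subset_rfl, fun β hβ => ⟨Pi.single β 1, fun γ => ?_, ?_⟩, rfl⟩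
    · by_cases h : γ = β <;> simp [h]
    · rw [Finset.sum_eq_single β] <;> simp +contextual [hβ]
  obtain ⟨t, h1, h2, h3⟩ := Nat.find_spec h
  refine ⟨t, h1, h2, fun α hα ⟨b, hb, hb'⟩ => ?_⟩
  refine Nat.find_min h (m := (t.erase α).card) (h3 ▸ Finset.card_erase_lt_of_mem hα)
    ⟨_, (Finset.erase_subset _ _).trans h1, fun β hβ => ?_, rfl⟩
  obtain ⟨a, ha, ha'⟩ := h2 β hβ
  refine ⟨fun γ => a γ + a α * b γ, fun γ => add_nonneg (ha γ) (mul_nonneg (ha α) (hb γ)), ?_⟩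
  simp only [add_smul, mul_smul, Finset.sum_add_distrib, ← Finset.smul_sum]
  rw [← hb', ha', add_comm, Finset.add_sum_erase t (fun γ => a γ • γ) hα]

/-- If `⟪α, β⟫ > 0`, the reflected root `β - 2⟪α, β⟫ α` or its negative is in the cone of `t`. This
expresses a multiple of `β`, respectively of `α`, by the other generators and contradicts
minimality. -/
theorem inner_nonpos_of_minimal_cone {W : Subgroup (Euc l ≃ₗᵢ[ℝ] Euc l)} {x₀ : Euc l}
    (hx₀ : ∀ β ∈ rootSet W, ⟪x₀, β⟫ ≠ 0) {P t : Finset (Euc l)}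
    (hP : ∀ β, β ∈ P ↔ β ∈ rootSet W ∧ 0 < ⟪x₀, β⟫) (htP : t ⊆ P) (hcone : ∀ β ∈ P, InCone t β)
    (hmin : ∀ α ∈ t, ¬ InCone (t.erase α) α) {α β : Euc l} (hα : α ∈ t) (hβ : β ∈ t)
    (hαβ : α ≠ β) : ⟪α, β⟫ ≤ 0 := by
  classical
  -- After all multiples of `β` are moved to the left, pairing with `x₀` shows that the remaining
  -- coefficient `k - a β` is positive; dividing by it puts `β` in the cone of the others.
  have key : ∀ β ∈ t, ∀ α ∈ t, α ≠ β → ∀ (c k : ℝ), 0 < c → ∀ a : Euc l → ℝ, (∀ γ, 0 ≤ a γ) →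
      k • β = c • α + ∑ γ ∈ t, a γ • γ → False := by
    intro β hβ α hα hαβ c k hc a ha h
    have h1 : (k - a β) • β = c • α + ∑ γ ∈ t.erase β, a γ • γ := by
      rw [← Finset.add_sum_erase _ _ hβ] at h
      rw [sub_smul, h]; abel
    have hpos : ∀ γ ∈ t, 0 < ⟪x₀, γ⟫ := fun γ hγ => ((hP γ).1 (htP hγ)).2
    have h2 : 0 < (k - a β) * ⟪x₀, β⟫ := by
      rw [← real_inner_smul_right, h1, inner_add_right, real_inner_smul_right, inner_sum]
      refine add_pos_of_pos_of_nonneg (mul_pos hc (hpos α hα)) (Finset.sum_nonneg fun γ hγ => ?_)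
      rw [real_inner_smul_right]
      exact mul_nonneg (ha γ) (hpos γ (Finset.mem_of_mem_erase hγ)).le
    have hk : 0 < k - a β := pos_of_mul_pos_left h2 (hpos β hβ).le
    refine hmin β hβ ⟨fun γ => (k - a β)⁻¹ * (a γ + if γ = α then c else 0), fun γ =>
      mul_nonneg (inv_nonneg.2 hk.le) (add_nonneg (ha γ) (by split_ifs <;> positivity)), ?_⟩
    have h3 : ∑ γ ∈ t.erase β, ((k - a β)⁻¹ * (a γ + if γ = α then c else 0)) • γ =
        (k - a β)⁻¹ • (c • α + ∑ γ ∈ t.erase β, a γ • γ) := by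
      simp only [mul_smul, ← Finset.smul_sum, add_smul, Finset.sum_add_distrib, ite_smul, zero_smul,
        Finset.sum_ite_eq', Finset.mem_erase, hα, and_true, ne_eq, hαβ, not_false_eq_true, if_true]
      rw [add_comm]
    rw [h3, ← h1, smul_smul, inv_mul_cancel₀ hk.ne', one_smul]
  by_contra! hpos
  have hroot : ∀ γ ∈ t, γ ∈ rootSet W := fun γ hγ => ((hP γ).1 (htP hγ)).1
  have hv := reflection_mem_rootSet (hroot α hα) (hroot β hβ)
  rcases lt_or_gt_of_ne (hx₀ _ hv) with h | h
  · obtain ⟨a, ha, ha'⟩ := hcone (-(β - (2 * ⟪α, β⟫) • α)) ((hP _).2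
      ⟨neg_mem_rootSet hv, by rw [inner_neg_right]; linarith⟩)
    refine key α hα β hβ hαβ.symm 1 (2 * ⟪α, β⟫) one_pos a ha ?_
    rw [← ha']; module
  · obtain ⟨a, ha, ha'⟩ := hcone _ ((hP _).2 ⟨hv, h⟩)
    refine key β hβ α hα hαβ (2 * ⟪α, β⟫) 1 (by positivity) a ha ?_
    rw [← ha']; module

/-- A basis of simple roots. -/
structure SimpleSystem (W : Subgroup (Euc l ≃ₗᵢ[ℝ] Euc l)) (ι : Type*) where
  basis : Module.Basis ι ℝ (Euc l)
  isRoot : ∀ i, basis i ∈ rootSet W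
  sign : ∀ β ∈ rootSet W, (∀ i, 0 ≤ basis.repr β i) ∨ ∀ i, basis.repr β i ≤ 0

theorem mem_iff_of_generated {W : Subgroup (Euc l ≃ₗᵢ[ℝ] Euc l)}
    (hgen : Subgroup.closure {w | w ∈ W ∧ IsReflection w} = W) {U : Submodule ℝ (Euc l)}
    (hU : ∀ β ∈ rootSet W, ∀ u ∈ U, u - (2 * ⟪β, u⟫) • β ∈ U) :
    ∀ w ∈ W, ∀ u ∈ U, w u ∈ U := by
  have hs : ∀ s : Refl W, ∀ u ∈ U, s.1 u ∈ U := fun s u hu => by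
    rw [← reflection_unitRoot s, reflection_unit (norm_unitRoot s)]
    exact hU _ (unitRoot_mem s) u hu
  intro w hw
  rw [← hgen] at hw
  induction hw using Subgroup.closure_induction'' with
  | mem x hx => exact hs ⟨x, hx⟩
  | inv_mem x hx =>
    rw [← eq_inv_of_mul_eq_one_left (refl_mul_self ⟨x, hx⟩)]
    exact hs ⟨x, hx⟩
  | one => exact fun u hu => hu
  | mul x y _ _ h1 h2 => exact fun u hu => h1 _ (h2 u hu)

/-- The span is `W`-stable. If it were zero there would be no reflections and every line would be
stable, which irreducibility forbids for `l ≥ 2`; in rank one the trivial group is a genuine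
exception. -/
theorem span_rootSet {W : Subgroup (Euc l ≃ₗᵢ[ℝ] Euc l)} (hW : IsIrreducibleReflectionGroup W)
    (hl : 2 ≤ l) : Submodule.span ℝ (rootSet W) = ⊤ := by
  refine (hW.irreducible _ (mem_iff_of_generated hW.generated fun β hβ u hu => ?_)).resolve_left ?_
  · exact sub_mem hu (Submodule.smul_mem _ _ (Submodule.subset_span hβ))
  · intro h0
    have h1 : ∀ β ∈ rootSet W, β = 0 := fun β hβ => by
      have := Submodule.subset_span (R := ℝ) hβ
      rwa [h0] at this
    let e : Euc l := EuclideanSpace.single ⟨0, by omega⟩ 1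
    have he : e ≠ 0 := fun h => by
      have := congrArg (fun v : Euc l => v ⟨0, by omega⟩) h
      simp [e] at this
    rcases hW.irreducible (ℝ ∙ e) (mem_iff_of_generated hW.generated fun β hβ =>
      absurd (h1 β hβ) (ne_zero_of_mem_rootSet hβ)) with h | h
    · exact he (Submodule.span_singleton_eq_bot.1 h)
    · have h2 := finrank_span_singleton (K := ℝ) he
      rw [h, finrank_top, finrank_euclideanSpace_fin] at h2
      omega

/-- Positive roots are those on one side of a vector `x₀` off all the hyperplanes; the simple ones
are minimal generators of their cone, independent because they make nonacute angles. -/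
theorem exists_simpleSystem {W : Subgroup (Euc l ≃ₗᵢ[ℝ] Euc l)}
    (hW : IsIrreducibleReflectionGroup W) (hl : 2 ≤ l) :
    ∃ t : Finset (Euc l), Nonempty (SimpleSystem W t) := by
  classical
  have := hW.finite
  obtain ⟨x₀, hx₀⟩ : ∃ x₀ : Euc l, ∀ β ∈ rootSet W, ⟪x₀, β⟫ ≠ 0 := by
    have h := Subspace.biUnion_ne_univ_of_top_notMem (k := ℝ) (E := Euc l)
      (s := (rootSet_finite (W := W)).toFinset.image fun β => (ℝ ∙ β)ᗮ) (by
        intro h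
        obtain ⟨β, hβ, h⟩ := Finset.mem_image.1 h
        rw [Set.Finite.mem_toFinset] at hβ
        rw [Submodule.orthogonal_eq_top_iff, Submodule.span_singleton_eq_bot] at h
        exact ne_zero_of_mem_rootSet hβ h)
    obtain ⟨x, hx⟩ := (Set.ne_univ_iff_exists_notMem _).1 h
    refine ⟨x, fun β hβ h => hx ?_⟩
    simp only [Set.mem_iUnion, Finset.mem_image, exists_prop]
    refine ⟨_, ⟨β, (Set.Finite.mem_toFinset _).2 hβ, rfl⟩, ?_⟩
    rw [SetLike.mem_coe, Submodule.mem_orthogonal_singleton_iff_inner_left]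
    exact h
  let P : Finset (Euc l) := {β ∈ (rootSet_finite (W := W)).toFinset | 0 < ⟪x₀, β⟫}
  have hP : ∀ β, β ∈ P ↔ β ∈ rootSet W ∧ 0 < ⟪x₀, β⟫ := fun β => by simp [P]
  obtain ⟨t, htP, hcone, hmin⟩ := exists_minimal_cone P
  have hli : LinearIndependent ℝ (fun γ : t => γ.1) :=
    linearIndependent_of_inner_nonpos (x := x₀) (fun γ => ((hP _).1 (htP γ.2)).2)
      fun α β h => inner_nonpos_of_minimal_cone hx₀ hP htP hcone hmin α.2 β.2
        fun h' => h (Subtype.ext h')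
  have hsum : ∀ (a : Euc l → ℝ), ∑ γ ∈ t, a γ • γ = ∑ γ : t, a γ • γ.1 := fun a =>
    (Finset.sum_coe_sort t fun γ => a γ • γ).symm
  have hspan : ⊤ ≤ Submodule.span ℝ (Set.range fun γ : t => γ.1) := by
    rw [← span_rootSet hW hl, Submodule.span_le]
    have h1 : ∀ β ∈ P, β ∈ Submodule.span ℝ (Set.range fun γ : t => γ.1) := by
      intro β hβ
      obtain ⟨a, -, ha⟩ := hcone β hβ
      rw [ha]
      exact Submodule.sum_mem _ fun γ hγ =>
        Submodule.smul_mem _ _ (Submodule.subset_span ⟨⟨γ, hγ⟩, rfl⟩)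
    intro β hβ
    rcases lt_or_gt_of_ne (hx₀ β hβ) with h | h
    · rw [← neg_neg β]
      exact neg_mem (h1 _ ((hP _).2 ⟨neg_mem_rootSet hβ, by rw [inner_neg_right]; linarith⟩))
    · exact h1 β ((hP β).2 ⟨hβ, h⟩)
  let b := Module.Basis.mk hli hspan
  have hrepr : ∀ β ∈ P, ∀ i, 0 ≤ b.repr β i := by
    intro β hβ i
    obtain ⟨a, ha0, ha⟩ := hcone β hβ
    rw [hsum] at ha
    have h1 : β = ∑ γ : t, a γ • b γ := by
      rw [ha]; simp [b]
    rw [h1, Module.Basis.repr_sum_self]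
    exact ha0 _
  refine ⟨t, ⟨⟨b, fun i => ?_, fun β hβ => ?_⟩⟩⟩
  · simp only [b, Module.Basis.mk_apply]
    exact ((hP _).1 (htP i.2)).1
  · rcases lt_or_gt_of_ne (hx₀ β hβ) with h | h
    · right
      intro i
      have h2 := hrepr (-β) ((hP _).2 ⟨neg_mem_rootSet hβ, by rw [inner_neg_right]; linarith⟩) i
      rw [map_neg, Finsupp.neg_apply] at h2
      linarith
    · exact Or.inl (hrepr β ((hP β).2 ⟨hβ, h⟩))

end Roots

/-! ### Combinatorics and spectrum of the Coxeter graph. -/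

section CoxeterGraph

variable {ι : Type*} [Fintype ι] [DecidableEq ι]

/-- Gram matrices of the simple unit roots of an irreducible finite reflection group. -/
structure IsCoxeterGram (A : Matrix ι ι ℝ) : Prop where
  symm : ∀ i j, A i j = A j i
  diag : ∀ i, A i i = 1
  pos : ∀ x : ι → ℝ, x ≠ 0 → 0 < ∑ i, ∑ j, x i * x j * A i j
  nonpos : ∀ i j, i ≠ j → A i j ≤ 0
  le : ∀ i j, i ≠ j → A i j ≠ 0 → A i j ≤ -(1 / 2)
  connected : ∀ I : Finset ι, I.Nonempty → I ≠ Finset.univ → ∃ i ∈ I, ∃ j ∉ I, A i j ≠ 0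

open scoped Classical in
/-- The adjacency function of the Coxeter graph. -/
noncomputable def adj (A : Matrix ι ι ℝ) (i j : ι) : ℕ := if i ≠ j ∧ A i j ≠ 0 then 1 else 0

/-- The number of neighbours in the Coxeter graph. -/
noncomputable def valency (A : Matrix ι ι ℝ) (i : ι) : ℕ := ∑ j, adj A i j

/-- Twice the number of edges of the Coxeter graph inside `S`. -/
noncomputable def edges (A : Matrix ι ι ℝ) (S : Finset ι) : ℕ := ∑ i ∈ S, ∑ j ∈ S, adj A i j

theorem adj_self (A : Matrix ι ι ℝ) (i : ι) : adj A i i = 0 := by simp [adj]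

theorem adj_pos {A : Matrix ι ι ℝ} {i j : ι} (h : i ≠ j) (hA : A i j ≠ 0) : adj A i j = 1 := by
  simp [adj, h, hA]

theorem ne_of_adj_ne_zero {A : Matrix ι ι ℝ} {i j : ι} (h : adj A i j ≠ 0) :
    i ≠ j ∧ A i j ≠ 0 := by
  by_contra h'
  exact h (if_neg h')

namespace IsCoxeterGram

variable {A : Matrix ι ι ℝ} (hA : IsCoxeterGram A)

include hA

theorem adj_comm (i j : ι) : adj A i j = adj A j i := by
  simp only [adj, hA.symm i j, ne_comm]

/-- Positivity of the Gram form with each edge entry replaced by its upper bound `-1/2`. Testing it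
on suitable vectors bounds the cycles and the leaves of the graph. -/
theorem sum_adj_lt {x : ι → ℝ} (hx : ∀ i, 0 ≤ x i) (hx0 : x ≠ 0) :
    ∑ i, ∑ j, (adj A i j : ℝ) * (x i * x j) < 2 * ∑ i, x i ^ 2 := by
  have h1 := hA.pos x hx0
  have h2 : ∑ i, ∑ j, x i * x j * A i j ≤
      ∑ i, ∑ j, ((if i = j then x i * x j else 0) - 1 / 2 * ((adj A i j : ℝ) * (x i * x j))) := by
    refine Finset.sum_le_sum fun i _ => Finset.sum_le_sum fun j _ => ?_
    by_cases hij : i = j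
    · subst hij
      simp [adj_self, hA.diag]
    · rw [if_neg hij]
      have h3 := mul_nonneg (hx i) (hx j)
      by_cases h : A i j = 0
      · have : adj A i j = 0 := by simp [adj, h]
        rw [h, this]; simp
      · rw [adj_pos hij h]
        have := hA.le i j hij h
        push_cast
        nlinarith
  simp only [Finset.sum_sub_distrib, ← Finset.mul_sum, Finset.sum_ite_eq, Finset.mem_univ,
    if_true] at h2
  simp only [pow_two]
  linarith

/-- The test vector is the indicator of `S`. As `edges` counts twice, every induced subgraph has
fewer edges than vertices: the graph is a forest. -/
theorem edges_lt {S : Finset ι} (hS : S.Nonempty) : edges A S < 2 * S.card := by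
  obtain ⟨a, ha⟩ := hS
  have h := hA.sum_adj_lt (x := fun i => if i ∈ S then 1 else 0) (fun i => by positivity)
    (fun h => by simpa [ha] using congrFun h a)
  have h1 : ∑ i, ∑ j, (adj A i j : ℝ) * ((if i ∈ S then 1 else 0) * (if j ∈ S then 1 else 0)) =
      edges A S := by
    simp [edges]
  rw [h1] at h
  have h2 : ∑ i, ((if i ∈ S then 1 else 0 : ℝ)) ^ 2 = S.card := by simp
  rw [h2] at h
  exact_mod_cast h

theorem edges_insert {S : Finset ι} {a : ι} (ha : a ∉ S) :
    edges A (insert a S) = edges A S + 2 * ∑ j ∈ S, adj A a j := by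
  simp only [edges, Finset.sum_insert ha, adj_self, Finset.sum_add_distrib]
  have : ∑ i ∈ S, adj A i a = ∑ i ∈ S, adj A a i :=
    Finset.sum_congr rfl fun i _ => hA.adj_comm i a
  omega

theorem even_edges (S : Finset ι) : Even (edges A S) := by
  induction S using Finset.induction_on with
  | empty => simp [edges]
  | insert a S ha ih =>
    rw [hA.edges_insert ha]
    exact ih.add (even_two_mul _)

theorem edges_add_two_le {S : Finset ι} (hS : S.Nonempty) : edges A S + 2 ≤ 2 * S.card := by
  have h1 := hA.edges_lt hS
  obtain ⟨k, hk⟩ := hA.even_edges S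
  omega

/-- Connectedness lets a set of vertices grow by one neighbour at a time, each adding at least one
edge. -/
theorem exists_edges_ge [Nonempty ι] (n : ℕ) (hn : n + 1 ≤ Fintype.card ι) :
    ∃ S : Finset ι, S.card = n + 1 ∧ 2 * n ≤ edges A S := by
  induction n with
  | zero => exact ⟨{Classical.arbitrary ι}, by simp, by simp⟩
  | succ n ih =>
    obtain ⟨S, hS, hE⟩ := ih (by omega)
    obtain ⟨i, hi, j, hj, hij⟩ := hA.connected S (Finset.card_pos.1 (by omega)) (fun h => by
      rw [h, Finset.card_univ] at hS; omega)
    refine ⟨insert j S, by rw [Finset.card_insert_of_notMem hj, hS], ?_⟩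
    rw [hA.edges_insert hj]
    have h1 : adj A j i = 1 := adj_pos (fun h => hj (h ▸ hi)) (by rwa [hA.symm])
    have h2 := Finset.single_le_sum (f := fun k => adj A j k) (fun _ _ => Nat.zero_le _) hi
    simp only [h1] at h2
    omega

theorem two_mul_card_le [Nonempty ι] : 2 * Fintype.card ι ≤ ∑ i, valency A i + 2 := by
  have hpos : 0 < Fintype.card ι := Fintype.card_pos
  obtain ⟨S, hS, hE⟩ := hA.exists_edges_ge (Fintype.card ι - 1) (by omega)
  have h : S = Finset.univ := Finset.card_eq_iff_eq_univ S |>.1 (by omega)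
  subst h
  change _ ≤ edges A Finset.univ + 2
  omega

theorem one_le_valency (hι : 2 ≤ Fintype.card ι) (i : ι) : 1 ≤ valency A i := by
  obtain ⟨i', hi, j, hj, hij⟩ := hA.connected {i} ⟨i, by simp⟩ (fun h => by
    have := congrArg Finset.card h
    rw [Finset.card_singleton, Finset.card_univ] at this; omega)
  rw [Finset.mem_singleton] at hi hj
  subst hi
  have h2 := Finset.single_le_sum (f := fun k => adj A i' k) (fun _ _ => Nat.zero_le _)
    (Finset.mem_univ j)
  rw [adj_pos (Ne.symm hj) hij] at h2
  exact h2

theorem card_leaves_le [Nonempty ι] :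
    (Finset.univ.filter fun i => valency A i = 1).card ≤ 3 := by
  -- The test vector is 1 at the leaves and 2 elsewhere. With `n` vertices, `L` leaves and sum of
  -- valencies at least `2 n - 2`, the inequality gives `8 n - 8 - 4 L < 8 n - 6 L`, so `L < 4`.
  have h := hA.sum_adj_lt (x := fun i => 2 - if valency A i = 1 then 1 else 0)
    (fun i => by split_ifs <;> norm_num) (fun h => by
      have := congrFun h (Classical.arbitrary ι)
      simp only [Pi.zero_apply] at this
      split_ifs at this <;> norm_num at this)
  set a : ι → ℝ := fun i => if valency A i = 1 then 1 else 0 with ha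
  have hdeg : ∀ i, ∑ j, (adj A i j : ℝ) = valency A i := fun i => by simp [valency]
  have h1 : ∑ i, ∑ j, (adj A i j : ℝ) * ((2 - a i) * (2 - a j)) =
      4 * (∑ i, valency A i : ℕ) - 4 * ∑ i, a i + ∑ i, ∑ j, (adj A i j : ℝ) * (a i * a j) := by
    have e1 : ∀ i j, (adj A i j : ℝ) * ((2 - a i) * (2 - a j)) = 4 * (adj A i j : ℝ) -
        2 * (a i * (adj A i j : ℝ)) - 2 * (a j * (adj A i j : ℝ)) +
          (adj A i j : ℝ) * (a i * a j) := fun i j => by ring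
    simp only [e1, Finset.sum_add_distrib, Finset.sum_sub_distrib]
    have e2 : ∑ i, ∑ j, 2 * (a i * (adj A i j : ℝ)) = 2 * ∑ i, a i := by
      simp only [← Finset.mul_sum, hdeg]
      congr 1
      refine Finset.sum_congr rfl fun i _ => ?_
      simp only [ha]
      split_ifs with hi <;> simp [hi]
    have e3 : ∑ i, ∑ j, 2 * (a j * (adj A i j : ℝ)) = 2 * ∑ i, a i := by
      rw [Finset.sum_comm, ← e2]
      simp only [hA.adj_comm]
    have e4 : ∑ i, ∑ j, 4 * (adj A i j : ℝ) = 4 * (∑ i, valency A i : ℕ) := by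
      simp only [← Finset.mul_sum, hdeg]
      push_cast; rfl
    rw [e2, e3, e4]; ring
  have h2 : (0 : ℝ) ≤ ∑ i, ∑ j, (adj A i j : ℝ) * (a i * a j) := by
    refine Finset.sum_nonneg fun i _ => Finset.sum_nonneg fun j _ => ?_
    simp only [ha]; positivity
  have h3 : ∑ i, (2 - a i) ^ 2 = 4 * Fintype.card ι - 3 * ∑ i, a i := by
    have e : ∀ i, (2 - a i) ^ 2 = 4 - 3 * a i := fun i => by
      simp only [ha]; split_ifs <;> norm_num
    simp only [e, Finset.sum_sub_distrib, ← Finset.mul_sum]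
    simp [mul_comm]
  have h4 : ∑ i, a i = (Finset.univ.filter fun i => valency A i = 1).card := by
    simp [ha]
  have h5 : (2 * Fintype.card ι : ℝ) ≤ (∑ i, valency A i : ℕ) + 2 := by
    exact_mod_cast hA.two_mul_card_le
  rw [h1, h3, h4] at h
  have h6 : ((Finset.univ.filter fun i => valency A i = 1).card : ℝ) < 4 := by linarith
  have h7 : (Finset.univ.filter fun i => valency A i = 1).card < 4 := by exact_mod_cast h6
  omega

/-- A nonempty part of a forest has a vertex with at most one neighbour in it; colour the rest
first. -/
theorem exists_coloring : ∃ col : ι → Bool, ∀ i j, i ≠ j → A i j ≠ 0 → col i ≠ col j := by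
  have h : ∀ n, ∀ S : Finset ι, S.card = n →
      ∃ col : ι → Bool, ∀ i ∈ S, ∀ j ∈ S, i ≠ j → A i j ≠ 0 → col i ≠ col j := by
    intro n
    induction n with
    | zero =>
      intro S hS
      rw [Finset.card_eq_zero] at hS
      subst hS
      exact ⟨fun _ => true, by simp⟩
    | succ n ih =>
      intro S hS
      have hne : S.Nonempty := Finset.card_pos.1 (by omega)
      obtain ⟨a, ha, h1⟩ : ∃ a ∈ S, ∑ j ∈ S, adj A a j < 2 := by
        by_contra! h
        have h2 := Finset.card_nsmul_le_sum S _ 2 h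
        have h3 := hA.edges_lt hne
        rw [edges] at h3
        simp only [smul_eq_mul] at h2
        omega
      obtain ⟨col, hcol⟩ := ih (S.erase a) (by rw [Finset.card_erase_of_mem ha]; omega)
      obtain ⟨b, hb⟩ : ∃ b : Bool, ∀ j ∈ S, a ≠ j → A a j ≠ 0 → col j ≠ b := by
        by_cases hj : ∃ j ∈ S, a ≠ j ∧ A a j ≠ 0
        · obtain ⟨j, hjS, hj1, hj2⟩ := hj
          refine ⟨!(col j), fun k hkS hk1 hk2 => ?_⟩
          have : k = j := by
            by_contra hkj
            have h2 := Finset.sum_le_sum_of_subset (f := fun j => adj A a j)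
              (Finset.insert_subset hkS (Finset.singleton_subset_iff.2 hjS))
            rw [Finset.sum_pair hkj, adj_pos hj1 hj2, adj_pos hk1 hk2] at h2
            omega
          subst this
          simp
        · push Not at hj
          exact ⟨true, fun j hjS h1 h2 => absurd (hj j hjS h1) h2⟩
      refine ⟨Function.update col a b, fun i hi j hj hij hAij => ?_⟩
      by_cases hia : i = a
      · subst hia
        rw [Function.update_self, Function.update_of_ne hij.symm]
        exact (hb j hj hij hAij).symm
      · by_cases hja : j = a
        · subst hja
          rw [Function.update_self, Function.update_of_ne hia]
          exact hb i hi hij.symm (by rwa [hA.symm])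
        · rw [Function.update_of_ne hia, Function.update_of_ne hja]
          exact hcol i (Finset.mem_erase.2 ⟨hia, hi⟩) j (Finset.mem_erase.2 ⟨hja, hj⟩) hij hAij
  obtain ⟨col, hcol⟩ := h _ Finset.univ rfl
  exact ⟨col, fun i j => hcol i (Finset.mem_univ i) j (Finset.mem_univ j)⟩

/-- A solution of the tree-like system `∑ i, A i j * y i = 0` (at the zeros `j` of `y`) which is
nonzero at no more than one leaf vanishes. -/
theorem eq_zero_of_leaves (hι : 2 ≤ Fintype.card ι) {y : ι → ℂ}
    (hy : ∀ j, y j = 0 → ∑ i, (A i j : ℂ) * y i = 0)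
    (hleaf : ∀ i j, valency A i = 1 → valency A j = 1 → y i ≠ 0 → y j ≠ 0 → i = j) : y = 0 := by
  classical
  by_contra h0
  -- Edges are counted in the forest on `Y ∪ B`, where `Y` is the support of `y` and `B` the zeros
  -- of `y` adjacent to it. All neighbours of `Y` lie in `Y ∪ B`, all valencies on `Y` but perhaps
  -- one are at least 2, and a point of `B` has two neighbours in `Y`, since its equation cannot
  -- have a single nonzero term. The sum of valencies is then at least `2 * card - 1`, but a forest
  -- allows only `2 * card - 2`.
  set Y : Finset ι := Finset.univ.filter fun i => y i ≠ 0 with hY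
  have memY : ∀ i, i ∈ Y ↔ y i ≠ 0 := fun i => by simp [hY]
  set B : Finset ι := Finset.univ.filter fun j => y j = 0 ∧ ∃ i, y i ≠ 0 ∧ adj A i j ≠ 0 with hB
  have memB : ∀ j, j ∈ B ↔ y j = 0 ∧ ∃ i, y i ≠ 0 ∧ adj A i j ≠ 0 := fun i => by simp [hB]
  have hdisj : Disjoint Y B := by
    rw [Finset.disjoint_left]
    exact fun i hi hi' => (memY i).1 hi ((memB i).1 hi').1
  obtain ⟨a, ha⟩ : ∃ a, y a ≠ 0 := by
    by_contra! h
    exact h0 (funext h)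
  have hne : (Y ∪ B).Nonempty := ⟨a, Finset.mem_union_left _ ((memY a).2 ha)⟩
  have h1 := hA.edges_add_two_le hne
  rw [Finset.card_union_of_disjoint hdisj, edges, Finset.sum_union hdisj] at h1
  simp only [Finset.sum_union hdisj, Finset.sum_add_distrib] at h1
  have h2 : 2 * B.card ≤ ∑ j ∈ B, ∑ i ∈ Y, adj A j i := by
    rw [mul_comm, ← smul_eq_mul]
    refine Finset.card_nsmul_le_sum B _ 2 fun j hj => ?_
    obtain ⟨hj0, i, hi, hij⟩ := (memB j).1 hj
    by_contra! hlt
    have hji : adj A j i = 1 := by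
      rw [hA.adj_comm]
      exact adj_pos (ne_of_adj_ne_zero hij).1 (ne_of_adj_ne_zero hij).2
    have h3 := hy j hj0
    rw [Finset.sum_eq_single i] at h3
    · exact (mul_ne_zero (Complex.ofReal_ne_zero.2 (ne_of_adj_ne_zero hij).2) hi) h3
    · intro k _ hki
      by_cases hk : y k = 0
      · rw [hk, mul_zero]
      · by_cases hAkj : A k j = 0
        · rw [hAkj]; simp
        · exfalso
          have hjk : adj A j k = 1 := adj_pos (fun h => hk (h ▸ hj0)) (by rwa [hA.symm])
          have h4 := Finset.sum_le_sum_of_subset (f := fun i => adj A j i)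
            (Finset.insert_subset ((memY k).2 hk) (Finset.singleton_subset_iff.2 ((memY i).2 hi)))
          rw [Finset.sum_pair hki, hji, hjk] at h4
          omega
    · simp
  have h3 : ∑ i ∈ Y, ∑ j ∈ B, adj A i j = ∑ j ∈ B, ∑ i ∈ Y, adj A j i := by
    rw [Finset.sum_comm]
    simp only [hA.adj_comm]
  have h4 : ∑ i ∈ Y, valency A i = ∑ i ∈ Y, ∑ j ∈ Y, adj A i j + ∑ i ∈ Y, ∑ j ∈ B, adj A i j := by
    rw [← Finset.sum_add_distrib]
    refine Finset.sum_congr rfl fun i hi => ?_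
    rw [← Finset.sum_union hdisj, valency]
    refine (Finset.sum_subset (Finset.subset_univ _) fun j _ hj => ?_).symm
    rw [Finset.mem_union, not_or] at hj
    by_contra h
    have hj0 : y j = 0 := by
      by_contra h'
      exact hj.1 ((memY j).2 h')
    exact hj.2 ((memB j).2 ⟨hj0, i, (memY i).1 hi, h⟩)
  have h5 : 2 * Y.card ≤ ∑ i ∈ Y, valency A i + (Y.filter fun i => valency A i = 1).card := by
    rw [Finset.card_filter (fun i => valency A i = 1) Y, ← Finset.sum_add_distrib, mul_comm, ← smul_eq_mul]
    refine Finset.card_nsmul_le_sum Y _ 2 fun i _ => ?_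
    have := hA.one_le_valency hι i
    split_ifs <;> omega
  have h6 : (Y.filter fun i => valency A i = 1).card ≤ 1 := by
    refine Finset.card_le_one.2 fun i hi j hj => ?_
    rw [Finset.mem_filter, memY] at hi hj
    exact hleaf i j hi.2 hj.2 hi.1 hj.1
  omega

/-- Perron–Frobenius by minimization of the quadratic form on the unit sphere. The off-diagonal
entries are nonpositive, so absolute values of a minimizer give another one; it is an eigenvector,
and connectedness makes its coordinates strictly positive. -/
theorem exists_perron [Nonempty ι] : ∃ (μ : ℝ) (x : ι → ℝ), 0 < μ ∧ μ ≤ 1 ∧ (∀ i, 0 < x i) ∧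
    ∀ i, ∑ j, A i j * x j = μ * x i := by
  let q : (ι → ℝ) → ℝ := fun x => ∑ i, ∑ j, x i * x j * A i j
  let n : (ι → ℝ) → ℝ := fun x => ∑ i, x i ^ 2
  let K : Set (ι → ℝ) := {x | n x = 1}
  have hq : Continuous q := by fun_prop
  have hn : Continuous n := by fun_prop
  have hK : IsCompact K := by
    refine Metric.isCompact_of_isClosed_isBounded (isClosed_singleton.preimage hn) ?_
    refine (Metric.isBounded_iff_subset_closedBall 0).2 ⟨1, fun x hx => ?_⟩
    rw [mem_closedBall_zero_iff, pi_norm_le_iff_of_nonneg zero_le_one]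
    intro i
    have h1 : x i ^ 2 ≤ 1 := by
      have h := Finset.single_le_sum (f := fun i => x i ^ 2) (fun _ _ => sq_nonneg _)
        (Finset.mem_univ i)
      exact h.trans_eq hx
    rw [Real.norm_eq_abs]
    exact abs_le_one_iff_mul_self_le_one.2 (by nlinarith)
  obtain ⟨x, hxK, hmin⟩ := hK.exists_isMinOn
    ⟨Pi.single (Classical.arbitrary ι) 1, by
      simp only [K, n, Set.mem_ofPred_eq]
      rw [Finset.sum_eq_single (Classical.arbitrary ι)] <;> simp +contextual⟩ hq.continuousOn
  set μ := q x with hμ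
  have hsmul : ∀ (t : ℝ) y, q (t • y) = t ^ 2 * q y := fun t y => by
    simp only [q, Finset.mul_sum, Pi.smul_apply, smul_eq_mul]
    exact Finset.sum_congr rfl fun i _ => Finset.sum_congr rfl fun j _ => by ring
  have hnsmul : ∀ (t : ℝ) y, n (t • y) = t ^ 2 * n y := fun t y => by
    simp only [n, Finset.mul_sum, Pi.smul_apply, smul_eq_mul, mul_pow]
  have hn0 : ∀ y, 0 ≤ n y := fun y => Finset.sum_nonneg fun _ _ => sq_nonneg _
  have hle : ∀ y, μ * n y ≤ q y := by
    intro y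
    rcases (hn0 y).eq_or_lt with h | h
    · have : y = 0 := by
        funext i
        exact pow_eq_zero_iff two_ne_zero |>.1
          ((Finset.sum_eq_zero_iff_of_nonneg (fun _ _ => sq_nonneg _)).1 h.symm i
            (Finset.mem_univ i))
      rw [← h, this]; simp [q]
    · have hs : (Real.sqrt (n y))⁻¹ • y ∈ K := by
        simp only [K, Set.mem_ofPred_eq]
        rw [hnsmul, inv_pow, Real.sq_sqrt h.le, inv_mul_cancel₀ h.ne']
      have := hmin hs
      simp only [Set.mem_ofPred_eq] at this
      rw [hsmul, inv_pow, Real.sq_sqrt h.le] at this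
      rw [hμ, ← le_div_iff₀ h]
      rwa [inv_mul_eq_div] at this
  let u : ι → ℝ := fun i => |x i|
  have hnu : n u = 1 := by
    rw [← hxK]; simp [n, u]
  have hqu : q u ≤ μ := by
    refine Finset.sum_le_sum fun i _ => Finset.sum_le_sum fun j _ => ?_
    by_cases hij : i = j
    · subst hij
      simp only [u, abs_mul_abs_self, le_refl]
    · simp only [u, ← abs_mul]
      exact mul_le_mul_of_nonpos_right (le_abs_self _) (hA.nonpos i j hij)
  have hqu' : q u = μ := le_antisymm hqu (by have := hle u; rwa [hnu, mul_one] at this)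
  have heq : ∀ i, ∑ j, A i j * u j = μ * u i := by
    intro i
    set b : ℝ := ∑ j, A i j * u j - μ * u i with hb
    -- First variation in the direction of the `i`-th coordinate; the linear coefficient `2 * b`
    -- must vanish.
    have hexp : ∀ t : ℝ, 0 ≤ t * (2 * b) + t ^ 2 * (1 - μ) := by
      intro t
      have h1 := hle (u + Pi.single i t)
      have h2 : n (u + Pi.single i t) = n u + 2 * t * u i + t ^ 2 := by
        simp only [n, Pi.add_apply, add_sq, Finset.sum_add_distrib]
        congr 1
        · congr 1
          rw [Finset.sum_eq_single i] <;> simp +contextual [mul_comm, mul_left_comm]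
        · rw [Finset.sum_eq_single i] <;> simp +contextual
      have h3 : q (u + Pi.single i t) = q u + 2 * t * (∑ j, A i j * u j) + t ^ 2 := by
        have e : ∀ k j, (u + (Pi.single i t : ι → ℝ)) k * (u + (Pi.single i t : ι → ℝ)) j * A k j = u k * u j * A k j +
            ((Pi.single i t : ι → ℝ) k * (u j * A k j) + (Pi.single i t : ι → ℝ) j * (u k * A k j) +
              (Pi.single i t : ι → ℝ) k * ((Pi.single i t : ι → ℝ) j * A k j)) := fun k j => by
          simp only [Pi.add_apply]; ring
        have p : ∀ g : ι → ℝ, ∑ k, (Pi.single i t : ι → ℝ) k * g k = t * g i := fun g => by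
          rw [Finset.sum_eq_single i] <;> simp +contextual
        simp only [q, e, Finset.sum_add_distrib, ← Finset.mul_sum, p]
        have p2 : ∑ k, u k * A k i = ∑ j, u j * A i j :=
          Finset.sum_congr rfl fun j _ => by rw [hA.symm j i]
        rw [p2, hA.diag, Finset.sum_congr rfl fun j _ => mul_comm (A i j) (u j)]
        ring
      rw [h2, h3, hnu, hqu'] at h1
      rw [hb]
      nlinarith
    have hb0 : b = 0 := by
      by_contra hb0
      set d := |1 - μ| + 1 with hd
      have hd1 : 1 - μ < d := (le_abs_self _).trans_lt (lt_add_one _)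
      have hd0 : 0 < d := by positivity
      -- With `d > 1 - μ` this value of `t` is small enough for the linear term to dominate, which
      -- makes the expression negative unless `b = 0`.
      have h1 := hexp (-b / d)
      have h2 : -b / d * (2 * b) + (-b / d) ^ 2 * (1 - μ) = b ^ 2 / d ^ 2 * ((1 - μ) - 2 * d) := by
        field_simp; ring
      rw [h2] at h1
      have h3 : 0 < b ^ 2 / d ^ 2 := by positivity
      nlinarith
    linarith
  have hu0 : ∀ i, 0 ≤ u i := fun i => abs_nonneg _
  have hu : u ≠ 0 := fun h => by
    rw [h] at hnu; simp [n] at hnu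
  -- At a zero `i` of `u` the eigenvalue equation is a sum of nonpositive terms equal to zero, so
  -- all neighbours are zeros too; connectedness would give `u = 0`.
  have hpos : ∀ i, 0 < u i := by
    by_contra! h
    obtain ⟨a, ha⟩ := h
    have ha0 : u a = 0 := le_antisymm ha (hu0 a)
    obtain ⟨i, hi, j, hj, hij⟩ := hA.connected (Finset.univ.filter fun i => u i = 0) ⟨a, by simp [ha0]⟩
      (fun h => hu (funext fun i => by
        have := Finset.mem_univ i
        rw [← h] at this
        simpa using this))
    simp only [Finset.mem_filter, Finset.mem_univ, true_and] at hi hj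
    have h1 := heq i
    rw [hi, mul_zero] at h1
    have hterm : ∀ k, A i k * u k ≤ 0 := fun k => by
      by_cases hik : i = k
      · rw [← hik, hi, mul_zero]
      · exact mul_nonpos_of_nonpos_of_nonneg (hA.nonpos i k hik) (hu0 k)
    have h2 := (Finset.sum_eq_zero_iff_of_nonpos (fun k _ => hterm k)).1 h1 j (Finset.mem_univ j)
    exact (mul_ne_zero hij hj) h2
  refine ⟨μ, u, ?_, ?_, hpos, heq⟩
  · rw [← hqu']
    exact hA.pos u hu
  · let i := Classical.arbitrary ι
    have h1 := heq i
    have h2 : ∑ j, A i j * u j ≤ u i := by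
      rw [← Finset.add_sum_erase _ _ (Finset.mem_univ i), hA.diag, one_mul]
      have : ∑ k ∈ Finset.univ.erase i, A i k * u k ≤ 0 := Finset.sum_nonpos fun k hk =>
        mul_nonpos_of_nonpos_of_nonneg (hA.nonpos i k (Finset.ne_of_mem_erase hk).symm) (hu0 k)
      linarith
    rw [h1] at h2
    exact (mul_le_iff_le_one_left (hpos i)).1 h2

end IsCoxeterGram

end CoxeterGraph

/-! ### The Gram matrix of the simple roots satisfies the axioms above. -/

section SimpleRoots

local notation "⟪" x ", " y "⟫" => inner ℝ x y

namespace SimpleSystem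

variable {l : ℕ} {W : Subgroup (Euc l ≃ₗᵢ[ℝ] Euc l)} {ι : Type*} [Fintype ι] [DecidableEq ι]
  (S : SimpleSystem W ι)

/-- The Gram matrix of the simple roots. -/
noncomputable def gram : Matrix ι ι ℝ := Matrix.of fun i j => ⟪S.basis i, S.basis j⟫

theorem gram_apply (i j : ι) : S.gram i j = ⟪S.basis i, S.basis j⟫ := rfl

theorem gram_comm (i j : ι) : S.gram i j = S.gram j i := by
  rw [gram_apply, gram_apply, real_inner_comm]

theorem gram_diag (i : ι) : S.gram i i = 1 := by
  rw [gram_apply, real_inner_self_eq_norm_sq, (S.isRoot i).1, one_pow]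

theorem inner_eq_sum_left (v u : Euc l) : ⟪v, u⟫ = ∑ i, S.basis.repr v i * ⟪S.basis i, u⟫ := by
  conv_lhs => rw [← S.basis.sum_repr v]
  simp only [sum_inner, real_inner_smul_left]

theorem inner_simple_eq_sum (i : ι) (u : Euc l) :
    ⟪S.basis i, u⟫ = ∑ j, S.basis.repr u j * S.gram i j := by
  rw [real_inner_comm, S.inner_eq_sum_left]
  exact Finset.sum_congr rfl fun j _ => by rw [S.gram_comm, gram_apply]

theorem repr_reflect (a : ℝ) (i : ι) (β : Euc l) (j : ι) :
    S.basis.repr (β - a • S.basis i) j = S.basis.repr β j - if i = j then a else 0 := by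
  simp [Finsupp.single_apply]

theorem eq_simple {β : Euc l} (hβ : β ∈ rootSet W) (hpos : ∀ j, 0 ≤ S.basis.repr β j) {i : ι}
    (h : ∀ j, j ≠ i → S.basis.repr β j = 0) : β = S.basis i := by
  have h1 : β = S.basis.repr β i • S.basis i := by
    refine S.basis.ext_elem fun j => ?_
    by_cases hij : j = i
    · subst hij; simp
    · simp [h j hij, Ne.symm hij]
  have h2 := hβ.1
  rw [h1, norm_smul, (S.isRoot i).1, mul_one, Real.norm_of_nonneg (hpos i)] at h2
  rw [h1, h2, one_smul]

theorem repr_nonneg {β : Euc l} (hβ : β ∈ rootSet W) {j : ι} (hj : 0 < S.basis.repr β j) (i : ι) :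
    0 ≤ S.basis.repr β i :=
  (S.sign β hβ).resolve_right (fun h => absurd (h j) (not_le.2 hj)) i

/-- A positive root other than `α_i` has another positive coordinate, which the `i`-th simple
reflection leaves unchanged; one positive coordinate determines the sign of a root. -/
theorem reflect_nonneg {β : Euc l} (hβ : β ∈ rootSet W) (hpos : ∀ j, 0 ≤ S.basis.repr β j) {i : ι}
    (hne : β ≠ S.basis i) (j : ι) :
    0 ≤ S.basis.repr (β - (2 * ⟪S.basis i, β⟫) • S.basis i) j := by
  obtain ⟨k, hki, hk⟩ : ∃ k, k ≠ i ∧ S.basis.repr β k ≠ 0 := by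
    by_contra! h
    exact hne (S.eq_simple hβ hpos h)
  refine S.repr_nonneg (reflection_mem_rootSet (S.isRoot i) hβ) (j := k) ?_ j
  rw [repr_reflect, if_neg hki.symm, sub_zero]
  exact lt_of_le_of_ne (hpos k) hk.symm

theorem gram_nonpos {i j : ι} (hij : i ≠ j) : S.gram i j ≤ 0 := by
  have h := S.reflect_nonneg (S.isRoot j) (fun k => by
    rw [Module.Basis.repr_self, Finsupp.single_apply]; positivity)
    (i := i) (fun h => hij (S.basis.injective h).symm) i
  rw [repr_reflect, if_pos rfl, Module.Basis.repr_self, Finsupp.single_eq_of_ne hij] at h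
  rw [gram_apply]
  linarith

/-- Put `c = -2 ⟪α_i, α_j⟫ > 0`. Reflecting `α_j` in `α_i` gives the positive root `α_j + c α_i`;
reflecting that in `α_j` gives a positive root with coordinate `c ^ 2 - 1` at `α_j`. Hence `c ≥ 1`.
-/
theorem gram_le {i j : ι} (hij : i ≠ j) (hA : S.gram i j ≠ 0) : S.gram i j ≤ -(1 / 2) := by
  have hneg : S.gram i j < 0 := lt_of_le_of_ne (S.gram_nonpos hij) hA
  set c : ℝ := -(2 * S.gram i j) with hc
  have hc0 : 0 < c := by linarith
  have hβ := reflection_mem_rootSet (S.isRoot i) (S.isRoot j)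
  set β := S.basis j - (2 * ⟪S.basis i, S.basis j⟫) • S.basis i with hβd
  have hi : S.basis.repr β i = c := by
    rw [hβd, repr_reflect, if_pos rfl, Module.Basis.repr_self, Finsupp.single_eq_of_ne hij, hc,
      gram_apply]
    ring
  have hpos := S.repr_nonneg hβ (j := i) (by rw [hi]; exact hc0)
  have h := S.reflect_nonneg hβ hpos (i := j) (fun h => by
    rw [h, Module.Basis.repr_self, Finsupp.single_eq_of_ne hij] at hi
    exact hc0.ne hi) j
  rw [repr_reflect, if_pos rfl, hβd, repr_reflect, if_neg hij, Module.Basis.repr_self,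
    Finsupp.single_eq_same, inner_sub_right, real_inner_smul_right] at h
  have h1 : ⟪S.basis j, S.basis j⟫ = 1 := S.gram_diag j
  have h2 : ⟪S.basis j, S.basis i⟫ = S.gram i j := (S.gram_comm i j).symm
  have h3 : ⟪S.basis i, S.basis j⟫ = S.gram i j := rfl
  rw [h1, h2, h3] at h
  nlinarith

theorem gram_pos (x : ι → ℝ) (hx : x ≠ 0) : 0 < ∑ i, ∑ j, x i * x j * S.gram i j := by
  have h1 : ∑ i, ∑ j, x i * x j * S.gram i j = ⟪∑ i, x i • S.basis i, ∑ i, x i • S.basis i⟫ := by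
    simp only [sum_inner, inner_sum, real_inner_smul_left, real_inner_smul_right, gram_apply,
      mul_assoc]
    exact Finset.sum_congr rfl fun i _ => Finset.sum_congr rfl fun j _ => by
      rw [real_inner_comm]
  rw [h1]
  refine lt_of_le_of_ne real_inner_self_nonneg fun h => hx (funext fun i => ?_)
  exact Fintype.linearIndependent_iff.1 S.basis.linearIndependent x (inner_self_eq_zero.1 h.symm) i

/-- If `i ∉ J` and `s_i β` is supported in `J`, then `s_i β` is orthogonal to `α_i`, hence so is
`β`, against the hypothesis; and for `i ∈ J` the coordinates outside `J` do not change. -/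
theorem mem_of_reflect {J : Finset ι} (hJ : ∀ i ∈ J, ∀ j ∉ J, S.gram i j = 0) {β : Euc l} {i : ι}
    (hi : ⟪S.basis i, β⟫ ≠ 0)
    (h : ∀ j ∉ J, S.basis.repr (β - (2 * ⟪S.basis i, β⟫) • S.basis i) j = 0) :
    ∀ j ∉ J, S.basis.repr β j = 0 := by
  by_cases hiJ : i ∈ J
  · intro j hj
    have := h j hj
    rwa [repr_reflect, if_neg (ne_of_mem_of_not_mem hiJ hj), sub_zero] at this
  · exfalso
    have h1 := S.inner_simple_eq_sum i (β - (2 * ⟪S.basis i, β⟫) • S.basis i)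
    rw [Finset.sum_eq_zero fun j _ => ?_, inner_sub_right, real_inner_smul_right,
      real_inner_self_eq_norm_sq, (S.isRoot i).1] at h1
    · exact hi (by linarith)
    · by_cases hj : j ∈ J
      · rw [S.gram_comm, hJ j hj i hiJ, mul_zero]
      · rw [h j hj, zero_mul]

/-- Induction on the height. A positive root makes a positive scalar product with some simple root
in its support, and reflecting in it lowers the height. -/
theorem root_mem_or [Finite W] {J : Finset ι} (hJ : ∀ i ∈ J, ∀ j ∉ J, S.gram i j = 0)
    {β : Euc l} (hβ : β ∈ rootSet W) :
    (∀ j ∉ J, S.basis.repr β j = 0) ∨ ∀ j ∈ J, S.basis.repr β j = 0 := by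
  have key : ∀ β ∈ rootSet W, (∀ i, 0 ≤ S.basis.repr β i) →
      (∀ j ∉ J, S.basis.repr β j = 0) ∨ ∀ j ∈ J, S.basis.repr β j = 0 := by
    by_contra hcon
    let B : Set (Euc l) := {β | β ∈ rootSet W ∧ (∀ i, 0 ≤ S.basis.repr β i) ∧
      ¬ ((∀ j ∉ J, S.basis.repr β j = 0) ∨ ∀ j ∈ J, S.basis.repr β j = 0)}
    have hB : B.Nonempty := by
      by_contra hB
      rw [Set.not_nonempty_iff_eq_empty] at hB
      refine hcon fun β h1 h2 => ?_
      by_contra h3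
      exact (Set.eq_empty_iff_forall_notMem.1 hB β) ⟨h1, h2, h3⟩
    obtain ⟨β, ⟨h1, h2, h3⟩, hmin⟩ := Set.exists_min_image B (fun β => ∑ i, S.basis.repr β i)
      (rootSet_finite.subset fun _ h => h.1) hB
    obtain ⟨i, hi⟩ : ∃ i, 0 < S.basis.repr β i * ⟪S.basis i, β⟫ := by
      by_contra! h
      have h4 := Finset.sum_nonpos fun i (_ : i ∈ Finset.univ) => h i
      rw [← S.inner_eq_sum_left, real_inner_self_eq_norm_sq, h1.1] at h4
      linarith
    have hi' : 0 < ⟪S.basis i, β⟫ := pos_of_mul_pos_right hi (h2 i)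
    have hne : β ≠ S.basis i := by
      rintro rfl
      refine h3 ?_
      by_cases hiJ : i ∈ J
      · left
        intro j hj
        rw [Module.Basis.repr_self, Finsupp.single_eq_of_ne (ne_of_mem_of_not_mem hiJ hj).symm]
      · right
        intro j hj
        rw [Module.Basis.repr_self, Finsupp.single_eq_of_ne (ne_of_mem_of_not_mem hj hiJ)]
    set γ := β - (2 * ⟪S.basis i, β⟫) • S.basis i with hγ
    have h4 : (∀ j ∉ J, S.basis.repr γ j = 0) ∨ ∀ j ∈ J, S.basis.repr γ j = 0 := by
      by_contra h4
      have h5 := hmin γ ⟨reflection_mem_rootSet (S.isRoot i) h1, S.reflect_nonneg h1 h2 hne, h4⟩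
      simp only [hγ, repr_reflect, Finset.sum_sub_distrib, Finset.sum_ite_eq, Finset.mem_univ,
        if_true] at h5
      linarith
    rcases h4 with h4 | h4
    · exact h3 (Or.inl (S.mem_of_reflect hJ hi'.ne' h4))
    · refine h3 (Or.inr fun j hj => S.mem_of_reflect (J := Jᶜ) (fun a ha b hb => ?_) hi'.ne'
        (fun j hj => h4 j (by simpa using hj)) j (by simpa using hj))
      rw [S.gram_comm]
      exact hJ b (by simpa using hb) a (by simpa using ha)
  rcases S.sign β hβ with h | h
  · exact key β hβ h
  · simpa using key (-β) (neg_mem_rootSet hβ) (fun i => by simpa using h i)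

/-- Otherwise the vectors supported in `J` form a proper nonzero `W`-stable subspace, as every root
is in it or orthogonal to it. -/
theorem gram_connected (hW : IsIrreducibleReflectionGroup W) (J : Finset ι) (hJ : J.Nonempty)
    (hJ' : J ≠ Finset.univ) : ∃ i ∈ J, ∃ j ∉ J, S.gram i j ≠ 0 := by
  have := hW.finite
  by_contra! hcon
  let U : Submodule ℝ (Euc l) :=
    { carrier := {v | ∀ j ∉ J, S.basis.repr v j = 0}
      add_mem' := fun {a b} ha hb j hj => by simp [ha j hj, hb j hj]
      zero_mem' := fun j _ => by simp
      smul_mem' := fun c a ha j hj => by simp [ha j hj] }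
  have hU : ∀ v, v ∈ U ↔ ∀ j ∉ J, S.basis.repr v j = 0 := fun v => Iff.rfl
  have hinv := mem_iff_of_generated hW.generated (U := U) (fun β hβ u hu => by
    rcases S.root_mem_or hcon hβ with h | h
    · exact sub_mem hu (Submodule.smul_mem _ _ h)
    · have h1 : ⟪β, u⟫ = 0 := by
        rw [S.inner_eq_sum_left]
        refine Finset.sum_eq_zero fun i _ => ?_
        by_cases hi : i ∈ J
        · rw [h i hi, zero_mul]
        · rw [S.inner_simple_eq_sum, Finset.sum_eq_zero, mul_zero]
          intro j _
          by_cases hj : j ∈ J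
          · rw [S.gram_comm, hcon j hj i hi, mul_zero]
          · rw [(hU u).1 hu j hj, zero_mul]
      rw [h1, mul_zero, zero_smul, sub_zero]
      exact hu)
  obtain ⟨i, hi⟩ := hJ
  obtain ⟨j, hj⟩ : ∃ j, j ∉ J := by
    by_contra! h
    exact hJ' (Finset.eq_univ_iff_forall.2 h)
  rcases hW.irreducible U hinv with h | h
  · have h1 : S.basis i ∈ U := fun k hk => by
      rw [Module.Basis.repr_self, Finsupp.single_eq_of_ne (ne_of_mem_of_not_mem hi hk).symm]
    rw [h, Submodule.mem_bot] at h1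
    exact S.basis.ne_zero i h1
  · have h1 : S.basis j ∈ U := h ▸ Submodule.mem_top
    have h2 := h1 j hj
    rw [Module.Basis.repr_self, Finsupp.single_eq_same] at h2
    exact one_ne_zero h2

theorem isCoxeterGram (hW : IsIrreducibleReflectionGroup W) : IsCoxeterGram S.gram where
  symm := S.gram_comm
  diag := S.gram_diag
  pos := S.gram_pos
  nonpos _ _ := S.gram_nonpos
  le _ _ := S.gram_le
  connected := S.gram_connected hW

theorem card_eq (S : SimpleSystem W ι) : Fintype.card ι = l := by
  rw [← Module.finrank_eq_card_basis S.basis, finrank_euclideanSpace_fin]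

end SimpleSystem

end SimpleRoots

/-! ### The bipartite Coxeter element and a bound for the number of roots. -/

section CoxeterPairs

local notation "⟪" x ", " y "⟫" => inner ℝ x y

/-- A periodic sequence of nonzero reals with zero sum over a period changes sign from
negative to positive within the period. -/
theorem exists_sign_change {c : ℕ → ℝ} {h : ℕ} (hh : 0 < h) (hper : Function.Periodic c h)
    (hne : ∀ k, c k ≠ 0) (hsum : ∑ k ∈ Finset.range h, c k = 0) :
    ∃ k < h, c k < 0 ∧ 0 < c (k + 1) := by
  by_contra! hcon
  have h1 : ∀ k, c k < 0 → c (k + 1) < 0 := by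
    intro k hk
    have h2 : c (k + 1) = c (k % h + 1) := by
      rw [← hper.map_mod_nat (k + 1), ← hper.map_mod_nat (k % h + 1), Nat.mod_add_mod]
    rw [h2]
    rw [← hper.map_mod_nat k] at hk
    exact lt_of_le_of_ne (hcon _ (Nat.mod_lt _ hh) hk) (hne _)
  have hnon : (Finset.range h).Nonempty := Finset.nonempty_range_iff.2 hh.ne'
  obtain ⟨m, hm⟩ : ∃ m, c m < 0 := by
    by_contra! h2
    exact (Finset.sum_pos (fun k _ => lt_of_le_of_ne (h2 k) (hne k).symm) hnon).ne' hsum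
  have h3 : ∀ n, c (m + n) < 0 := fun n => by
    induction n with
    | zero => exact hm
    | succ n ih => exact h1 _ ih
  refine (Finset.sum_neg (fun k _ => ?_) hnon).ne hsum
  have h4 : c (k + m * h) = c k := hper.nat_mul m k
  rw [← h4]
  have h5 : m ≤ k + m * h := (Nat.le_mul_of_pos_right m hh).trans (Nat.le_add_left _ _)
  obtain ⟨n, hn⟩ := Nat.exists_eq_add_of_le h5
  rw [hn]
  exact h3 n

namespace SimpleSystem

variable {l : ℕ} {W : Subgroup (Euc l ≃ₗᵢ[ℝ] Euc l)} {ι : Type*} [Fintype ι] [DecidableEq ι]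
  (S : SimpleSystem W ι)

/-- Simple roots indexed by `J` are pairwise orthogonal. -/
def IsOrthogonalSet (J : Finset ι) : Prop := ∀ i ∈ J, ∀ j ∈ J, i ≠ j → S.gram i j = 0

/-- `g` is the product of the commuting simple reflections indexed by `J`. -/
def IsPartReflection (J : Finset ι) (g : Euc l ≃ₗᵢ[ℝ] Euc l) : Prop :=
  ∀ y, g y = y - ∑ i ∈ J, (2 * ⟪S.basis i, y⟫) • S.basis i

variable {S} {J : Finset ι} {g : Euc l ≃ₗᵢ[ℝ] Euc l}

theorem inner_sum_of_mem (hJ : S.IsOrthogonalSet J) (x : ι → ℝ) {i : ι} (hi : i ∈ J) :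
    ⟪S.basis i, ∑ j ∈ J, x j • S.basis j⟫ = x i := by
  rw [inner_sum, Finset.sum_eq_single i]
  · rw [real_inner_smul_right, ← gram_apply, gram_diag, mul_one]
  · intro j hj hji
    rw [real_inner_smul_right, ← gram_apply, hJ i hi j hj hji.symm, mul_zero]
  · exact fun h => absurd hi h

theorem exists_partReflection (J : Finset ι) (hJ : S.IsOrthogonalSet J) :
    ∃ g ∈ W, S.IsPartReflection J g := by
  induction J using Finset.induction_on with
  | empty => exact ⟨1, W.one_mem, fun y => by simp⟩
  | insert a J ha ih =>
    obtain ⟨g, hg, h⟩ := ih fun i hi j hj =>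
      hJ i (Finset.mem_insert_of_mem hi) j (Finset.mem_insert_of_mem hj)
    refine ⟨(ℝ ∙ S.basis a)ᗮ.reflection * g, W.mul_mem (S.isRoot a).2 hg, fun y => ?_⟩
    have h1 : ⟪S.basis a, g y⟫ = ⟪S.basis a, y⟫ := by
      rw [h, inner_sub_right, inner_sum, Finset.sum_eq_zero, sub_zero]
      intro i hi
      rw [real_inner_smul_right, ← gram_apply, hJ a (Finset.mem_insert_self _ _) i
        (Finset.mem_insert_of_mem hi) (ne_of_mem_of_not_mem hi ha).symm, mul_zero]
    rw [isometry_mul_apply, reflection_unit (S.isRoot a).1, h1, h, Finset.sum_insert ha]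
    abel

namespace IsPartReflection

variable (hJ : S.IsOrthogonalSet J) (hg : S.IsPartReflection J g)

include hg

theorem repr_of_not_mem (y : Euc l) {i : ι} (hi : i ∉ J) :
    S.basis.repr (g y) i = S.basis.repr y i := by
  rw [hg, map_sub, Finsupp.sub_apply, map_sum, Finsupp.finsetSum_apply, Finset.sum_eq_zero, sub_zero]
  intro j hj
  rw [map_smul, Module.Basis.repr_self, Finsupp.smul_apply,
    Finsupp.single_eq_of_ne (ne_of_mem_of_not_mem hj hi).symm, smul_zero]

theorem repr_of_mem (y : Euc l) {i : ι} (hi : i ∈ J) :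
    S.basis.repr (g y) i = S.basis.repr y i - 2 * ⟪S.basis i, y⟫ := by
  rw [hg, map_sub, Finsupp.sub_apply, map_sum, Finsupp.finsetSum_apply, Finset.sum_eq_single i]
  · simp
  · intro j hj hji
    rw [map_smul, Module.Basis.repr_self, Finsupp.smul_apply, Finsupp.single_eq_of_ne hji.symm,
      smul_zero]
  · exact fun h => absurd hi h

theorem apply_simple (i : ι) :
    g (S.basis i) = S.basis i - ∑ j ∈ J, (2 * S.gram j i) • S.basis j := hg _

include hJ

theorem apply_sum (x : ι → ℝ) : g (∑ i ∈ J, x i • S.basis i) = -∑ i ∈ J, x i • S.basis i := by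
  have h : ∀ i ∈ J, (2 * ⟪S.basis i, ∑ j ∈ J, x j • S.basis j⟫) • S.basis i =
      (2 : ℝ) • (x i • S.basis i) := fun i hi => by rw [inner_sum_of_mem hJ x hi, mul_smul]
  rw [hg, Finset.sum_congr rfl h, ← Finset.smul_sum]
  module

theorem involutive (y : Euc l) : g (g y) = y := by
  nth_rewrite 2 [hg]
  rw [map_sub, hg.apply_sum hJ, hg]
  abel

/-- Coordinates outside `J` do not change, so `β` is supported in `J`. There `⟪α_i, β⟫` is the
`i`-th coordinate itself, so the `i`-th reflection negates it; this is impossible for a positive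
root other than `α_i`. -/
theorem exists_eq_simple {β : Euc l} (hβ : β ∈ rootSet W) (hpos : ∀ i, 0 ≤ S.basis.repr β i)
    (hneg : ∀ i, S.basis.repr (g β) i ≤ 0) : ∃ i ∈ J, β = S.basis i := by
  have h1 : ∀ i ∉ J, S.basis.repr β i = 0 := fun i hi =>
    le_antisymm (by rw [← hg.repr_of_not_mem β hi]; exact hneg i) (hpos i)
  have h2 : β = ∑ i ∈ J, S.basis.repr β i • S.basis i := by
    conv_lhs => rw [← S.basis.sum_repr β]
    refine (Finset.sum_subset (Finset.subset_univ J) fun i _ hi => ?_).symm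
    rw [h1 i hi, zero_smul]
  obtain ⟨i, hi⟩ : ∃ i, S.basis.repr β i ≠ 0 := by
    by_contra! h
    refine ne_zero_of_mem_rootSet hβ (S.basis.ext_elem fun i => ?_)
    rw [h, map_zero, Finsupp.zero_apply]
  have hiJ : i ∈ J := by
    by_contra h
    exact hi (h1 i h)
  refine ⟨i, hiJ, ?_⟩
  by_contra hne
  have h3 := S.reflect_nonneg hβ hpos hne i
  have h4 : ⟪S.basis i, β⟫ = S.basis.repr β i := by
    conv_lhs => rw [h2]
    exact inner_sum_of_mem hJ _ hiJ
  rw [repr_reflect, if_pos rfl, h4] at h3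
  exact hi (le_antisymm (by linarith) (hpos i))

end IsPartReflection

variable (S)

/-- The data that define a bipartite Coxeter element and its plane. -/
structure CoxeterPair where
  J : Finset ι
  g₁ : Euc l ≃ₗᵢ[ℝ] Euc l
  g₂ : Euc l ≃ₗᵢ[ℝ] Euc l
  mem₁ : g₁ ∈ W
  mem₂ : g₂ ∈ W
  orth₁ : S.IsOrthogonalSet J
  orth₂ : S.IsOrthogonalSet Jᶜ
  part₁ : S.IsPartReflection J g₁
  part₂ : S.IsPartReflection Jᶜ g₂
  mu : ℝ
  mu_pos : 0 < mu
  mu_le : mu ≤ 1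
  x : ι → ℝ
  x_pos : ∀ i, 0 < x i
  perron : ∀ i, ∑ j, S.gram i j * x j = mu * x i

/-- The set `J` is one colour class of the graph; the members of a class are orthogonal. -/
theorem exists_coxeterPair (hW : IsIrreducibleReflectionGroup W) [Nonempty ι] :
    Nonempty S.CoxeterPair := by
  have hA := S.isCoxeterGram hW
  obtain ⟨col, hcol⟩ := hA.exists_coloring
  obtain ⟨mu, x, h1, h2, h3, h4⟩ := hA.exists_perron
  have o₁ : S.IsOrthogonalSet (Finset.univ.filter fun i => col i = true) := fun i hi j hj hij => by
    by_contra h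
    exact hcol i j hij h (by simp_all)
  have o₂ : S.IsOrthogonalSet (Finset.univ.filter fun i => col i = true)ᶜ :=
    fun i hi j hj hij => by
      by_contra h
      exact hcol i j hij h (by simp_all)
  obtain ⟨g₁, m₁, p₁⟩ := exists_partReflection _ o₁
  obtain ⟨g₂, m₂, p₂⟩ := exists_partReflection _ o₂
  exact ⟨⟨_, g₁, g₂, m₁, m₂, o₁, o₂, p₁, p₂, mu, h1, h2, x, h3, h4⟩⟩

namespace CoxeterPair

variable {S} (P : S.CoxeterPair)

/-- The Coxeter element. -/
noncomputable def w : Euc l ≃ₗᵢ[ℝ] Euc l := P.g₁ * P.g₂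

theorem w_mem : P.w ∈ W := W.mul_mem P.mem₁ P.mem₂

theorem w_apply (y : Euc l) : P.w y = P.g₁ (P.g₂ y) := rfl

/-- The first half of the Perron vector. -/
noncomputable def z₁ : Euc l := ∑ i ∈ P.J, P.x i • S.basis i

/-- The second half of the Perron vector. -/
noncomputable def z₂ : Euc l := ∑ i ∈ P.Jᶜ, P.x i • S.basis i

theorem inner_add (i : ι) : ⟪S.basis i, P.z₁ + P.z₂⟫ = P.mu * P.x i := by
  rw [z₁, z₂, Finset.sum_add_sum_compl, inner_sum, ← P.perron]
  exact Finset.sum_congr rfl fun j _ => by rw [real_inner_smul_right, mul_comm, gram_apply]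

/-- The coefficient of the action of the two involutions on their plane. -/
noncomputable def k : ℝ := 2 * (1 - P.mu)

theorem g₁_z₁ : P.g₁ P.z₁ = -P.z₁ := P.part₁.apply_sum P.orth₁ _

theorem g₂_z₂ : P.g₂ P.z₂ = -P.z₂ := P.part₂.apply_sum P.orth₂ _

/-- For `i ∈ J` the Perron equation reads `⟪α_i, z₂⟫ = (μ - 1) x_i`. So the two halves of the Perron
vector span a plane stable under both involutions. -/
theorem g₁_z₂ : P.g₁ P.z₂ = P.z₂ + P.k • P.z₁ := by
  have h : ∀ i ∈ P.J, (2 * ⟪S.basis i, P.z₂⟫) • S.basis i = (-P.k) • (P.x i • S.basis i) := by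
    intro i hi
    have h1 := P.inner_add i
    rw [inner_add_right, z₁, inner_sum_of_mem P.orth₁ _ hi] at h1
    rw [smul_smul, k]
    congr 1
    linarith
  rw [P.part₁, Finset.sum_congr rfl h, ← Finset.smul_sum, ← z₁]
  module

theorem g₂_z₁ : P.g₂ P.z₁ = P.z₁ + P.k • P.z₂ := by
  have h : ∀ i ∈ P.Jᶜ, (2 * ⟪S.basis i, P.z₁⟫) • S.basis i = (-P.k) • (P.x i • S.basis i) := by
    intro i hi
    have h1 := P.inner_add i
    rw [inner_add_right, z₂, inner_sum_of_mem P.orth₂ _ hi] at h1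
    rw [smul_smul, k]
    congr 1
    linarith
  rw [P.part₂, Finset.sum_congr rfl h, ← Finset.smul_sum, ← z₂]
  module

theorem w_z₁ : P.w P.z₁ = (P.k ^ 2 - 1) • P.z₁ + P.k • P.z₂ := by
  rw [w_apply, g₂_z₁, map_add, map_smul, g₁_z₁, g₁_z₂]
  module

theorem w_z₂ : P.w P.z₂ = (-P.k) • P.z₁ - P.z₂ := by
  rw [w_apply, g₂_z₂, map_neg, g₁_z₂]
  module

/-- A fixed `y` satisfies `g₂ y = g₁ y`, but `g₁` alters only coordinates in `J` and `g₂` only the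
others. So neither alters any, and `y` is orthogonal to all simple roots. -/
theorem eq_zero_of_fixed {y : Euc l} (hy : P.w y = y) : y = 0 := by
  have h1 : P.g₂ y = P.g₁ y := by
    rw [← P.part₁.involutive P.orth₁ (P.g₂ y), ← w_apply, hy]
  have h2 : ∀ i, ⟪S.basis i, y⟫ = 0 := by
    intro i
    have h3 := congrArg (fun u => S.basis.repr u i) h1
    by_cases hi : i ∈ P.J
    · rw [P.part₁.repr_of_mem y hi, P.part₂.repr_of_not_mem y (by simpa using hi)] at h3
      linarith
    · rw [P.part₁.repr_of_not_mem y hi, P.part₂.repr_of_mem y (by simpa using hi)] at h3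
      linarith
  have h3 := S.inner_eq_sum_left y y
  rw [Finset.sum_eq_zero fun i _ => by rw [h2, mul_zero]] at h3
  exact inner_self_eq_zero.1 h3

theorem inner_z_eq (β : Euc l) :
    ⟪P.z₁ + P.z₂, β⟫ = ∑ i, S.basis.repr β i * (P.mu * P.x i) := by
  rw [real_inner_comm, S.inner_eq_sum_left]
  exact Finset.sum_congr rfl fun i _ => by rw [inner_add]

theorem inner_z_nonneg {β : Euc l} (h : ∀ i, 0 ≤ S.basis.repr β i) : 0 ≤ ⟪P.z₁ + P.z₂, β⟫ := by
  rw [inner_z_eq]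
  exact Finset.sum_nonneg fun i _ => mul_nonneg (h i) (mul_pos P.mu_pos (P.x_pos i)).le

theorem inner_z_nonpos {β : Euc l} (h : ∀ i, S.basis.repr β i ≤ 0) : ⟪P.z₁ + P.z₂, β⟫ ≤ 0 := by
  rw [inner_z_eq]
  exact Finset.sum_nonpos fun i _ =>
    mul_nonpos_of_nonpos_of_nonneg (h i) (mul_pos P.mu_pos (P.x_pos i)).le

/-- The Perron vector has positive scalar product `μ x_i` with each simple root, so it lies in the
open chamber. -/
theorem inner_z_ne_zero {β : Euc l} (hβ : β ∈ rootSet W) : ⟪P.z₁ + P.z₂, β⟫ ≠ 0 := by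
  intro h0
  have hx : ∀ i, P.mu * P.x i ≠ 0 := fun i => (mul_pos P.mu_pos (P.x_pos i)).ne'
  refine ne_zero_of_mem_rootSet hβ (S.basis.ext_elem fun i => ?_)
  rw [map_zero, Finsupp.zero_apply]
  rw [inner_z_eq] at h0
  rcases S.sign β hβ with h | h
  · exact (mul_eq_zero.1 ((Finset.sum_eq_zero_iff_of_nonneg fun i _ =>
      mul_nonneg (h i) (mul_pos P.mu_pos (P.x_pos i)).le).1 h0 i (Finset.mem_univ i))).resolve_right
        (hx i)
  · exact (mul_eq_zero.1 ((Finset.sum_eq_zero_iff_of_nonpos fun i _ =>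
      mul_nonpos_of_nonpos_of_nonneg (h i) (mul_pos P.mu_pos (P.x_pos i)).le).1 h0 i
        (Finset.mem_univ i))).resolve_right (hx i)

/-- The positive roots that the Coxeter element makes negative. -/
def inversions : Set (Euc l) :=
  {β | β ∈ rootSet W ∧ 0 < ⟪P.z₁ + P.z₂, β⟫ ∧ ⟪P.z₁ + P.z₂, P.w β⟫ < 0}

/-- If `g₂ β` is negative, `β` is a simple root outside `J`; if it is positive, it is a simple root
in `J` because `g₁` makes it negative. Each index accounts for one inversion. -/
theorem ncard_inversions_le : P.inversions.ncard ≤ l := by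
  have h : P.inversions ⊆
      Set.range fun i => if i ∈ P.J then P.g₂ (S.basis i) else S.basis i := by
    rintro β ⟨hβ, h1, h2⟩
    have hpos := (S.sign β hβ).resolve_right fun h => (P.inner_z_nonpos h).not_gt h1
    have hneg := (S.sign _ (map_mem_rootSet P.w_mem hβ)).resolve_left fun h =>
      (P.inner_z_nonneg h).not_gt h2
    have hβ₂ := map_mem_rootSet P.mem₂ hβ
    rcases S.sign _ hβ₂ with h3 | h3
    · obtain ⟨i, hi, hi'⟩ := P.part₁.exists_eq_simple P.orth₁ hβ₂ h3 hneg
      refine ⟨i, ?_⟩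
      simp only [if_pos hi]
      rw [← hi', P.part₂.involutive P.orth₂]
    · obtain ⟨i, hi, hi'⟩ := P.part₂.exists_eq_simple P.orth₂ hβ hpos h3
      refine ⟨i, ?_⟩
      simp only [if_neg (Finset.mem_compl.1 hi), hi']
  refine (Set.ncard_le_ncard h (Set.finite_range _)).trans ?_
  rw [← Set.image_univ]
  refine (Set.ncard_image_le Set.finite_univ).trans ?_
  rw [Set.ncard_univ, Nat.card_eq_fintype_card, S.card_eq]

/-- The sum of `w ^ k z` over a period is fixed by `w`, hence zero. So for each root `β` the nowhere
zero sequence `⟪w ^ k z, β⟫` turns from negative to positive at some `k < h`, and then `w ^ (-(k +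
1)) β` is an inversion. The root is recovered from `k` and this inversion. -/
theorem ncard_rootSet_le [Finite W] {h : ℕ} (hh : 0 < h)
    (hz : (P.w ^ h) (P.z₁ + P.z₂) = P.z₁ + P.z₂) : (rootSet W).ncard ≤ h * l := by
  set z := P.z₁ + P.z₂ with hzd
  have hmem : ∀ k, P.w ^ k ∈ W := fun k => W.pow_mem P.w_mem k
  have hflip : ∀ (u : Euc l ≃ₗᵢ[ℝ] Euc l) (a b : Euc l), ⟪u a, b⟫ = ⟪a, u⁻¹ b⟫ := fun u a b =>
    LinearIsometryEquiv.inner_map_eq_flip u a b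
  have hsum : ∑ k ∈ Finset.range h, (P.w ^ k) z = 0 := by
    refine P.eq_zero_of_fixed ?_
    rw [map_sum]
    have h1 : ∀ k, P.w ((P.w ^ k) z) = (P.w ^ (k + 1)) z := fun k => by
      rw [pow_succ', isometry_mul_apply]
    simp only [h1]
    have h2 := Finset.sum_range_succ (fun k => (P.w ^ k) z) h
    rw [Finset.sum_range_succ', hz, pow_zero] at h2
    exact add_right_cancel h2
  have hex : ∀ β ∈ rootSet W, ∃ k < h, ⟪(P.w ^ k) z, β⟫ < 0 ∧ 0 < ⟪(P.w ^ (k + 1)) z, β⟫ := by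
    intro β hβ
    refine exists_sign_change (c := fun k => ⟪(P.w ^ k) z, β⟫) hh (fun k => ?_) (fun k => ?_) ?_
    · simp only
      rw [pow_add, isometry_mul_apply, hz]
    · rw [hflip]
      exact P.inner_z_ne_zero (map_mem_rootSet (W.inv_mem (hmem k)) hβ)
    · rw [← sum_inner, hsum, inner_zero_left]
  choose! k hk using hex
  have hfin : P.inversions.Finite := rootSet_finite.subset fun _ h => h.1
  have h1 := Set.ncard_le_ncard_of_injOn (s := rootSet W)
    (t := (Finset.range h : Set ℕ) ×ˢ P.inversions)
    (fun β => (k β, (P.w ^ (k β + 1))⁻¹ β)) (fun β hβ => ?_) (fun β hβ γ hγ hβγ => ?_)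
    ((Finset.finite_toSet _).prod hfin)
  · rw [Set.ncard_prod, Set.ncard_coe_finset, Finset.card_range] at h1
    exact h1.trans (Nat.mul_le_mul_left _ P.ncard_inversions_le)
  · obtain ⟨a, b, c⟩ := hk β hβ
    refine ⟨by simpa using a, map_mem_rootSet (W.inv_mem (hmem _)) hβ, ?_, ?_⟩
    · rw [← hflip]; exact c
    · rw [← isometry_mul_apply, pow_succ', mul_inv_rev, ← mul_assoc]
      have : P.w * (P.w ^ k β)⁻¹ * P.w⁻¹ = (P.w ^ k β)⁻¹ := by group
      rw [this, ← hflip]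
      exact b
  · simp only [Prod.mk.injEq] at hβγ
    rw [hβγ.1] at hβγ
    exact ((P.w ^ (k γ + 1))⁻¹).injective hβγ.2

end CoxeterPair

end SimpleSystem

end CoxeterPairs

/-! ### Eigenvectors and eigenspaces of the Coxeter element. -/

section CoxeterElement

local notation "⟪" x ", " y "⟫" => inner ℝ x y

section Complexification

variable {l : ℕ}

/-- The bilinear pairing of a real vector with a complex one. -/
noncomputable def bil (u : Euc l) (X : Fin l → ℂ) : ℂ := ∑ k, ((u k : ℝ) : ℂ) * X k

/-- A real vector as a complex one. -/
noncomputable def cplx (u : Euc l) : Fin l → ℂ := fun k => ((u k : ℝ) : ℂ)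

theorem bil_cplx (u v : Euc l) : bil u (cplx v) = ((⟪u, v⟫ : ℝ) : ℂ) := by
  simp only [bil, cplx, PiLp.inner_apply, RCLike.inner_apply, conj_trivial]
  push_cast
  exact Finset.sum_congr rfl fun _ _ => mul_comm _ _

theorem bil_smul_right (a : ℂ) (u : Euc l) (X : Fin l → ℂ) : bil u (a • X) = a * bil u X := by
  simp only [bil, Pi.smul_apply, smul_eq_mul, Finset.mul_sum]
  exact Finset.sum_congr rfl fun _ _ => by ring

theorem bil_add_right (u : Euc l) (X Y : Fin l → ℂ) : bil u (X + Y) = bil u X + bil u Y := by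
  simp only [bil, Pi.add_apply, mul_add, Finset.sum_add_distrib]

theorem bil_neg_left (u : Euc l) (X : Fin l → ℂ) : bil (-u) X = -bil u X := by
  simp [bil]

theorem bil_add_left (u v : Euc l) (X : Fin l → ℂ) : bil (u + v) X = bil u X + bil v X := by
  simp [bil, add_mul, Finset.sum_add_distrib]

theorem bil_smul_left (a : ℝ) (u : Euc l) (X : Fin l → ℂ) : bil (a • u) X = (a : ℂ) * bil u X := by
  simp [bil, Finset.mul_sum, mul_assoc]

theorem bil_sum_left {ι : Type*} (s : Finset ι) (u : ι → Euc l) (X : Fin l → ℂ) :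
    bil (∑ i ∈ s, u i) X = ∑ i ∈ s, bil (u i) X :=
  map_sum (AddMonoidHom.mk' (fun u => bil u X) fun u v => bil_add_left u v X) u s

theorem bil_single (k : Fin l) (X : Fin l → ℂ) :
    bil (EuclideanSpace.single k (1 : ℝ)) X = X k := by
  rw [bil, Finset.sum_eq_single k] <;> simp +contextual

/-- The pairing as a linear form in the complex vector. -/
noncomputable def bilForm (u : Euc l) : (Fin l → ℂ) →ₗ[ℂ] ℂ where
  toFun := bil u
  map_add' := bil_add_right u
  map_smul' a X := bil_smul_right a u X

theorem eval_linForm (u : Euc l) (v : Fin l → ℂ) : eval v (linForm ℂ u) = bil u v := by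
  simp [linForm, bil]

theorem cmat_mulVec_cplx (w : Euc l ≃ₗᵢ[ℝ] Euc l) (u : Euc l) :
    (cmat ℂ w).mulVec (cplx u) = cplx (w u) := cmat_mulVec ℂ w u

theorem bil_mulVec (w : Euc l ≃ₗᵢ[ℝ] Euc l) (u : Euc l) (X : Fin l → ℂ) :
    bil u ((cmat ℂ w).mulVec X) = bil (w⁻¹ u) X := by
  have h1 : ∀ (u : Euc l) (Y : Fin l → ℂ), bil u Y = dotProduct (cplx u) Y := fun u Y => rfl
  rw [h1, h1, Matrix.dotProduct_mulVec, ← Matrix.mulVec_transpose, cmat_transpose, cmat_mulVec_cplx]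

theorem pow_mulVec {w : Euc l ≃ₗᵢ[ℝ] Euc l} {v : Fin l → ℂ} {lam : ℂ}
    (h : (cmat ℂ w).mulVec v = lam • v) (n : ℕ) :
    (cmat ℂ (w ^ n)).mulVec v = lam ^ n • v := by
  induction n with
  | zero => rw [pow_zero, cmat_one, Matrix.one_mulVec, pow_zero, one_smul]
  | succ n ih =>
    rw [pow_succ', cmat_mul, ← Matrix.mulVec_mulVec, ih, Matrix.mulVec_smul, h, smul_smul,
      pow_succ]

end Complexification

namespace SimpleSystem

variable {l : ℕ} {W : Subgroup (Euc l ≃ₗᵢ[ℝ] Euc l)} {ι : Type*} [Fintype ι] [DecidableEq ι]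
  {S : SimpleSystem W ι}

theorem eq_zero_of_bil {X : Fin l → ℂ} (h : ∀ i, bil (S.basis i) X = 0) : X = 0 := by
  funext k
  rw [Pi.zero_apply, ← bil_single k X, ← S.basis.sum_repr (EuclideanSpace.single k (1 : ℝ)), bil_sum_left]
  exact Finset.sum_eq_zero fun i _ => by rw [bil_smul_left, h, mul_zero]

namespace CoxeterPair

variable (P : S.CoxeterPair)

/-- A nonreal root of `t ^ 2 - k * t + 1`. -/
noncomputable def tau : ℂ := ⟨P.k / 2, Real.sqrt (4 - P.k ^ 2) / 2⟩

theorem tau_im_pos : 0 < P.tau.im := by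
  have h1 : 0 ≤ P.k := by have := P.mu_le; unfold k; linarith
  have h2 : P.k < 2 := by have := P.mu_pos; unfold k; linarith
  have : 0 < Real.sqrt (4 - P.k ^ 2) := Real.sqrt_pos.2 (by nlinarith)
  simp only [tau]
  positivity

theorem tau_sq : P.tau ^ 2 = P.k * P.tau - 1 := by
  have h1 : 0 ≤ P.k := by have := P.mu_le; unfold k; linarith
  have h2 : P.k < 2 := by have := P.mu_pos; unfold k; linarith
  have h3 := Real.mul_self_sqrt (show 0 ≤ 4 - P.k ^ 2 by nlinarith)
  apply Complex.ext
  · rw [pow_two] at h3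
    simp [tau, pow_two]
    linarith
  · simp [tau, pow_two]
    ring

theorem eq_zero_of_add_tau {a b : ℝ} (h : (a : ℂ) + P.tau * b = 0) : a = 0 ∧ b = 0 := by
  have h1 := congrArg Complex.im h
  simp at h1
  have h2 := h1.resolve_left P.tau_im_pos.ne'
  rw [h2] at h
  simp at h
  exact ⟨h, h2⟩

/-- The eigenvalue of the Coxeter element on its plane. -/
noncomputable def lam : ℂ := P.k ^ 2 - 1 - P.k * P.tau

/-- The eigenvector of the Coxeter element in its plane. -/
noncomputable def v : Fin l → ℂ := cplx P.z₁ + P.tau • cplx P.z₂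

theorem mulVec_v : (cmat ℂ P.w).mulVec P.v = P.lam • P.v := by
  rw [v, Matrix.mulVec_add, Matrix.mulVec_smul, cmat_mulVec_cplx, cmat_mulVec_cplx, w_z₁, w_z₂]
  funext j
  simp only [cplx, Pi.add_apply, Pi.smul_apply, smul_eq_mul, PiLp.add_apply, PiLp.sub_apply,
    PiLp.smul_apply, lam]
  push_cast
  linear_combination ((P.k : ℂ) * (P.z₂ j : ℝ)) * P.tau_sq

theorem bil_v (u : Euc l) : bil u P.v = (⟪u, P.z₁⟫ : ℝ) + P.tau * (⟪u, P.z₂⟫ : ℝ) := by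
  rw [v, bil_add_right, bil_smul_right, bil_cplx, bil_cplx]

theorem bil_v_ne_zero {u : Euc l} (h : ⟪u, P.z₁ + P.z₂⟫ ≠ 0) : bil u P.v ≠ 0 := by
  intro h0
  rw [bil_v] at h0
  obtain ⟨h1, h2⟩ := P.eq_zero_of_add_tau h0
  rw [inner_add_right, h1, h2, add_zero] at h
  exact h rfl

/-- Since `tau` is not real, a root orthogonal to `v` would be orthogonal to `z₁` and `z₂`, while
their sum lies in the open chamber. -/
theorem eval_root_ne_zero (s : Refl W) : eval P.v (linForm ℂ (root s)) ≠ 0 := by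
  rw [eval_linForm]
  refine P.bil_v_ne_zero fun h => ?_
  rw [real_inner_comm] at h
  refine P.inner_z_ne_zero (unitRoot_mem s) ?_
  rw [unitRoot, real_inner_smul_right, h, mul_zero]

/-- Comparing coefficients of 1 and `tau`, which are independent over the reals, shows that `w ^ h`
fixes `z₁` and `z₂`; this feeds the count of roots. -/
theorem pow_apply_z {h : ℕ} (hh : P.lam ^ h = 1) :
    (P.w ^ h) (P.z₁ + P.z₂) = P.z₁ + P.z₂ := by
  have h1 := pow_mulVec P.mulVec_v h
  rw [hh, one_smul, v, Matrix.mulVec_add, Matrix.mulVec_smul, cmat_mulVec_cplx,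
    cmat_mulVec_cplx] at h1
  have h2 : ∀ j, (P.w ^ h) P.z₁ j = P.z₁ j ∧ (P.w ^ h) P.z₂ j = P.z₂ j := by
    intro j
    have h3 := congrFun h1 j
    simp only [cplx, Pi.add_apply, Pi.smul_apply, smul_eq_mul] at h3
    obtain ⟨h4, h5⟩ := P.eq_zero_of_add_tau (a := (P.w ^ h) P.z₁ j - P.z₁ j)
      (b := (P.w ^ h) P.z₂ j - P.z₂ j) (by push_cast; linear_combination h3)
    exact ⟨sub_eq_zero.1 h4, sub_eq_zero.1 h5⟩
  rw [map_add]
  congr 1 <;> ext j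
  · exact (h2 j).1
  · exact (h2 j).2

theorem orderOf_lam_pos [Finite W] [Nonempty ι] : 0 < orderOf P.lam := by
  have h1 : IsOfFinOrder (⟨P.w, P.w_mem⟩ : W) := isOfFinOrder_of_finite _
  obtain ⟨n, hn, hn1⟩ := h1.exists_pow_eq_one
  have h2 : P.w ^ n = 1 := congrArg Subtype.val hn1
  have h3 := pow_mulVec P.mulVec_v n
  rw [h2, cmat_one, Matrix.one_mulVec] at h3
  have h4 : bil (S.basis (Classical.arbitrary ι)) P.v ≠ 0 := P.bil_v_ne_zero (by
    rw [real_inner_comm]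
    exact P.inner_z_ne_zero (S.isRoot _))
  have h5 := congrArg (bil (S.basis (Classical.arbitrary ι))) h3
  rw [bil_smul_right] at h5
  have h6 : P.lam ^ n = 1 := by
    have : (P.lam ^ n - 1) * bil (S.basis (Classical.arbitrary ι)) P.v = 0 := by
      linear_combination -h5
    exact sub_eq_zero.1 ((mul_eq_zero.1 this).resolve_right h4)
  exact (isOfFinOrder_iff_pow_eq_one.2 ⟨n, hn, h6⟩).orderOf_pos

theorem bil_part {J : Finset ι} {g : Euc l ≃ₗᵢ[ℝ] Euc l} (hJ : S.IsOrthogonalSet J)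
    (hg : S.IsPartReflection J g) (i : ι) (X : Fin l → ℂ) :
    bil (S.basis i) ((cmat ℂ g).mulVec X) =
      bil (S.basis i) X - 2 * ∑ j ∈ J, (S.gram j i : ℂ) * bil (S.basis j) X := by
  have h : g⁻¹ = g := inv_eq_of_mul_eq_one_left (LinearIsometryEquiv.ext (hg.involutive hJ))
  rw [bil_mulVec, h, hg.apply_simple, sub_eq_add_neg, bil_add_left, bil_neg_left,
    bil_sum_left, Finset.mul_sum, ← sub_eq_add_neg]
  congr 1
  exact Finset.sum_congr rfl fun j _ => by rw [bil_smul_left]; push_cast; ring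

theorem sum_gram_of_mem {J : Finset ι} (hJ : S.IsOrthogonalSet J) {j : ι} (hj : j ∈ J)
    (y : ι → ℂ) : ∑ i ∈ J, (S.gram i j : ℂ) * y i = y j := by
  rw [Finset.sum_eq_single j]
  · rw [S.gram_diag, Complex.ofReal_one, one_mul]
  · intro i hi hij
    rw [hJ i hi j hj hij, Complex.ofReal_zero, zero_mul]
  · exact fun h => absurd hj h

/-- The simple coordinates of an eigenvector of the Coxeter element. -/
theorem sum_gram_eq_zero {κ : ℂ} (hκ : κ ≠ 0) {X : Fin l → ℂ}
    (hX : (cmat ℂ P.w).mulVec X = κ • X) {j : ι} (hj : bil (S.basis j) X = 0) :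
    ∑ i, (S.gram i j : ℂ) * bil (S.basis i) X = 0 := by
  -- The eigenvalue equation in the form `g₂ X = κ g₁ X`. At a vertex with zero coordinate the
  -- involution of its own class contributes nothing, and the other one contributes the sum over the
  -- neighbours.
  have h1 : (cmat ℂ P.g₂).mulVec X = κ • (cmat ℂ P.g₁).mulVec X := by
    rw [← Matrix.mulVec_smul, ← hX, Matrix.mulVec_mulVec, ← cmat_mul]
    congr 2
    exact (LinearIsometryEquiv.ext fun y => P.part₁.involutive P.orth₁ _).symm
  have h2 := congrArg (bil (S.basis j)) h1
  rw [bil_smul_right, bil_part P.orth₁ P.part₁, bil_part P.orth₂ P.part₂, hj] at h2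
  rw [← Finset.sum_add_sum_compl P.J]
  by_cases hjJ : j ∈ P.J
  · rw [sum_gram_of_mem P.orth₁ hjJ fun i => bil (S.basis i) X, hj] at h2 ⊢
    linear_combination (-1 / 2 : ℂ) * h2
  · rw [sum_gram_of_mem P.orth₂ (Finset.mem_compl.2 hjJ) fun i => bil (S.basis i) X, hj] at h2 ⊢
    have h3 : κ * ∑ i ∈ P.J, (S.gram i j : ℂ) * bil (S.basis i) X = 0 := by
      linear_combination (1 / 2 : ℂ) * h2
    rw [(mul_eq_zero.1 h3).resolve_left hκ, add_zero]

/-- The eigenspaces of the Coxeter element have dimension at most two. -/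
theorem not_linearIndependent_eigenvectors (hW : IsIrreducibleReflectionGroup W) (hl : 2 ≤ l)
    {κ : ℂ} {X : Fin 3 → Fin l → ℂ} (hX : ∀ i, (cmat ℂ P.w).mulVec (X i) = κ • X i) :
    ¬ LinearIndependent ℂ X := by
  intro hli
  have hA := S.isCoxeterGram hW
  have hcard : Fintype.card ι = l := S.card_eq
  have : Nonempty ι := Fintype.card_pos_iff.1 (by omega)
  have hκ : κ ≠ 0 := by
    rintro rfl
    refine hli.ne_zero 0 (eq_zero_of_bil (S := S) fun i => ?_)
    have h1 := hX 0
    rw [zero_smul] at h1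
    have h2 := congrArg (cmat ℂ P.w).transpose.mulVec h1
    rw [Matrix.mulVec_mulVec, transpose_mul_cmat, Matrix.one_mulVec, Matrix.mulVec_zero] at h2
    rw [h2]; simp [bil]
  -- `M` consists of all leaves of the Coxeter graph but one.
  obtain ⟨M, hM, hM'⟩ : ∃ M : Finset ι, M.card ≤ 2 ∧
      ∀ i j, valency S.gram i = 1 → valency S.gram j = 1 → i ∉ M → j ∉ M → i = j := by
    have h3 := hA.card_leaves_le
    set L := Finset.univ.filter fun i => valency S.gram i = 1 with hL
    have hmem : ∀ i, valency S.gram i = 1 → i ∈ L := fun i hi => by simp [hL, hi]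
    rcases L.eq_empty_or_nonempty with h | ⟨a, ha⟩
    · exact ⟨∅, by simp, fun i j hi => absurd (hmem i hi) (by simp [h])⟩
    · refine ⟨L.erase a, by rw [Finset.card_erase_of_mem ha]; omega, fun i j hi hj hi' hj' => ?_⟩
      have h4 : ∀ i, valency S.gram i = 1 → i ∉ L.erase a → i = a := fun i hi hi' => by
        by_contra hne
        exact hi' (Finset.mem_erase.2 ⟨hne, hmem i hi⟩)
      rw [h4 i hi hi', h4 j hj hj']
  -- Three independent eigenvectors have a nonzero combination `Y` vanishing at the at most two
  -- leaves in `M`; by `eq_zero_of_leaves` all its simple coordinates vanish.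
  let F : (Fin 3 → ℂ) →ₗ[ℂ] (M → ℂ) :=
    LinearMap.pi fun i => (bilForm (S.basis i)) ∘ₗ Fintype.linearCombination ℂ X
  have hF := LinearMap.ker_ne_bot_of_finrank_lt (f := F) (by simp; omega)
  obtain ⟨a, ha, ha0⟩ := (Submodule.ne_bot_iff _).1 hF
  set Y : Fin l → ℂ := ∑ i, a i • X i with hY
  have hYe : (cmat ℂ P.w).mulVec Y = κ • Y := by
    rw [hY, Matrix.mulVec_sum, Finset.smul_sum]
    exact Finset.sum_congr rfl fun i _ => by rw [Matrix.mulVec_smul, hX, smul_comm]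
  have hYM : ∀ i ∈ M, bil (S.basis i) Y = 0 := fun i hi => by
    have := congrFun (LinearMap.mem_ker.1 ha) ⟨i, hi⟩
    simpa [F, bilForm, Fintype.linearCombination_apply] using this
  have h5 := hA.eq_zero_of_leaves (by omega) (y := fun i => bil (S.basis i) Y)
    (fun j hj => P.sum_gram_eq_zero hκ hYe hj) (fun i j hi hj h1 h2 => by
      refine hM' i j hi hj (fun h => h1 (hYM i h)) fun h => h2 (hYM j h))
  have h6 : Y = 0 := eq_zero_of_bil (S := S) fun i => congrFun h5 i
  exact ha0 (funext (Fintype.linearIndependent_iff.1 hli a h6))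

end CoxeterPair

end SimpleSystem

/-- A Coxeter element, its regular eigenvector and the bound on its order. -/
theorem exists_coxeter_element {l : ℕ} {W : Subgroup (Euc l ≃ₗᵢ[ℝ] Euc l)}
    (hW : IsIrreducibleReflectionGroup W) (hl : 2 ≤ l) :
    ∃ w ∈ W, ∃ (lam : ℂ) (v : Fin l → ℂ), (cmat ℂ w).mulVec v = lam • v ∧
      (∀ s : Refl W, eval v (linForm ℂ (root s)) ≠ 0) ∧ 0 < orderOf lam ∧
      2 * Nat.card (Refl W) ≤ orderOf lam * l ∧
      ∀ (κ : ℂ) (X : Fin 3 → Fin l → ℂ), (∀ i, (cmat ℂ w).mulVec (X i) = κ • X i) →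
        ¬ LinearIndependent ℂ X := by
  classical
  have := hW.finite
  have := finite_refl (W := W) this
  have := Fintype.ofFinite (Refl W)
  obtain ⟨t, ⟨S⟩⟩ := exists_simpleSystem hW hl
  have hcard := S.card_eq
  have : Nonempty t := Fintype.card_pos_iff.1 (by omega)
  obtain ⟨P⟩ := S.exists_coxeterPair hW
  refine ⟨P.w, P.w_mem, P.lam, P.v, P.mulVec_v, P.eval_root_ne_zero, P.orderOf_lam_pos, ?_,
    fun κ X hX => P.not_linearIndependent_eigenvectors hW hl hX⟩
  rw [Nat.card_eq_fintype_card]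
  exact two_mul_card_refl_le.trans
    (P.ncard_rootSet_le P.orderOf_lam_pos (P.pow_apply_z (pow_orderOf_eq_one _)))

end CoxeterElement

/-! ### Multiplicities of the degrees. -/

section Degrees

local notation "⟪" x ", " y "⟫" => inner ℝ x y

theorem eval_smul_of_isHomogeneous {σ K : Type*} [CommRing K] {p : MvPolynomial σ K}
    {n : ℕ} (hp : p.IsHomogeneous n) (a : K) (x : σ → K) : eval (a • x) p = a ^ n * eval x p := by
  rw [eval_eq, eval_eq, Finset.mul_sum]
  refine Finset.sum_congr rfl fun m hm => ?_
  have h1 : ∑ i ∈ m.support, m i = n := by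
    have := hp (mem_support_iff.1 hm)
    rwa [Finsupp.weight_apply, Finsupp.sum, Finset.sum_congr rfl fun i _ => by
      rw [Pi.one_apply, smul_eq_mul, mul_one]] at this
  simp only [Pi.smul_apply, smul_eq_mul, mul_pow, Finset.prod_mul_distrib,
    Finset.prod_pow_eq_pow_sum, h1]
  ring

theorem eval_add_of_isHomogeneous_one {σ K : Type*} [CommRing K] {p : MvPolynomial σ K}
    (hp : p.IsHomogeneous 1) (x y : σ → K) : eval (x + y) p = eval x p + eval y p := by
  have h : p ∈ homogeneousSubmodule σ K 1 := hp
  rw [homogeneousSubmodule_one_eq_span_X] at h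
  clear hp
  induction h using Submodule.span_induction with
  | mem p hp =>
    obtain ⟨i, rfl⟩ := hp
    simp
  | zero => simp
  | add p q _ _ hp hq =>
    rw [map_add, hp, hq, map_add, map_add]; ring
  | smul a p _ hp => rw [smul_eval, hp, smul_eval, smul_eval]; ring

/-- The gradient of a polynomial at a point. -/
noncomputable def gradAt {l : ℕ} (x : Fin l → ℂ) (p : MvPolynomial (Fin l) ℂ) : Fin l → ℂ :=
  fun j => eval x (pderiv j p)

section Gradient

variable {l : ℕ} {W : Subgroup (Euc l ≃ₗᵢ[ℝ] Euc l)}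

theorem gradAt_mulVec {w : Euc l ≃ₗᵢ[ℝ] Euc l} (hw : w ∈ W) {p : MvPolynomial (Fin l) ℂ}
    (hp : p ∈ invariants ℂ W) (x : Fin l → ℂ) :
    gradAt ((cmat ℂ w).mulVec x) p = (cmat ℂ w).mulVec (gradAt x p) := by
  funext k
  simp only [gradAt]
  conv_lhs => rw [← hp w hw]
  rw [pderiv_act, map_sum]
  simp only [map_mul, eval_C, eval_act, Matrix.mulVec_mulVec, transpose_mul_cmat,
    Matrix.one_mulVec]
  rfl

theorem gradAt_smul {p : MvPolynomial (Fin l) ℂ} {n : ℕ} (hp : p.IsHomogeneous n) (a : ℂ)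
    (x : Fin l → ℂ) : gradAt (a • x) p = a ^ (n - 1) • gradAt x p :=
  funext fun _ => eval_smul_of_isHomogeneous hp.pderiv a x

/-- Springer's argument: equivariance of the gradient against its homogeneity of degree `n - 1`. -/
theorem gradAt_eigenvector {w : Euc l ≃ₗᵢ[ℝ] Euc l} (hw : w ∈ W) {p : MvPolynomial (Fin l) ℂ}
    (hp : p ∈ invariants ℂ W) {n : ℕ} (hpn : p.IsHomogeneous n) {lam : ℂ} {v : Fin l → ℂ}
    (hv : (cmat ℂ w).mulVec v = lam • v) :
    (cmat ℂ w).mulVec (gradAt v p) = lam ^ (n - 1) • gradAt v p := by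
  rw [← gradAt_mulVec hw hp, hv, gradAt_smul hpn]

theorem eq_smul_of_reflection_mulVec {β : Euc l} (hβ : β ∈ rootSet W) {Y : Fin l → ℂ}
    (hY : (cmat ℂ (ℝ ∙ β)ᗮ.reflection).mulVec Y = -Y) : Y = bil β Y • cplx β := by
  have hinv := Submodule.reflection_inv (K := (ℝ ∙ β)ᗮ)
  funext k
  have h2 := congrArg (bil (EuclideanSpace.single k (1 : ℝ))) hY
  rw [bil_mulVec, hinv, reflection_unit hβ.1, bil_single, sub_eq_add_neg, bil_add_left,
    bil_neg_left, bil_smul_left, bil_single, real_inner_comm, single_inner, Pi.neg_apply] at h2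
  rw [Pi.smul_apply, cplx, smul_eq_mul]
  push_cast at h2
  linear_combination (1 / 2 : ℂ) * h2

theorem eq_zero_of_fixed_mulVec (hW : IsIrreducibleReflectionGroup W) (hl : 2 ≤ l)
    {Y : Fin l → ℂ} (hY : ∀ w ∈ W, (cmat ℂ w).mulVec Y = Y) : Y = 0 := by
  have h : ∀ u ∈ Submodule.span ℝ (rootSet W), bil u Y = 0 := by
    intro u hu
    induction hu using Submodule.span_induction with
    | mem β hβ =>
      have h1 := congrArg (bil β) (hY _ hβ.2)
      have hinv := Submodule.reflection_inv (K := (ℝ ∙ β)ᗮ)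
      rw [bil_mulVec, hinv, reflection_unit hβ.1, real_inner_self_eq_norm_sq, hβ.1] at h1
      have h2 : β - (2 * 1 ^ 2 : ℝ) • β = -β := by module
      rw [h2, bil_neg_left] at h1
      linear_combination (-1 / 2 : ℂ) * h1
    | zero => simp [bil]
    | add u v _ _ h1 h2 => rw [bil_add_left, h1, h2, add_zero]
    | smul a u _ h1 => rw [bil_smul_left, h1, mul_zero]
  rw [span_rootSet hW hl] at h
  funext k
  rw [Pi.zero_apply, ← bil_single k Y]
  exact h _ Submodule.mem_top

theorem cplx_add (u v : Euc l) : cplx (u + v) = cplx u + cplx v := by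
  funext k; simp [cplx]

theorem cplx_smul (a : ℝ) (u : Euc l) : cplx (a • u) = (a : ℂ) • cplx u := by
  funext k; simp [cplx]

/-- The gradient of an invariant quadratic form is a multiple of the identity. -/
theorem exists_gradAt_eq_smul (hW : IsIrreducibleReflectionGroup W) (hl : 2 ≤ l)
    {p : MvPolynomial (Fin l) ℂ} (hp : p ∈ invariants ℂ W) (hp2 : p.IsHomogeneous 2) :
    ∃ a : ℂ, ∀ x, gradAt x p = a • x := by
  have hadd : ∀ x y, gradAt (x + y) p = gradAt x p + gradAt y p := fun x y =>
    funext fun _ => eval_add_of_isHomogeneous_one hp2.pderiv x y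
  have hsmul : ∀ (a : ℂ) x, gradAt (a • x) p = a • gradAt x p := fun a x => by
    rw [gradAt_smul hp2]; simp
  obtain ⟨β, hβ⟩ : (rootSet W).Nonempty := by
    rw [Set.nonempty_iff_ne_empty]
    intro h0
    have h1 := span_rootSet hW hl
    rw [h0, Submodule.span_empty] at h1
    have h2 : Module.finrank ℝ (⊥ : Submodule ℝ (Euc l)) = l := by
      rw [h1, finrank_top, finrank_euclideanSpace_fin]
    rw [finrank_bot] at h2
    omega
  set a := bil β (gradAt (cplx β) p) with ha
  let U : Submodule ℝ (Euc l) :=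
    { carrier := {u | gradAt (cplx u) p = a • cplx u}
      add_mem' := fun {u v} (hu : gradAt (cplx u) p = a • cplx u)
          (hv : gradAt (cplx v) p = a • cplx v) => by
        change gradAt (cplx (u + v)) p = a • cplx (u + v)
        rw [cplx_add, hadd, hu, hv, smul_add]
      zero_mem' := by
        change gradAt (cplx 0) p = a • cplx 0
        have h : cplx (0 : Euc l) = (0 : ℂ) • cplx 0 := by funext; simp [cplx]
        rw [h, hsmul, zero_smul, zero_smul, smul_zero]
      smul_mem' := fun b u (hu : gradAt (cplx u) p = a • cplx u) => by
        change gradAt (cplx (b • u)) p = a • cplx (b • u)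
        rw [cplx_smul, hsmul, hu, smul_comm] }
  -- Schur's lemma over the reals: `U` is a `W`-stable real subspace, nonzero because the reflection
  -- in `β` negates the gradient at `β`, which is thus a multiple of `β`. The complex scalar `a` was
  -- read off from it.
  have hU : U = ⊤ := by
    refine (hW.irreducible U fun w hw u hu => ?_).resolve_left fun h => ?_
    · change gradAt (cplx (w u)) p = a • cplx (w u)
      have hu' : gradAt (cplx u) p = a • cplx u := hu
      rw [← cmat_mulVec_cplx, gradAt_mulVec hw hp, hu', Matrix.mulVec_smul]
    · have h1 : β ∈ U := by
        change gradAt (cplx β) p = a • cplx β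
        refine eq_smul_of_reflection_mulVec hβ ?_
        rw [← gradAt_mulVec hβ.2 hp, cmat_mulVec_cplx]
        have h2 : (ℝ ∙ β)ᗮ.reflection β = (-1 : ℝ) • β := by
          rw [reflection_unit hβ.1, real_inner_self_eq_norm_sq, hβ.1]; module
        rw [h2, cplx_smul, hsmul]
        simp
      rw [h, Submodule.mem_bot] at h1
      exact ne_zero_of_mem_rootSet hβ h1
  have hreal : ∀ u : Euc l, gradAt (cplx u) p = a • cplx u := fun u => by
    have : u ∈ U := hU ▸ Submodule.mem_top
    exact this
  refine ⟨a, fun x => ?_⟩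
  have hx : x = cplx (WithLp.toLp 2 fun k => (x k).re) +
      Complex.I • cplx (WithLp.toLp 2 fun k => (x k).im) := by
    funext k
    simp only [cplx, Pi.add_apply, Pi.smul_apply, smul_eq_mul]
    rw [mul_comm, Complex.re_add_im]
  rw [hx, hadd, hsmul, hreal, hreal, smul_add, smul_comm]

/-- The sum of the squares of the coordinates. -/
noncomputable def sumSq (l : ℕ) : MvPolynomial (Fin l) ℂ := ∑ k, X k ^ 2

theorem sumSq_isHomogeneous : (sumSq l).IsHomogeneous 2 :=
  IsHomogeneous.sum _ _ _ fun k _ => isHomogeneous_X_pow k 2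

theorem sumSq_mem : sumSq l ∈ invariants ℂ W := by
  intro w _
  refine MvPolynomial.funext fun x => ?_
  have h : ∀ y : Fin l → ℂ, eval y (sumSq l) = dotProduct y y := fun y => by
    simp [sumSq, dotProduct, pow_two]
  rw [eval_act, h, h, Matrix.dotProduct_mulVec, Matrix.vecMul_transpose, Matrix.mulVec_mulVec,
    cmat_mul_transpose, Matrix.one_mulVec]

theorem sumSq_ne_zero (hl : 0 < l) : sumSq l ≠ 0 := by
  intro h
  have := congrArg (eval (Pi.single ⟨0, hl⟩ 1)) h
  rw [sumSq, map_sum, Finset.sum_eq_single ⟨0, hl⟩] at this <;> simp +contextual at this ⊢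

end Gradient

namespace IsBasicInvariants

variable {l : ℕ} {W : Subgroup (Euc l ≃ₗᵢ[ℝ] Euc l)} {f : Fin l → MvPolynomial (Fin l) ℂ}
  {d : Fin l → ℕ} (hf : IsBasicInvariants W f d)

include hf

/-- The gradient of a linear invariant is constant, hence a `W`-fixed vector, hence zero. -/
theorem two_le (hW : IsIrreducibleReflectionGroup W) (hl : 2 ≤ l) {v : Fin l → ℂ}
    (hG : LinearIndependent ℂ fun i => gradAt v (f i)) (i : Fin l) : 2 ≤ d i := by
  by_contra! h
  have h1 : d i = 1 := by have := hf.pos i; omega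
  have h2 : (f i).IsHomogeneous 1 := h1 ▸ hf.hom i
  refine hG.ne_zero i (eq_zero_of_fixed_mulVec hW hl fun w hw => ?_)
  rw [← gradAt_mulVec hw (hf.mem i)]
  have h3 : ∀ x, gradAt x (f i) = gradAt 0 (f i) := fun x => by
    have := gradAt_smul h2 0 x
    rwa [zero_smul, Nat.sub_self, pow_zero, one_smul, eq_comm] at this
  rw [h3, ← h3 v]

/-- The invariant sum of squares lies in the ideal of the `f i`, so some generator has degree at
most 2. -/
theorem exists_degree_le_two (hl : 0 < l) : ∃ i, d i ≤ 2 := by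
  by_contra! h
  refine sumSq_ne_zero hl ?_
  have h1 : sumSq l ∈ Ideal.span (Set.range f) := by
    rw [hf.span_eq]
    exact mem_invIdeal_of_coeff_zero W sumSq_mem
      (sumSq_isHomogeneous.coeff_eq_zero (by simp))
  obtain ⟨g, hg⟩ := exists_sum_of_mem_span_range h1
  have h2 := homogeneousComponent_of_mem (m := 2) (sumSq_isHomogeneous (l := l))
  rw [if_pos rfl] at h2
  rw [← h2, hg, map_sum]
  exact Finset.sum_eq_zero fun i _ => homogeneousComponent_mul_eq_zero (hf.hom i) (h i)

theorem eq_of_degree_two (hW : IsIrreducibleReflectionGroup W) (hl : 2 ≤ l) {v : Fin l → ℂ}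
    (hG : LinearIndependent ℂ fun i => gradAt v (f i)) {i j : Fin l} (hi : d i = 2)
    (hj : d j = 2) : i = j := by
  obtain ⟨a, ha⟩ := exists_gradAt_eq_smul hW hl (hf.mem i) (hi ▸ hf.hom i)
  obtain ⟨b, hb⟩ := exists_gradAt_eq_smul hW hl (hf.mem j) (hj ▸ hf.hom j)
  by_contra hij
  have hb0 : b ≠ 0 := fun h => hG.ne_zero j (by rw [hb, h, zero_smul])
  refine hG.notMem_span_image (s := {j}) (x := i) hij ?_
  rw [Set.image_singleton, Submodule.mem_span_singleton]
  exact ⟨a / b, by rw [ha, hb, smul_smul, div_mul_cancel₀ _ hb0]⟩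

/-- No three degrees coincide, and the largest degree occurs once. -/
theorem degree_multiplicity (hW : IsIrreducibleReflectionGroup W) (hl : 2 ≤ l) :
    (∀ i j k, d i = d j → d i = d k → i = j ∨ j = k ∨ i = k) ∧
      ∀ i j, (∀ k, d k ≤ d i) → d j = d i → j = i := by
  have := hW.finite
  have := finite_refl (W := W) this
  have := Fintype.ofFinite (Refl W)
  obtain ⟨w, hw, lam, v, hv, hroot, hpos, hN, hthree⟩ := exists_coxeter_element hW hl
  set h := orderOf lam with hh
  have hG : LinearIndependent ℂ fun i => gradAt v (f i) :=
    hf.gradient_linearIndependent hW.generated hroot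
  have hM : ∀ i, (cmat ℂ w).mulVec (gradAt v (f i)) = lam ^ (d i - 1) • gradAt v (f i) :=
    fun i => gradAt_eigenvector hw (hf.mem i) (hf.hom i) hv
  have h2 := hf.two_le hW hl hG
  refine ⟨fun i j k hij hik => ?_, ?_⟩
  · by_contra! hne
    refine hthree (lam ^ (d i - 1)) (fun m => gradAt v (f (![i, j, k] m))) (fun m => ?_)
      (hG.comp ![i, j, k] ?_)
    · rw [hM]
      congr 3
      fin_cases m <;> simp [hij]
      exact hij.symm.trans hik |>.symm
    · intro a b hab
      fin_cases a <;> fin_cases b <;> simp_all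
  -- The Gram matrix of the gradients is nonsingular, so some term of its determinant is nonzero;
  -- this supplies the permutation `σ` that pairs the degrees.
  · have hdet : (Matrix.of fun i j => dotProduct (gradAt v (f i)) (gradAt v (f j))).det ≠ 0 := by
      let A : Matrix (Fin l) (Fin l) ℂ := Matrix.of fun i => gradAt v (f i)
      have h3 : (Matrix.of fun i j => dotProduct (gradAt v (f i)) (gradAt v (f j))) =
          A * A.transpose := by
        ext i j; rfl
      have h4 : A.det ≠ 0 := by
        have h5 : IsUnit A := Matrix.linearIndependent_rows_iff_isUnit.1 hG
        exact ((Matrix.isUnit_iff_isUnit_det A).1 h5).ne_zero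
      rw [h3, Matrix.det_mul, Matrix.det_transpose]
      exact mul_ne_zero h4 h4
    rw [Matrix.det_apply] at hdet
    obtain ⟨σ, -, hσ⟩ := Finset.exists_ne_zero_of_sum_ne_zero hdet
    have hσ' : ∀ i, dotProduct (gradAt v (f (σ i))) (gradAt v (f i)) ≠ 0 := fun i hi => by
      refine hσ ?_
      rw [Finset.prod_eq_zero (Finset.mem_univ i), smul_zero]
      exact hi
    have hge : ∀ i, h + 2 ≤ d i + d (σ i) := by
      intro i
      -- `w` preserves the bilinear form, so two eigenvectors that are not orthogonal have inverse
      -- eigenvalues. The exponent is positive since all degrees are at least 2, hence it is at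
      -- least `h`.
      have h3 : lam ^ (d (σ i) - 1 + (d i - 1)) = 1 := by
        have h4 : dotProduct ((cmat ℂ w).mulVec (gradAt v (f (σ i))))
            ((cmat ℂ w).mulVec (gradAt v (f i))) =
              dotProduct (gradAt v (f (σ i))) (gradAt v (f i)) := by
          rw [Matrix.dotProduct_mulVec, ← Matrix.mulVec_transpose, Matrix.mulVec_mulVec,
            transpose_mul_cmat, Matrix.one_mulVec]
        rw [hM, hM, smul_dotProduct, dotProduct_smul, smul_eq_mul, smul_eq_mul, ← mul_assoc,
          ← pow_add] at h4
        exact (mul_eq_right₀ (hσ' i)).1 h4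
      have h4 := Nat.le_of_dvd (by have := h2 i; omega) (orderOf_dvd_of_pow_eq_one h3)
      have := h2 i
      have := h2 (σ i)
      omega
    -- The left side is `2 (N + l)` with `N` the number of reflections, and `2 N ≤ h l`.
    have hsum : ∑ i, (d i + d (σ i)) ≤ ∑ _i : Fin l, (h + 2) := by
      have h3 := (hf.jacobian_eq hW.generated).2
      rw [← Nat.card_eq_fintype_card] at h3
      have h4 : ∑ i, d i = ∑ i, (d i - 1) + l := by
        have : ∑ i, d i = ∑ i, ((d i - 1) + 1) :=
          Finset.sum_congr rfl fun i _ => by have := h2 i; omega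
        rw [this, Finset.sum_add_distrib]; simp
      rw [Finset.sum_add_distrib, Equiv.sum_comp σ d, Finset.sum_const, Finset.card_univ,
        Fintype.card_fin, smul_eq_mul, h4, h3]
      nlinarith
    have heq : ∀ i, d i + d (σ i) = h + 2 := by
      intro i
      by_contra hne
      exact (Finset.sum_lt_sum (fun i _ => hge i) ⟨i, Finset.mem_univ i,
        lt_of_le_of_ne (hge i) (Ne.symm hne)⟩).not_ge hsum
    obtain ⟨m, hm⟩ := hf.exists_degree_le_two (by omega)
    intro i j hmax hji
    -- The partner of an index of degree 2 has degree `h`, so the maximum is at least `h` and the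
    -- partner of an index attaining it has degree at most 2.
    have hσi : d (σ i) = 2 := by
      have h3 := heq m
      have h4 := heq i
      have h5 := hmax (σ m)
      have h6 := h2 (σ i)
      omega
    have hσj : d (σ j) = 2 := by
      have h3 := heq j
      have h4 := heq i
      omega
    exact σ.injective (hf.eq_of_degree_two hW hl hG hσj hσi)

end IsBasicInvariants

end Degrees

/-! ### The pairing defined by the Dunkl operators and its nondegeneracy. -/

section PairingMatrix

section Monomials

variable {σ K : Type*} [Fintype σ] [DecidableEq σ] [CommRing K]

/-- The exponents of the monomials of degree `n`. -/
abbrev monos (σ : Type*) [Fintype σ] [DecidableEq σ] (n : ℕ) : Finset (σ →₀ ℕ) :=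
  Finset.univ.finsuppAntidiag n

theorem mem_monos {n : ℕ} {m : σ →₀ ℕ} : m ∈ monos σ n ↔ m.degree = n := by
  rw [Finset.mem_finsuppAntidiag, Finsupp.degree_eq_sum]
  simp

theorem isHomogeneous_monomial_monos {n : ℕ} (m : monos σ n) (a : K) :
    (monomial m.1 a).IsHomogeneous n :=
  isHomogeneous_monomial a (mem_monos.1 m.2)

theorem eq_sum_monos {n : ℕ} {p : MvPolynomial σ K} (hp : p.IsHomogeneous n) :
    p = ∑ m : monos σ n, monomial m.1 (coeff m.1 p) := by
  rw [Finset.sum_coe_sort (monos σ n) fun m => monomial m (coeff m p)]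
  conv_lhs => rw [p.as_sum]
  refine Finset.sum_subset (fun m hm => mem_monos.2 ?_) fun m _ hm => ?_
  · by_contra h
    exact mem_support_iff.1 hm (hp.coeff_eq_zero h)
  · rw [notMem_support_iff.1 hm, map_zero]

end Monomials

section Pairing

variable {l : ℕ} {W : Subgroup (Euc l ≃ₗᵢ[ℝ] Euc l)} [Finite (Refl W)] {R : Type*} [CommRing R]
  [Algebra ℂ R] [IsDomain R] {c : Refl W → R} (hc : IsConjInvariant W c)

/-- The constant term of `∇_p x`. -/
noncomputable def pair (p : MvPolynomial (Fin l) ℂ) (x : MvPolynomial (Fin l) R) : R :=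
  coeff 0 (dunklHom hc p x)

theorem dunklHom_eq_C {n : ℕ} {p : MvPolynomial (Fin l) ℂ} (hp : p.IsHomogeneous n)
    {x : MvPolynomial (Fin l) R} (hx : x.IsHomogeneous n) :
    dunklHom hc p x = C (pair hc p x) := by
  have h := dunklHom_isHomogeneous hc hp hx
  rw [Nat.sub_self, ← totalDegree_zero_iff_isHomogeneous, totalDegree_eq_zero_iff_eq_C] at h
  exact h

theorem pair_eq_sum_left {n : ℕ} {p : MvPolynomial (Fin l) ℂ} (hp : p.IsHomogeneous n)
    (x : MvPolynomial (Fin l) R) : pair hc p x =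
      ∑ m : monos (Fin l) n, algebraMap ℂ R (coeff m.1 p) * pair hc (monomial m.1 1) x := by
  conv_lhs => rw [eq_sum_monos hp]
  rw [pair, map_sum, LinearMap.sum_apply, coeff_sum]
  refine Finset.sum_congr rfl fun m _ => ?_
  have h : (monomial m.1 (coeff m.1 p) : MvPolynomial (Fin l) ℂ) =
      coeff m.1 p • monomial m.1 1 := by
    rw [smul_monomial, smul_eq_mul, mul_one]
  rw [h, map_smul, LinearMap.smul_apply, coeff_smul, Algebra.smul_def, pair]

theorem pair_sum_right {ι : Type*} (s : Finset ι) (p : MvPolynomial (Fin l) ℂ)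
    (x : ι → MvPolynomial (Fin l) R) : pair hc p (∑ i ∈ s, x i) = ∑ i ∈ s, pair hc p (x i) := by
  rw [pair, map_sum, coeff_sum]
  rfl

theorem pair_smul_right (p : MvPolynomial (Fin l) ℂ) (a : R) (x : MvPolynomial (Fin l) R) :
    pair hc p (a • x) = a * pair hc p x := by
  rw [pair, map_smul, coeff_smul, smul_eq_mul, pair]

/-- The matrix of the pairing in degree `n` in the monomial bases. -/
noncomputable def pairMatrix (n : ℕ) : Matrix (monos (Fin l) n) (monos (Fin l) n) R :=
  Matrix.of fun m m' => pair hc (monomial m.1 1) (monomial m'.1 1)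

theorem pair_monomial {n : ℕ} (m : monos (Fin l) n) (u : monos (Fin l) n → R) :
    pair hc (monomial m.1 1) (∑ m' : monos (Fin l) n, monomial m'.1 (u m')) =
      (pairMatrix hc n).mulVec u m := by
  rw [pair_sum_right, Matrix.mulVec, dotProduct]
  refine Finset.sum_congr rfl fun m' _ => ?_
  have h : (monomial m'.1 (u m') : MvPolynomial (Fin l) R) = u m' • monomial m'.1 1 := by
    rw [smul_monomial, smul_eq_mul, mul_one]
  rw [h, pair_smul_right, mul_comm]
  rfl

theorem coeff_sum_monos {n : ℕ} (u : monos (Fin l) n → R) (m : monos (Fin l) n) :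
    coeff m.1 (∑ m' : monos (Fin l) n, monomial m'.1 (u m')) = u m := by
  rw [coeff_sum, Finset.sum_eq_single m]
  · rw [coeff_monomial, if_pos rfl]
  · intro m' _ h
    rw [coeff_monomial, if_neg fun h' => h (Subtype.ext h')]
  · simp

theorem eq_zero_of_pairMatrix {n : ℕ} (hdet : (pairMatrix hc n).det ≠ 0)
    {x : MvPolynomial (Fin l) R} (hx : x.IsHomogeneous n)
    (h : ∀ p : MvPolynomial (Fin l) ℂ, p.IsHomogeneous n → dunklHom hc p x = 0) : x = 0 := by
  have h1 : (pairMatrix hc n).mulVec (fun m => coeff m.1 x) = 0 := by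
    funext m
    rw [← pair_monomial, ← eq_sum_monos hx, pair, h _ (isHomogeneous_monomial_monos m 1)]
    rfl
  have h2 : (fun m : monos (Fin l) n => coeff m.1 x) = 0 := by
    by_contra h0
    exact hdet (Matrix.exists_mulVec_eq_zero_iff.1 ⟨_, h0, h1⟩)
  rw [eq_sum_monos hx]
  exact Finset.sum_eq_zero fun m _ => by rw [show coeff m.1 x = 0 from congrFun h2 m, map_zero]

theorem pairMatrix_det_ne_zero {n : ℕ} (h : ∀ x : MvPolynomial (Fin l) R, x.IsHomogeneous n →
    (∀ p : MvPolynomial (Fin l) ℂ, p.IsHomogeneous n → dunklHom hc p x = 0) → x = 0) :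
    (pairMatrix hc n).det ≠ 0 := by
  intro hdet
  obtain ⟨u, hu0, hu⟩ := Matrix.exists_mulVec_eq_zero_iff.2 hdet
  have hhom : (∑ m' : monos (Fin l) n, monomial m'.1 (u m')).IsHomogeneous n :=
    IsHomogeneous.sum _ _ _ fun m _ => isHomogeneous_monomial_monos m _
  have h1 := h _ hhom fun p hp => by
    rw [dunklHom_eq_C hc hp hhom, pair_eq_sum_left hc hp]
    simp only [pair_monomial, hu, Pi.zero_apply, mul_zero, Finset.sum_const_zero, C_0]
  exact hu0 (funext fun m => by rw [← coeff_sum_monos u m, h1, coeff_zero, Pi.zero_apply])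

/-- The adjugate takes the place of the inverse matrix, so that the construction works over `ℂ[c]`;
the price is the factor `det`. -/
theorem exists_dual {n : ℕ} (φ : MvPolynomial (Fin l) ℂ →ₗ[ℂ] ℂ) :
    ∃ e : MvPolynomial (Fin l) R, e.IsHomogeneous n ∧
      ∀ p : MvPolynomial (Fin l) ℂ, p.IsHomogeneous n →
        pair hc p e = (pairMatrix hc n).det * algebraMap ℂ R (φ p) := by
  let g : monos (Fin l) n → R := fun m => algebraMap ℂ R (φ (monomial m.1 1))
  refine ⟨∑ m' : monos (Fin l) n, monomial m'.1 ((pairMatrix hc n).adjugate.mulVec g m'),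
    IsHomogeneous.sum _ _ _ fun m _ => isHomogeneous_monomial_monos m _, fun p hp => ?_⟩
  rw [pair_eq_sum_left hc hp]
  simp only [pair_monomial, Matrix.mulVec_mulVec, Matrix.mul_adjugate, Matrix.smul_mulVec,
    Matrix.one_mulVec]
  conv_rhs => rw [eq_sum_monos hp]
  rw [map_sum, map_sum, Finset.mul_sum]
  refine Finset.sum_congr rfl fun m _ => ?_
  have h : (monomial m.1 (coeff m.1 p) : MvPolynomial (Fin l) ℂ) =
      coeff m.1 p • monomial m.1 1 := by
    rw [smul_monomial, smul_eq_mul, mul_one]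
  rw [h, map_smul, smul_eq_mul, map_mul, Pi.smul_apply, smul_eq_mul]
  ring

theorem pairMatrix_map {R' : Type*} [CommRing R'] [Algebra ℂ R'] [IsDomain R'] (φ : R →ₐ[ℂ] R')
    (hc' : IsConjInvariant W (fun s => φ (c s))) (n : ℕ) :
    φ (pairMatrix hc n).det = (pairMatrix hc' n).det := by
  rw [AlgHom.map_det]
  congr 1
  ext m m'
  have h := congrArg (coeff 0)
    (dunklHom_map φ hc hc' (monomial m.1 1) (monomial m'.1 (1 : R)))
  rw [coeff_map, map_monomial, map_one φ.toRingHom] at h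
  exact h

end Pairing

section Regular

variable {l : ℕ} {W : Subgroup (Euc l ≃ₗᵢ[ℝ] Euc l)} [Finite (Refl W)]

/-- Induction on the degree: if `x` is orthogonal to degree `n + 1`, each `∇_j x` is orthogonal to
degree `n`, hence zero, and regularity makes `x` constant. -/
theorem IsRegularParam.pairMatrix_ne_zero {c : Refl W → ℂ} (h : IsRegularParam c) (n : ℕ) :
    (pairMatrix h.1 n).det ≠ 0 := by
  refine pairMatrix_det_ne_zero h.1 ?_
  induction n with
  | zero =>
    intro x _ hp
    have := hp 1 (isHomogeneous_one _ _)
    rwa [map_one] at this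
  | succ n ih =>
    intro x hx hp
    have h1 : ∀ j, dunkl c (Pi.single j 1) x = 0 := fun j => by
      rw [← dunklHom_X h.1]
      refine ih _ (dunklHom_isHomogeneous h.1 (isHomogeneous_X ℂ j) hx) fun p hp' => ?_
      rw [← Module.End.mul_apply, ← map_mul]
      exact hp _ (hp'.mul (isHomogeneous_X ℂ j))
    have h2 := h.2 x fun y => by
      rw [dunkl_eq_sum, LinearMap.sum_apply]
      exact Finset.sum_eq_zero fun j _ => by rw [LinearMap.smul_apply, h1, smul_zero]
    by_contra h0
    rw [hx.totalDegree h0] at h2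
    exact Nat.succ_ne_zero n h2

theorem isRegularParam_zero : IsRegularParam (fun _ : Refl W => (0 : ℂ)) := by
  have := Fintype.ofFinite (Refl W)
  refine ⟨fun _ _ _ => rfl, fun x hx => ?_⟩
  have h : ∀ i, pderiv i x = 0 := fun i => by
    have := hx (Pi.single i 1)
    rw [dunkl_apply, dirDeriv, Finset.sum_eq_single i] at this
    · simpa using this
    · intro j _ hj
      rw [Pi.single_eq_of_ne hj, C_0, zero_mul]
    · simp
  rw [eq_C_of_pderiv_eq_zero h, totalDegree_C]

theorem univParam_isConjInvariant : IsConjInvariant W (univParam W) := by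
  intro s t h
  rw [univParam, univParam]
  exact congrArg _ (Quotient.sound (s := reflSetoid W) h).symm

/-- The determinant is a polynomial in `c` with nonzero value at `c = 0`, where Dunkl operators are
partial derivatives and the parameter is regular. -/
theorem pairMatrix_univParam_ne_zero (n : ℕ) :
    (pairMatrix (univParam_isConjInvariant (W := W)) n).det ≠ 0 := by
  intro h
  have h0 : IsRegularParam (fun s : Refl W =>
      (aeval fun _ : ReflClass W => (0 : ℂ)) (univParam W s)) := by
    convert isRegularParam_zero (W := W) using 2
    exact aeval_X _ _
  refine h0.pairMatrix_ne_zero n ?_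
  rw [← pairMatrix_map univParam_isConjInvariant, h, map_zero]

end Regular

end PairingMatrix

/-! ### Invariants in the truncated quasiharmonics and their generator over `ℂ[c]`. -/

section QuasiHarmonics

section Primitive

variable {σ R : Type*} [CommRing R] [IsDomain R] [UniqueFactorizationMonoid R]

/-- Every nonzero polynomial is a constant multiple of one without constant prime factors. -/
theorem exists_primitive_factor [UniqueFactorizationMonoid (MvPolynomial σ R)]
    (e : MvPolynomial σ R) (he : e ≠ 0) :
    ∃ (g : R) (e' : MvPolynomial σ R), e = C g * e' ∧ ∀ p : R, Prime p → ¬ C p ∣ e' := by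
  induction e using WellFounded.induction
    (wellFounded_dvdNotUnit (α := MvPolynomial σ R)) with
  | h e ih =>
    by_cases h : ∃ p : R, Prime p ∧ C p ∣ e
    · obtain ⟨p, hp, e₁, rfl⟩ := h
      have he₁ : e₁ ≠ 0 := right_ne_zero_of_mul he
      obtain ⟨g, e', h1, h2⟩ := ih e₁ ⟨he₁, C p, ((prime_C_iff σ).2 hp).not_isUnit, mul_comm _ _⟩ he₁
      exact ⟨p * g, e', by rw [C_mul, mul_assoc, ← h1], h2⟩
    · push Not at h
      exact ⟨1, e, by rw [C_1, one_mul], h⟩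

/-- A form of Gauss's lemma, by induction on the prime factors of `r`: a prime constant dividing `C
a * e` does not divide `e`, so it divides `a` and can be cancelled. -/
theorem dvd_of_C_mul_eq {e : MvPolynomial σ R} (he : e ≠ 0)
    (hprim : ∀ p : R, Prime p → ¬ C p ∣ e) (r : R) :
    ∀ (a : R) (x : MvPolynomial σ R), C r * x = C a * e → r ∣ a := by
  induction r using UniqueFactorizationMonoid.induction_on_prime with
  | h₁ =>
    intro a x h
    rw [C_0, zero_mul, eq_comm, mul_eq_zero, C_eq_zero] at h
    rw [h.resolve_right he]
  | h₂ r hr => exact fun a _ _ => hr.dvd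
  | h₃ r p hr hp ih =>
    intro a x h
    have h1 : C p ∣ C a * e := ⟨C r * x, by rw [← h, C_mul, mul_assoc]⟩
    have h2 : p ∣ a := by
      have := (((prime_C_iff σ).2 hp).dvd_or_dvd h1).resolve_right (hprim p hp)
      simpa using (C_dvd_iff_dvd_coeff p (C a)).1 this 0
    obtain ⟨b, rfl⟩ := h2
    refine mul_dvd_mul_left p (ih b x ?_)
    refine mul_left_cancel₀ ((prime_C_iff σ).2 hp).ne_zero ?_
    rw [← mul_assoc, ← C_mul, h, C_mul, mul_assoc]

end Primitive

section Equivariance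

variable {l : ℕ} {W : Subgroup (Euc l ≃ₗᵢ[ℝ] Euc l)}

theorem reynolds_act [Finite W] {R : Type*} [CommRing R] [Algebra ℂ R] {w : Euc l ≃ₗᵢ[ℝ] Euc l}
    (hw : w ∈ W) (p : MvPolynomial (Fin l) R) : reynolds W R (act R w p) = reynolds W R p := by
  have := Fintype.ofFinite W
  rw [reynolds_apply, reynolds_apply]
  refine congrArg _ (Fintype.sum_equiv (Equiv.mulRight (⟨w, hw⟩ : W)) _ _ fun u => ?_)
  exact (act_mul R u.1 w p).symm

variable [Finite (Refl W)] {R : Type*} [CommRing R] [Algebra ℂ R] [IsDomain R] {c : Refl W → R}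
  (hc : IsConjInvariant W c)

/-- In equal degrees the result is a constant, so equivariance becomes invariance. -/
theorem dunklHom_act_left {w : Euc l ≃ₗᵢ[ℝ] Euc l} (hw : w ∈ W) {n : ℕ}
    {p : MvPolynomial (Fin l) ℂ} (hp : p.IsHomogeneous n) {x : MvPolynomial (Fin l) R}
    (hx : x.IsHomogeneous n) :
    dunklHom hc (act ℂ w p) (act R w x) = dunklHom hc p x := by
  rw [dunklHom_act hc w hw, dunklHom_eq_C hc hp hx, act_C]

theorem dunklHom_reynolds [Finite W] {n : ℕ} {p : MvPolynomial (Fin l) ℂ} (hp : p.IsHomogeneous n)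
    {x : MvPolynomial (Fin l) R} (hx : x.IsHomogeneous n) (hxW : x ∈ invariants R W) :
    dunklHom hc (reynolds W ℂ p) x = dunklHom hc p x := by
  have := Fintype.ofFinite W
  have h : ∀ w : W, dunklHom hc (act ℂ w.1 p) x = dunklHom hc p x := fun w => by
    rw [← dunklHom_act_left hc w.2 hp hx, hxW w.1 w.2]
  have h2 : dunklHom hc (Fintype.card W • p) x = Fintype.card W • dunklHom hc p x := by
    rw [map_nsmul]; rfl
  conv_rhs => rw [← C_card_inv_mul (W := W) ℂ p]
  rw [reynolds_apply, map_mul, map_mul, Module.End.mul_apply, Module.End.mul_apply, map_sum,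
    LinearMap.sum_apply, Finset.sum_congr rfl fun w _ => h w, Finset.sum_const, Finset.card_univ,
    h2]

theorem mem_truncQHInv {d n : ℕ} {x : MvPolynomial (Fin l) R} : x ∈ truncQHInv c d n ↔
    (∀ k, 0 < k → k < d → ∀ p ∈ invariants ℂ W, p.IsHomogeneous k → dunklHom hc p x = 0) ∧
      x.IsHomogeneous n ∧ x ∈ invariants R W := by
  have h : x ∈ truncQHInv c d n ↔ (∀ k, 0 < k → k < d → ∀ p ∈ invariants ℂ W,
      p.IsHomogeneous k → dunklPoly c p x = 0) ∧ x.IsHomogeneous n ∧ x ∈ invariants R W :=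
    and_assoc
  simp only [h, dunklPoly_eq hc]

include hc in
theorem mem_truncQHInv_of_C_mul {d n : ℕ} {a : R} (ha : a ≠ 0) {x : MvPolynomial (Fin l) R}
    (h : C a * x ∈ truncQHInv c d n) : x ∈ truncQHInv c d n := by
  have ha' : (C a : MvPolynomial (Fin l) R) ≠ 0 := C_eq_zero.not.2 ha
  rw [mem_truncQHInv hc] at h ⊢
  obtain ⟨h1, h2, h3⟩ := h
  refine ⟨fun k hk hkd p hp hpk => ?_, ?_, fun w hw => ?_⟩
  · have := h1 k hk hkd p hp hpk
    rw [← smul_eq_C_mul, map_smul, smul_eq_C_mul] at this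
    exact (mul_eq_zero.1 this).resolve_left ha'
  · intro m hm
    exact h2 (by rw [coeff_C_mul]; exact mul_ne_zero ha hm)
  · have := h3 w hw
    rw [map_mul, act_C] at this
    exact mul_left_cancel₀ ha' this

end Equivariance

namespace IsBasicInvariants

variable {l : ℕ} {W : Subgroup (Euc l ≃ₗᵢ[ℝ] Euc l)} {f : Fin l → MvPolynomial (Fin l) ℂ}
  {d : Fin l → ℕ} (hf : IsBasicInvariants W f d)

include hf

theorem constantCoeff_aeval (H : MvPolynomial (Fin l) ℂ) :
    constantCoeff (aeval f H) = constantCoeff H := by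
  induction H using MvPolynomial.induction_on with
  | C a => simp [MvPolynomial.algebraMap_eq]
  | add p q hp hq => rw [map_add, map_add, map_add, hp, hq]
  | mul_X p j _ =>
    have : constantCoeff (f j) = 0 := hf.coeff_zero j
    simp [this]

/-- The linear coefficients of an invariant with respect to the basic invariants. -/
theorem exists_coeffs : ∃ φ : Fin l → MvPolynomial (Fin l) ℂ →ₗ[ℂ] ℂ,
    ∀ j H, φ j (aeval f H) = coeff (Finsupp.single j 1) H := by
  -- An arbitrary linear left inverse of the substitution `X i ↦ f i`; only its values on invariants
  -- are determined, and only those matter.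
  obtain ⟨g, hg⟩ := LinearMap.exists_leftInverse_of_injective
    (aeval f : MvPolynomial (Fin l) ℂ →ₐ[ℂ] _).toLinearMap (LinearMap.ker_eq_bot.2 hf.indep)
  refine ⟨fun j => lcoeff ℂ (Finsupp.single j 1) ∘ₗ g, fun j H => ?_⟩
  have : g (aeval f H) = H := LinearMap.congr_fun hg H
  rw [LinearMap.comp_apply, this, lcoeff_apply]

/-- The linear coefficient is a derivation at the origin, so it vanishes on products of invariants
without constant term. -/
theorem coeff_mul_eq_zero {φ : Fin l → MvPolynomial (Fin l) ℂ →ₗ[ℂ] ℂ}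
    (hφ : ∀ j H, φ j (aeval f H) = coeff (Finsupp.single j 1) H) {p q : MvPolynomial (Fin l) ℂ}
    (hp : p ∈ invariants ℂ W) (hq : q ∈ invariants ℂ W) (hp0 : constantCoeff p = 0)
    (hq0 : constantCoeff q = 0) (j : Fin l) : φ j (p * q) = 0 := by
  obtain ⟨H, rfl⟩ := hf.exists_aeval hp
  obtain ⟨K, rfl⟩ := hf.exists_aeval hq
  rw [hf.constantCoeff_aeval] at hp0 hq0
  have h : ∀ G : MvPolynomial (Fin l) ℂ, coeff (Finsupp.single j 1) G =
      constantCoeff (pderiv j G) := fun G => by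
    rw [constantCoeff_eq, coeff_pderiv]; simp
  rw [← map_mul, hφ, h, pderiv_mul, map_add, map_mul, map_mul, hp0, hq0]
  simp

variable [Finite W] [Finite (Refl W)] {R : Type*} [CommRing R] [Algebra ℂ R] [IsDomain R]
  {c : Refl W → R} (hc : IsConjInvariant W c)

/-- `e` represents, up to the factor `det`, the functional that averages a polynomial and takes its
coefficient at `f j`. This functional is `W`-invariant, so `e` is invariant; it vanishes on
multiples of invariants of lower positive degree, so `e` lies in the truncated space. -/
theorem exists_dual_mem (hdet : ∀ n, (pairMatrix hc n).det ≠ 0) {n : ℕ} {j : Fin l}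
    (hj : d j = n) : ∃ e ∈ truncQHInv c n n, ∀ i, d i = n →
      pair hc (f i) e = (pairMatrix hc n).det * if i = j then 1 else 0 := by
  subst hj
  obtain ⟨φ, hφ⟩ := hf.exists_coeffs
  obtain ⟨e, he, hpair⟩ := exists_dual hc (n := d j) (φ j ∘ₗ reynolds W ℂ)
  refine ⟨e, (mem_truncQHInv hc).2 ⟨fun k hk hkd q hq hqk => ?_, he, fun w hw => ?_⟩,
    fun i hi => ?_⟩
  -- Pairing `∇_q e` with any `r` of the complementary degree is pairing `e` with `q * r`.
  · refine eq_zero_of_pairMatrix hc (hdet _) (dunklHom_isHomogeneous hc hqk he) fun r hr => ?_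
    have hqr : (q * r).IsHomogeneous (d j) := by
      have := hqk.mul hr
      rwa [Nat.add_sub_cancel' hkd.le] at this
    rw [← Module.End.mul_apply, ← map_mul, mul_comm, dunklHom_eq_C hc hqr he, hpair _ hqr,
      LinearMap.comp_apply, reynolds_mul_of_mem W ℂ hq, hf.coeff_mul_eq_zero hφ hq
        (reynolds_mem W ℂ r) (hqk.coeff_eq_zero (by simpa using hk.ne))
        ((reynolds_isHomogeneous W ℂ hr).coeff_eq_zero (by simp; omega)) j, map_zero, mul_zero, C_0]
  · rw [← sub_eq_zero]
    have he' := act_isHomogeneous R w he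
    refine eq_zero_of_pairMatrix hc (hdet _) (he'.sub he) fun p hp => ?_
    have hp' := act_isHomogeneous ℂ w⁻¹ hp
    have h1 : act ℂ w (act ℂ w⁻¹ p) = p := by
      rw [← act_mul, mul_inv_cancel, act_one]
    have h2 := dunklHom_act_left hc hw hp' he
    rw [h1] at h2
    rw [map_sub, h2, dunklHom_eq_C hc hp' he, dunklHom_eq_C hc hp he, hpair _ hp', hpair _ hp,
      LinearMap.comp_apply, LinearMap.comp_apply, reynolds_act (W.inv_mem hw), sub_self]
  · rw [hpair _ (hi ▸ hf.hom i), LinearMap.comp_apply, reynolds_of_mem W ℂ (hf.mem i)]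
    have h1 : f i = aeval f (X i : MvPolynomial (Fin l) ℂ) := (aeval_X f i).symm
    rw [h1, hφ, coeff_X]
    by_cases hij : i = j
    · subst hij; simp
    · rw [if_neg hij, if_neg fun h => hij (Finsupp.single_left_injective one_ne_zero h), map_zero]

/-- Against an invariant `x` only the average of `p` counts, and this is a polynomial in the `f j`.
Each of its monomials contains some `f j` of degree at most `n`, and `∇` of that kills `x`: by
truncation below degree `n`, by hypothesis in degree `n`. -/
theorem eq_zero_of_mem (hdet : ∀ n, (pairMatrix hc n).det ≠ 0) {n : ℕ} (hn : 0 < n)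
    {x : MvPolynomial (Fin l) R} (hx : x ∈ truncQHInv c n n)
    (h : ∀ j, d j = n → dunklHom hc (f j) x = 0) : x = 0 := by
  obtain ⟨h1, h2, h3⟩ := (mem_truncQHInv hc).1 hx
  refine eq_zero_of_pairMatrix hc (hdet n) h2 fun p hp => ?_
  rw [← dunklHom_reynolds hc hp h2 h3]
  obtain ⟨H, hH⟩ := hf.exists_aeval (reynolds_mem W ℂ p)
  have hhom := homogeneousComponent_of_mem (m := n) (reynolds_isHomogeneous W ℂ hp)
  rw [if_pos rfl, ← hH, homogeneousComponent_aeval hf.hom] at hhom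
  rw [← hH, ← hhom]
  set H' := weightedHomogeneousComponent d n H with hH'
  have hw : H'.IsWeightedHomogeneous d n := weightedHomogeneousComponent_isWeightedHomogeneous n H
  rw [H'.as_sum, map_sum, map_sum, LinearMap.sum_apply]
  refine Finset.sum_eq_zero fun m hm => ?_
  have hwm := hw (mem_support_iff.1 hm)
  obtain ⟨j, hj⟩ : ∃ j, m j ≠ 0 := by
    by_contra! h0
    rw [show m = 0 from Finsupp.ext h0, map_zero] at hwm
    exact hn.ne hwm
  have hm' : m - Finsupp.single j 1 + Finsupp.single j 1 = m :=
    tsub_add_cancel_of_le (by simpa using Nat.one_le_iff_ne_zero.2 hj)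
  rw [← hm', map_add, Finsupp.weight_single, one_smul] at hwm
  rw [← hm', monomial_add_single, pow_one, map_mul, aeval_X, map_mul, Module.End.mul_apply]
  have hzero : dunklHom hc (f j) x = 0 := by
    rcases (show d j ≤ n by omega).eq_or_lt with hdj | hdj
    · exact h j hdj
    · exact h1 (d j) (hf.pos j) hdj (f j) (hf.mem j) (hf.hom j)
  rw [hzero, map_zero]

/-- Pairing with the basic invariants of degree `d i` gives the coordinates: injective by
`eq_zero_of_mem`, surjective by the dual elements. -/
theorem finrank_truncQHInv {c : Refl W → ℂ} (hc : IsRegularParam c) (i : Fin l) :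
    Module.finrank ℂ (truncQHInv c (d i) (d i)) = Fintype.card {j // d j = d i} := by
  classical
  let F : truncQHInv c (d i) (d i) →ₗ[ℂ] ({j // d j = d i} → ℂ) :=
    LinearMap.pi fun j => lcoeff ℂ 0 ∘ₗ dunklHom hc.1 (f j.1) ∘ₗ Submodule.subtype _
  have hF : ∀ x j, F x j = pair hc.1 (f j.1) x.1 := fun x j => rfl
  have hinj : Function.Injective F := by
    rw [injective_iff_map_eq_zero]
    intro x hx
    have h1 := ((mem_truncQHInv hc.1).1 x.2).2.1
    refine Subtype.ext (hf.eq_zero_of_mem hc.1 hc.pairMatrix_ne_zero (hf.pos i) x.2 fun j hj => ?_)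
    rw [dunklHom_eq_C hc.1 (hj ▸ hf.hom j) h1, ← hF x ⟨j, hj⟩, hx, Pi.zero_apply, C_0]
  have hsurj : Function.Surjective F := by
    intro g
    have hex : ∀ j : {j // d j = d i}, ∃ e ∈ truncQHInv c (d i) (d i), ∀ k, d k = d i →
        pair hc.1 (f k) e = (pairMatrix hc.1 (d i)).det * if k = j.1 then 1 else 0 :=
       fun j => hf.exists_dual_mem hc.1 hc.pairMatrix_ne_zero j.2
    choose e he hpair using hex
    have hD := hc.pairMatrix_ne_zero (d i)
    refine ⟨∑ j, (g j / (pairMatrix hc.1 (d i)).det) • (⟨e j, he j⟩ : truncQHInv c (d i) (d i)),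
      funext fun k => ?_⟩
    rw [map_sum, Finset.sum_apply, Finset.sum_eq_single k]
    · rw [map_smul, Pi.smul_apply, hF, hpair k k.1 k.2, if_pos rfl, mul_one, smul_eq_mul,
        div_mul_cancel₀ _ hD]
    · intro j _ hjk
      rw [map_smul, Pi.smul_apply, hF, hpair j k.1 k.2, if_neg fun h => hjk (Subtype.ext h).symm,
        mul_zero, smul_zero]
    · simp
  rw [(LinearEquiv.ofBijective F ⟨hinj, hsurj⟩).finrank_eq, Module.finrank_fintype_fun_eq_card]

/-- Freed of constant prime factors, the dual element becomes the generator `e`. Any `x` satisfies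
`r x = a e₀ = a g e`, with `r` and `a` the pairings of `f i` with `e₀` and `x`; as `e` has no
constant prime factor, `r` divides `a g`. -/
theorem exists_generator_univParam (i : Fin l) (hi : ∀ j, d j = d i → j = i) :
    ∃ e ∈ truncQHInv (univParam W) (d i) (d i), e ≠ 0 ∧
      ∀ x ∈ truncQHInv (univParam W) (d i) (d i),
        ∃ a : MvPolynomial (ReflClass W) ℂ, x = a • e := by
  have hc := univParam_isConjInvariant (W := W)
  have hdet := pairMatrix_univParam_ne_zero (W := W)
  obtain ⟨e₀, he₀, hpair⟩ := hf.exists_dual_mem hc hdet (j := i) rfl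
  have h0 : pair hc (f i) e₀ ≠ 0 := by
    rw [hpair i rfl, if_pos rfl, mul_one]
    exact hdet _
  have he₀' : e₀ ≠ 0 := fun h => h0 (by rw [h, pair, map_zero, MvPolynomial.coeff_zero])
  obtain ⟨g, e, hge, hprim⟩ := exists_primitive_factor e₀ he₀'
  rw [hge] at he₀'
  have hg : g ≠ 0 := fun h => he₀' (by rw [h, C_0, zero_mul])
  have he : e ≠ 0 := right_ne_zero_of_mul he₀'
  refine ⟨e, mem_truncQHInv_of_C_mul hc hg (hge ▸ he₀), he, fun x hx => ?_⟩
  set r := pair hc (f i) e₀ with hr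
  set a := pair hc (f i) x with ha
  have h1 : C r * x = C (a * g) * e := by
    rw [C_mul, mul_assoc, ← hge, ← sub_eq_zero, ← smul_eq_C_mul, ← smul_eq_C_mul]
    refine hf.eq_zero_of_mem hc hdet (hf.pos i) (sub_mem (Submodule.smul_mem _ _ hx)
      (Submodule.smul_mem _ _ he₀)) fun j hj => ?_
    rw [hi j hj, map_sub, map_smul, map_smul,
      dunklHom_eq_C hc (hf.hom i) ((mem_truncQHInv hc).1 hx).2.1,
      dunklHom_eq_C hc (hf.hom i) ((mem_truncQHInv hc).1 he₀).2.1, ← hr, ← ha, smul_eq_C_mul,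
      smul_eq_C_mul, mul_comm, sub_self]
  obtain ⟨b, hb⟩ := dvd_of_C_mul_eq he hprim r _ _ h1
  refine ⟨b, mul_left_cancel₀ (C_eq_zero.not.2 h0) ?_⟩
  rw [h1, hb, C_mul, mul_assoc, smul_eq_C_mul]

end IsBasicInvariants

end QuasiHarmonics

end CoxeterQH

theorem mainTheorem5 (l : ℕ) (W : Subgroup (Euc l ≃ₗᵢ[ℝ] Euc l))
    (hW : IsIrreducibleReflectionGroup W) :
    (∃ d : Fin l → ℕ, IsDegrees W d) ∧
    ∀ d : Fin l → ℕ, IsDegrees W d →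
      (∀ i : Fin l, ∀ c : Refl W → ℂ, IsRegularParam c →
        ((∀ j, j ≠ i → d j ≠ d i) → Module.finrank ℂ (truncQHInv c (d i) (d i)) = 1) ∧
        ((∃ j, j ≠ i ∧ d j = d i) → Module.finrank ℂ (truncQHInv c (d i) (d i)) = 2) ∧
        ((i : ℕ) + 1 = l → Module.finrank ℂ (truncQHInv c (d i) (d i)) = 1)) ∧
      (Function.Injective d → ∀ i : Fin l,
        (∃ e ∈ truncQHInv (univParam W) (d i) (d i), e ≠ 0 ∧
          ∀ x ∈ truncQHInv (univParam W) (d i) (d i),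
            ∃ a : MvPolynomial (ReflClass W) ℂ, x = a • e) ∧
        (∀ c : Refl W → ℂ, IsRegularParam c →
          ∃ e ∈ truncQHInv c (d i) (d i), e ≠ 0 ∧
            ∀ x ∈ truncQHInv c (d i) (d i), ∃ a : ℂ, x = a • e)) := by
  classical
  have := hW.finite
  have := finite_refl (W := W) this
  refine ⟨exists_isDegrees hW.generated, fun d hd => ?_⟩
  obtain ⟨f, hf⟩ := hd.exists_basic
  have hmult : (∀ i j k, d i = d j → d i = d k → i = j ∨ j = k ∨ i = k) ∧
      ∀ i j, (∀ k, d k ≤ d i) → d j = d i → j = i := by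
    -- In rank at most one there is a single index and nothing to prove.
    rcases Nat.lt_or_ge l 2 with hl | hl
    · have : Subsingleton (Fin l) := Fin.subsingleton_iff_le_one.2 (by omega)
      exact ⟨fun i j _ _ _ => Or.inl (Subsingleton.elim i j),
        fun i j _ _ => Subsingleton.elim j i⟩
    · exact hf.degree_multiplicity hW hl
  have hone : ∀ i, (∀ j, d j = d i → j = i) → ∀ c : Refl W → ℂ, IsRegularParam c →
      Module.finrank ℂ (truncQHInv c (d i) (d i)) = 1 := fun i hi c hc => by
    rw [hf.finrank_truncQHInv hc, Fintype.card_eq_one_iff]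
    exact ⟨⟨i, rfl⟩, fun j => Subtype.ext (hi j.1 j.2)⟩
  refine ⟨fun i c hc => ⟨fun h => ?_, fun ⟨j, hji, hj⟩ => ?_, fun h => ?_⟩, fun hinj i => ⟨?_, ?_⟩⟩
  · exact hone i (fun j hj => by_contra fun hne => h j hne hj) c hc
  · rw [hf.finrank_truncQHInv hc, Fintype.card_subtype]
    have h : (Finset.univ.filter fun k => d k = d i) = {i, j} := by
      ext k
      rw [Finset.mem_filter, Finset.mem_insert, Finset.mem_singleton]
      refine ⟨fun hk => ?_, ?_⟩
      · rcases hmult.1 i j k hj.symm hk.2.symm with h | h | h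
        · exact absurd h.symm hji
        · exact Or.inr h.symm
        · exact Or.inl h.symm
      · rintro (rfl | rfl)
        · exact ⟨Finset.mem_univ _, rfl⟩
        · exact ⟨Finset.mem_univ _, hj⟩
    rw [h, Finset.card_pair hji.symm]
  -- The degrees are increasing, so the last index attains the maximum.
  · exact hone i (fun j => hmult.2 i j fun k => hd.1 (by
      rw [Fin.le_def]
      omega)) c hc
  · exact hf.exists_generator_univParam i fun j hj => hinj hj
  · intro c hc
    obtain ⟨v, hv, hv'⟩ := finrank_eq_one_iff'.1 (hone i (fun j hj => hinj hj) c hc)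
    refine ⟨v.1, v.2, fun h => hv (Subtype.ext h), fun x hx => ?_⟩
    obtain ⟨a, ha⟩ := hv' ⟨x, hx⟩
    exact ⟨a, (congrArg Subtype.val ha).symm⟩
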